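/- Let $\mathcal L_{ring}=\{+,\cdot,-,0,1\}$ be the first-order language of rings. A $\forall^1\exists^1$ sentence is a sentence of the form $\forall x\,\exists y\,\varphi(x,y)$ with $\varphi$ a quantifier-free $\mathcal L_{ring}$-formula in (at most) the variables $x,y$. The $\forall^1\exists^1$ theory of infinite fields is the set of all $\forall^1\exists^1$ sentences that are true in every infinite field (of arbitrary characteristic). **Proposition.** The $\forall^1\exists^1$ theory of infinite fields is decidable: the set of Gödel numbers of its sentences is a recursive set of natural numbers. -/

import Mathlib

universe u

namespace InfiniteFields

open FirstOrder FirstOrder.Language FirstOrder.Ring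

/-- Gödel number of a term of the language of rings `(+, *, -, 0, 1)` whose variables are numbered
by `v`. -/
def termCode {α : Type} (v : α → ℕ) : Language.ring.Term α → ℕ
  | .var a => Nat.pair 0 (v a)
  | .func ringFunc.zero _ => Nat.pair 1 0
  | .func ringFunc.one _ => Nat.pair 2 0
  | .func ringFunc.neg ts => Nat.pair 3 (termCode v (ts 0))
  | .func ringFunc.add ts => Nat.pair 4 (Nat.pair (termCode v (ts 0)) (termCode v (ts 1)))
  | .func ringFunc.mul ts => Nat.pair 5 (Nat.pair (termCode v (ts 0)) (termCode v (ts 1)))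

/-- The number of a variable: there are no free variables, and the variable bound by the
outermost quantifier has number `0`, the one bound by the next quantifier has number `1`, ... -/
def varCode {n : ℕ} : Empty ⊕ Fin n → ℕ :=
  Sum.elim Empty.elim (fun i => (i : ℕ))

/-- Gödel number of a formula of the language of rings (built from `⊥`, `=`, `→`, `∀`; the
language has no relation symbols). -/
def formulaCode : {n : ℕ} → Language.ring.BoundedFormula Empty n → ℕ
  | _, .falsum => Nat.pair 0 0
  | _, .equal s t => Nat.pair 1 (Nat.pair (termCode varCode s) (termCode varCode t))
  | _, .rel R _ => Empty.elim R
  | _, .imp φ ψ => Nat.pair 2 (Nat.pair (formulaCode φ) (formulaCode ψ))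
  | _, .all φ => Nat.pair 3 (formulaCode φ)

/-- Gödel number of a sentence of the language of rings. -/
def sentenceCode (ψ : Language.ring.Sentence) : ℕ :=
  formulaCode (n := 0) ψ

theorem varCode_injective {n : ℕ} : Function.Injective (varCode (n := n)) := by
  rintro (a | i) (b | j) h
  · exact a.elim
  · exact a.elim
  · exact b.elim
  · simpa [varCode, Fin.ext_iff] using h

theorem termCode_injective {α : Type} {v : α → ℕ} (hv : Function.Injective v) :
    Function.Injective (termCode v) := by
  intro s
  induction s with
  | var a =>
    intro t h
    cases t with
    | var b => simpa [termCode, hv.eq_iff] using h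
    | func g us => cases g <;> simp [termCode] at h
  | func f ts ih =>
    intro t h
    cases t with
    | var b => cases f <;> simp [termCode] at h
    | func g us =>
      cases f <;> cases g <;> simp [termCode] at h
      · congr 1; funext i; fin_cases i
        · exact ih 0 h.1
        · exact ih 1 h.2
      · congr 1; funext i; fin_cases i
        · exact ih 0 h.1
        · exact ih 1 h.2
      · congr 1; funext i; fin_cases i
        exact ih 0 h
      · congr 1; funext i; exact i.elim0
      · congr 1; funext i; exact i.elim0

theorem formulaCode_injective {n : ℕ} :
    Function.Injective (formulaCode (n := n)) := by
  intro φ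
  induction φ with
  | falsum => intro ψ h; cases ψ with
    | rel R _ => exact Empty.elim R
    | _ => simp_all [formulaCode]
  | equal s t => intro ψ h; cases ψ with
    | rel R _ => exact Empty.elim R
    | equal s' t' =>
      simp only [formulaCode, Nat.pair_eq_pair, true_and] at h
      rw [termCode_injective varCode_injective h.1, termCode_injective varCode_injective h.2]
    | _ => simp [formulaCode] at h
  | rel R _ => exact Empty.elim R
  | imp φ₁ φ₂ ih₁ ih₂ => intro ψ h; cases ψ with
    | rel R _ => exact Empty.elim R
    | imp ψ₁ ψ₂ =>
      simp only [formulaCode, Nat.pair_eq_pair, true_and] at h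
      rw [ih₁ h.1, ih₂ h.2]
    | _ => simp [formulaCode] at h
  | all φ ih => intro ψ h; cases ψ with
    | rel R _ => exact Empty.elim R
    | all ψ =>
      simp only [formulaCode, Nat.pair_eq_pair, true_and] at h
      rw [ih h]
    | _ => simp [formulaCode] at h

/-- Distinct sentences have distinct Gödel numbers. -/
theorem sentenceCode_injective : Function.Injective sentenceCode :=
  fun _ _ h => formulaCode_injective h

/-- `ψ` is a sentence `∀ x, ∃ y, φ(x, y)` with `φ` quantifier-free. -/
def IsForallExistsSentence (ψ : Language.ring.Sentence) : Prop :=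
  ∃ φ : Language.ring.BoundedFormula Empty 2, φ.IsQF ∧ ψ = φ.ex.all

/-- The `∀¹∃¹` theory of infinite fields: the `∀¹∃¹` sentences of the language of rings that are
true in every infinite field, of any characteristic. -/
def forallExistsTheory : Set Language.ring.Sentence :=
  {ψ | IsForallExistsSentence ψ ∧
    ∀ (K : Type u) [Field K] [Infinite K] [CompatibleRing K], K ⊨ ψ}

end InfiniteFields

/-!
# Decidability of the `∀¹∃¹` theory of infinite fields

A sentence `∀ x, ∃ y, φ(x, y)` is coded by a number `c`, the code of `φ`. By Post's theorem
(`computablePred_theory`) it is enough that the truth in all infinite fields, `Valid c`, and its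
negation are both recursively enumerable. Formulas are evaluated directly on their codes, by `evT`
and `evF`, in arbitrary commutative rings.

**Validity** (`rePred_valid`) is the easy half. By Herbrand's theorem, `Valid c` holds exactly if
for some `N` every assignment of truth values to the first `N` equations between closed terms (in
a constant for `x`, names for inverses and infinitely many further constants) violates a field
axiom or makes `φ(x, y)` true at one of the first `N` terms `y`. If there is no such `N`, then the
assignments that avoid both have an ultrafilter limit, which is the diagram of an infinite field
in which the sentence fails.

**Falsity** (`rePred_not_valid`) rests on certificates that live in finite fields, the predicate
`FiniteRefutation`. Over a field `K ∋ x`, the truth of `φ(x, y)` depends on `y` only if `y` is one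
of the at most `c + 1` roots of the nonzero atomic polynomials `f(x, Y)` of `φ`
(`exists_exceptional_set`). In the following fields these roots can be bounded.

* `K = k(X)` with `k` finite and `x = t ∈ k`. A root in `K` of a polynomial over `k` is in `k`. So
  if `k` has more than `c + 1` elements and `φ(t, y)` fails for all `y ∈ k`, it fails for all `y ∈
  K`.
* `K = 𝔽_p(X)` or `K = ℚ(X)`, and `x = X`. A root is a fraction `u(x) / v(x)`, where `u` and `v`
  divide coefficients of `f`, so that their degrees and coefficients are bounded, by Mignotte's
  bound in characteristic zero.
* `K = ℚ(a)` is a number field, and `x = a`. A root is again a fraction `u(a) / v(a)` with bounded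
  integer polynomials `u` and `v` (`exists_fraction_numberField`): multiplied by a leading
  coefficient it is integral with bounded conjugates, and multiplied by the different of the
  generator it becomes an integer polynomial in the generator, the coefficients of which are
  traces.

In the last two cases the failure of `φ(x, y)` for all `y ∈ K` therefore follows from its failure
for all `y = u(x) / v(x)` with `u` and `v` in an explicit finite box, large enough to contain an
element that is not a root as well. This depends only on the question which integer polynomials up
to an explicit size vanish at `x`, and can be checked at an element `t` of a finite field at which
the same ones vanish (`fails_of_boxFails`). This gives the soundness of certificates,
`not_valid_of_finiteRefutation`.

Certificates are also complete (`exists_finiteRefutation`). Let `φ(a, y)` fail for all `y` in an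
infinite field. If `a` is transcendental over the prime field or algebraic over `ℚ`, then `a` has
an imitation `t` in a finite field, because `ℤ[X]` is a Jacobson ring with finite residue fields
(`exists_finite_field_imitation`). If `a` generates a finite field `k`, then `φ(a, y)` fails for
all `y` in the extension of `k` of prime degree `ℓ > c + 1`: every root of an atomic polynomial in
that extension has degree less than `ℓ` over `k`, hence is in `k`, and at all other `y` the formula
has the truth value that it has at generic elements of the given infinite field.

Finally, finite fields are given by tables of their operations, and it is a primitive recursive
property of a table, an element and the size parameters that they form a certificate
(`TableRefutation`).
-/

namespace InfiniteFields

open Nat (pair unpair)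

/-! ### Primitive recursive functions and predicates -/

attribute [fun_prop] Primrec
attribute [fun_prop] PrimrecPred

section PrimrecRules

variable {α β γ : Type*} [Primcodable α] [Primcodable β] [Primcodable γ]

@[fun_prop] theorem primrec_id : Primrec (fun a : α => a) := Primrec.id

@[fun_prop] theorem primrec_const (b : β) : Primrec (fun _ : α => b) := Primrec.const b

@[fun_prop] theorem primrec_fst : Primrec (fun p : α × β => p.1) := Primrec.fst

@[fun_prop] theorem primrec_snd : Primrec (fun p : α × β => p.2) := Primrec.snd

@[fun_prop] theorem primrec_comp {f : β → γ} {g : α → β} (hf : Primrec f) (hg : Primrec g) :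
    Primrec (fun a => f (g a)) := hf.comp hg

@[fun_prop] theorem primrec_mk {f : α → β} {g : α → γ} (hf : Primrec f) (hg : Primrec g) :
    Primrec (fun a => (f a, g a)) := hf.pair hg

@[fun_prop] theorem primrec_add {f g : α → ℕ} (hf : Primrec f) (hg : Primrec g) :
    Primrec (fun a => f a + g a) := Primrec.nat_add.comp hf hg

@[fun_prop] theorem primrec_mul {f g : α → ℕ} (hf : Primrec f) (hg : Primrec g) :
    Primrec (fun a => f a * g a) := Primrec.nat_mul.comp hf hg

@[fun_prop] theorem primrec_div {f g : α → ℕ} (hf : Primrec f) (hg : Primrec g) :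
    Primrec (fun a => f a / g a) := Primrec.nat_div.comp hf hg

@[fun_prop] theorem primrec_mod {f g : α → ℕ} (hf : Primrec f) (hg : Primrec g) :
    Primrec (fun a => f a % g a) := Primrec.nat_mod.comp hf hg

@[fun_prop] theorem primrec_natPair {f g : α → ℕ} (hf : Primrec f) (hg : Primrec g) :
    Primrec (fun a => pair (f a) (g a)) := Primrec₂.natPair.comp hf hg

@[fun_prop] theorem primrec_pow {f g : α → ℕ} (hf : Primrec f) (hg : Primrec g) :
    Primrec (fun a => f a ^ g a) := (Primrec₂.unpaired'.1 Nat.Primrec.pow).comp hf hg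

@[fun_prop] theorem primrec_unpair {f : α → ℕ} (hf : Primrec f) :
    Primrec (fun a => unpair (f a)) := Primrec.unpair.comp hf

@[fun_prop] theorem primrec_getD {f : α → List β} {g : α → ℕ} (d : β) (hf : Primrec f)
    (hg : Primrec g) : Primrec (fun a => (f a).getD (g a) d) := (Primrec.list_getD d).comp hf hg

@[fun_prop] theorem primrec_length {f : α → List β} (hf : Primrec f) :
    Primrec (fun a => (f a).length) := Primrec.list_length.comp hf

@[fun_prop] theorem primrecPred_lt {f g : α → ℕ} (hf : Primrec f) (hg : Primrec g) :
    PrimrecPred (fun a => f a < g a) := Primrec.nat_lt.comp hf hg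

@[fun_prop] theorem primrecPred_le {f g : α → ℕ} (hf : Primrec f) (hg : Primrec g) :
    PrimrecPred (fun a => f a ≤ g a) := Primrec.nat_le.comp hf hg

@[fun_prop] theorem primrecPred_eq {f g : α → β} (hf : Primrec f) (hg : Primrec g) :
    PrimrecPred (fun a => f a = g a) := Primrec.eq.comp hf hg

@[fun_prop] theorem primrecPred_and {p q : α → Prop} (hp : PrimrecPred p) (hq : PrimrecPred q) :
    PrimrecPred (fun a => p a ∧ q a) := hp.and hq

@[fun_prop] theorem primrecPred_or {p q : α → Prop} (hp : PrimrecPred p) (hq : PrimrecPred q) :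
    PrimrecPred (fun a => p a ∨ q a) := hp.or hq

@[fun_prop] theorem primrecPred_not {p : α → Prop} (hp : PrimrecPred p) :
    PrimrecPred (fun a => ¬ p a) := hp.not

@[fun_prop] theorem primrecPred_comp {p : β → Prop} {f : α → β} (hp : PrimrecPred p)
    (hf : Primrec f) : PrimrecPred (fun a => p (f a)) := hp.comp hf

@[fun_prop] theorem primrec_ite {p : α → Prop} [DecidablePred p] {f g : α → β}
    (hp : PrimrecPred p) (hf : Primrec f) (hg : Primrec g) :
    Primrec (fun a => if p a then f a else g a) := Primrec.ite hp hf hg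

/-- The bounded quantifier `∀ i < n, p i`, as a constant so that `fun_prop` can treat it as a
function of `n` and `p`. -/
def BAll (n : ℕ) (p : ℕ → Prop) : Prop := ∀ i < n, p i

/-- The bounded quantifier `∃ i < n, p i`. -/
def BEx (n : ℕ) (p : ℕ → Prop) : Prop := ∃ i < n, p i

@[fun_prop] theorem primrecPred_bAll {n : α → ℕ} {p : α → ℕ → Prop} (hn : Primrec n)
    (hp : PrimrecPred (fun q : α × ℕ => p q.1 q.2)) :
    PrimrecPred (fun a => BAll (n a) (p a)) := by
  have h : PrimrecRel (fun (i : ℕ) (a : α) => p a i) := hp.comp (Primrec.snd.pair Primrec.fst)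
  have h' : PrimrecPred (fun a => ∀ i ∈ List.range (n a), p a i) :=
    h.forall_mem_list.comp (Primrec.list_range.comp hn) Primrec.id
  exact h'.of_eq fun a => by simp [BAll]

@[fun_prop] theorem primrecPred_bEx {n : α → ℕ} {p : α → ℕ → Prop} (hn : Primrec n)
    (hp : PrimrecPred (fun q : α × ℕ => p q.1 q.2)) :
    PrimrecPred (fun a => BEx (n a) (p a)) := by
  have h : PrimrecPred (fun a => ¬ BAll (n a) (fun i => ¬ p a i)) := by fun_prop
  exact h.of_eq fun a => by simp [BAll, BEx]

/-- Iteration with a counter: `s₀ = z`, `sᵢ₊₁ = step i sᵢ`. -/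
def iter {σ : Type*} (z : σ) (step : ℕ → σ → σ) (n : ℕ) : σ :=
  Nat.rec z step n

@[fun_prop] theorem primrec_iter {n : α → ℕ} {z : α → β} {step : α → ℕ → β → β} (hn : Primrec n)
    (hz : Primrec z) (hs : Primrec (fun q : α × ℕ × β => step q.1 q.2.1 q.2.2)) :
    Primrec (fun a => iter (z a) (step a) (n a)) :=
  Primrec.nat_rec' (h := fun a q => step a q.1 q.2) hn hz hs

/-- A set of the form `{a | ∃ w, R a w}` with `R` primitive recursive is recursively
enumerable. -/
theorem rePred_exists {R : α → β → Prop} (hR : PrimrecPred (fun q : α × β => R q.1 q.2)) :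
    REPred (fun a => ∃ w, R a w) := by
  classical
  have h1 : PrimrecPred (fun q : α × ℕ => ∃ w ∈ (Encodable.decode (α := β) q.2).toList,
      R q.1 w) := by
    have h2 : PrimrecRel (fun (w : β) (a : α) => R a w) :=
      hR.comp (Primrec.snd.pair Primrec.fst)
    have h3 : Primrec (fun q : α × ℕ => (Encodable.decode (α := β) q.2).toList) :=
      Primrec.optionToList.comp (Primrec.decode.comp Primrec.snd)
    exact h2.exists_mem_list.comp h3 Primrec.fst
  obtain ⟨_, h1⟩ := h1
  have h4 := Partrec.dom_re (Partrec.rfind (p := fun (a : α) (n : ℕ) =>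
    (Part.some (decide (∃ w ∈ (Encodable.decode (α := β) n).toList, R a w)) : Part Bool))
    (by
      have := h1.to_comp.partrec
      exact this.of_eq fun q => by simp))
  refine h4.of_eq fun a => ?_
  refine Nat.rfind_dom.trans ?_
  simp only [Part.mem_some_iff, Part.some_dom, implies_true, and_true]
  constructor
  · rintro ⟨n, hn⟩
    obtain ⟨w, -, hw⟩ := of_decide_eq_true hn.symm
    exact ⟨w, hw⟩
  · rintro ⟨w, hw⟩
    exact ⟨Encodable.encode w, (decide_eq_true ⟨w, by simp [Option.toList], hw⟩).symm⟩

end PrimrecRules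

/-! ### Recursion on codes -/

/-- Recursion along the tree structure of codes: the value at `c = pair t r` may use the values at
`r` and at the two components of `r`. Values at numbers that are not below `c` are replaced by
`d`. -/
def treeRec {α : Type*} {σ : Type*} (d : σ) (G : α → ℕ → σ → σ → σ → σ) (a : α) (c : ℕ) : σ :=
  G a c (if _h : (unpair c).2 < c then treeRec d G a (unpair c).2 else d)
    (if _h : (unpair (unpair c).2).1 < c then treeRec d G a (unpair (unpair c).2).1 else d)
    (if _h : (unpair (unpair c).2).2 < c then treeRec d G a (unpair (unpair c).2).2 else d)
termination_by c

theorem lt_pair_of_pos {t r : ℕ} (ht : 1 ≤ t) : r < pair t r := by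
  have := Nat.add_le_pair t r
  omega

theorem treeRec_pair {α : Type*} {σ : Type*} (d : σ) (G : α → ℕ → σ → σ → σ → σ) (a : α)
    {t r : ℕ} (ht : 1 ≤ t) :
    treeRec d G a (pair t r) = G a (pair t r) (treeRec d G a r) (treeRec d G a (unpair r).1)
      (treeRec d G a (unpair r).2) := by
  rw [treeRec]
  have h := lt_pair_of_pos (r := r) ht
  have h1 := Nat.unpair_left_le r
  have h2 := Nat.unpair_right_le r
  simp only [Nat.unpair_pair]
  rw [dif_pos h, dif_pos (by omega), dif_pos (by omega)]

theorem primrec_treeRec {α σ : Type*} [Primcodable α] [Primcodable σ] (d : σ)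
    {G : α → ℕ → σ → σ → σ → σ}
    (hG : Primrec (fun q : α × ℕ × σ × σ × σ => G q.1 q.2.1 q.2.2.1 q.2.2.2.1 q.2.2.2.2)) :
    Primrec (fun q : α × ℕ => treeRec d G q.1 q.2) := by
  have key : Primrec₂ (fun (a : α) (c : ℕ) => treeRec d G a c) := by
    refine Primrec.nat_strong_rec _ (g := fun a l => some (G a l.length
      (l.getD (unpair l.length).2 d) (l.getD (unpair (unpair l.length).2).1 d)
      (l.getD (unpair (unpair l.length).2).2 d))) ?_ ?_
    · have : Primrec (fun q : α × List σ => some (G q.1 q.2.length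
        (q.2.getD (unpair q.2.length).2 d) (q.2.getD (unpair (unpair q.2.length).2).1 d)
        (q.2.getD (unpair (unpair q.2.length).2).2 d))) := by
        refine Primrec.option_some.comp (hG.comp (g := fun q : α × List σ => (q.1, q.2.length,
          q.2.getD (unpair q.2.length).2 d, q.2.getD (unpair (unpair q.2.length).2).1 d,
          q.2.getD (unpair (unpair q.2.length).2).2 d)) ?_)
        fun_prop
      exact this
    · intro a n
      have hget : ∀ m, ((List.range n).map (treeRec d G a)).getD m d =
          if _h : m < n then treeRec d G a m else d := by
        intro m
        by_cases hm : m < n <;> simp [List.getD, hm]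
      simp only [List.length_map, List.length_range, hget]
      conv_rhs => rw [treeRec]
  exact key

/-- Selection by the tag of a code. -/
def byTag {σ : Type*} (t : ℕ) (x₀ x₁ x₂ x₃ x₄ x₅ x₆ : σ) : σ :=
  if t = 0 then x₀ else if t = 1 then x₁ else if t = 2 then x₂ else if t = 3 then x₃ else
    if t = 4 then x₄ else if t = 5 then x₅ else x₆

section byTag
variable {σ : Type*} (x₀ x₁ x₂ x₃ x₄ x₅ x₆ : σ)
@[simp] theorem byTag_zero : byTag 0 x₀ x₁ x₂ x₃ x₄ x₅ x₆ = x₀ := rfl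
@[simp] theorem byTag_one : byTag 1 x₀ x₁ x₂ x₃ x₄ x₅ x₆ = x₁ := rfl
@[simp] theorem byTag_two : byTag 2 x₀ x₁ x₂ x₃ x₄ x₅ x₆ = x₂ := rfl
@[simp] theorem byTag_three : byTag 3 x₀ x₁ x₂ x₃ x₄ x₅ x₆ = x₃ := rfl
@[simp] theorem byTag_four : byTag 4 x₀ x₁ x₂ x₃ x₄ x₅ x₆ = x₄ := rfl
@[simp] theorem byTag_five : byTag 5 x₀ x₁ x₂ x₃ x₄ x₅ x₆ = x₅ := rfl
theorem byTag_junk {t : ℕ} (ht : 6 ≤ t) : byTag t x₀ x₁ x₂ x₃ x₄ x₅ x₆ = x₆ := by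
  unfold byTag
  repeat rw [if_neg (by omega)]
theorem byTag_const {t : ℕ} (ht : 3 ≤ t) : byTag t x₀ x₁ x₂ x₃ x₃ x₃ x₃ = x₃ := by
  unfold byTag
  repeat rw [if_neg (by omega)]
  split_ifs <;> rfl
end byTag

@[fun_prop] theorem primrec_byTag {α σ : Type*} [Primcodable α] [Primcodable σ] {t : α → ℕ}
    {x₀ x₁ x₂ x₃ x₄ x₅ x₆ : α → σ} (ht : Primrec t) (h₀ : Primrec x₀) (h₁ : Primrec x₁)
    (h₂ : Primrec x₂) (h₃ : Primrec x₃) (h₄ : Primrec x₄) (h₅ : Primrec x₅) (h₆ : Primrec x₆) :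
    Primrec (fun a => byTag (t a) (x₀ a) (x₁ a) (x₂ a) (x₃ a) (x₄ a) (x₅ a) (x₆ a)) := by
  unfold byTag
  fun_prop

/-- The code of the variable number `i`. -/
abbrev vr (i : ℕ) : ℕ := pair 0 i
/-- The code of the term `0`. -/
abbrev zr : ℕ := pair 1 0
/-- The code of the term `1`. -/
abbrev on : ℕ := pair 2 0
/-- The code of the negative of a term. -/
abbrev ng (a : ℕ) : ℕ := pair 3 a
/-- The code of the sum of two terms. -/
abbrev ad (a b : ℕ) : ℕ := pair 4 (pair a b)
/-- The code of the product of two terms. -/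
abbrev ml (a b : ℕ) : ℕ := pair 5 (pair a b)

/-- Induction along the recursion of `treeRec`. -/
theorem tag_induction {P : ℕ → Prop} (h : ∀ t r, (1 ≤ t → P r ∧ P (unpair r).1 ∧ P (unpair r).2) →
    P (pair t r)) (c : ℕ) : P c := by
  induction c using Nat.strong_induction_on with
  | _ c ih =>
    have hc := Nat.pair_unpair c
    rw [← hc]
    apply h
    intro ht
    have h0 := lt_pair_of_pos (r := (unpair c).2) ht
    rw [hc] at h0
    have h1 := Nat.unpair_left_le (unpair c).2
    have h2 := Nat.unpair_right_le (unpair c).2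
    exact ⟨ih _ h0, ih _ (by omega), ih _ (by omega)⟩

/-- Induction on codes of terms; numbers that are no codes of terms are covered by the cases
`junk` and by arbitrary second components in the cases of the constants. -/
theorem term_induction {P : ℕ → Prop} (var : ∀ i, P (vr i)) (zero : ∀ r, P (pair 1 r))
    (one : ∀ r, P (pair 2 r)) (neg : ∀ a, P a → P (ng a))
    (add : ∀ a b, P a → P b → P (ad a b)) (mul : ∀ a b, P a → P b → P (ml a b))
    (junk : ∀ t r, 6 ≤ t → P (pair t r)) (c : ℕ) : P c := by
  induction c using tag_induction with
  | _ t r ih =>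
    obtain h | h := Nat.lt_or_ge t 6
    · interval_cases t
      · exact var r
      · exact zero r
      · exact one r
      · exact neg r (ih (by norm_num)).1
      · have := add _ _ (ih (by norm_num)).2.1 (ih (by norm_num)).2.2
        rwa [ad, Nat.pair_unpair] at this
      · have := mul _ _ (ih (by norm_num)).2.1 (ih (by norm_num)).2.2
        rwa [ml, Nat.pair_unpair] at this
    · exact junk t r h

/-- Induction on codes of quantifier-free formulas. -/
theorem formula_induction {P : ℕ → Prop} (falsum : ∀ r, P (pair 0 r))
    (equal : ∀ a b, P (pair 1 (pair a b))) (imp : ∀ a b, P a → P b → P (pair 2 (pair a b)))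
    (junk : ∀ t r, 3 ≤ t → P (pair t r)) (c : ℕ) : P c := by
  induction c using tag_induction with
  | _ t r ih =>
    obtain h | h := Nat.lt_or_ge t 3
    · interval_cases t
      · exact falsum r
      · have := equal (unpair r).1 (unpair r).2
        rwa [Nat.pair_unpair] at this
      · have := imp _ _ (ih (by norm_num)).2.1 (ih (by norm_num)).2.2
        rwa [Nat.pair_unpair] at this
    · exact junk t r h

/-! ### Evaluation of codes in commutative rings -/

section Eval

variable {R S : Type*} [CommRing R] [CommRing S]

/-- The value of the term with code `c` in a commutative ring under the assignment `v`. Numbers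
that are not codes of terms have the value `0`. -/
def evT (v : ℕ → R) (c : ℕ) : R :=
  treeRec 0 (fun (v : ℕ → R) c p l r => byTag (unpair c).1 (v (unpair c).2) 0 1 (-p) (l + r)
    (l * r) 0) v c

@[simp] theorem evT_var (v : ℕ → R) (i : ℕ) : evT v (vr i) = v i := by
  rw [evT, treeRec]; simp
@[simp] theorem evT_zero (v : ℕ → R) (r : ℕ) : evT v (pair 1 r) = 0 := by
  rw [evT, treeRec]; simp
@[simp] theorem evT_one (v : ℕ → R) (r : ℕ) : evT v (pair 2 r) = 1 := by
  rw [evT, treeRec]; simp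
@[simp] theorem evT_neg (v : ℕ → R) (a : ℕ) : evT v (ng a) = - evT v a := by
  rw [evT, treeRec_pair _ _ _ (by norm_num)]; simp [evT]
@[simp] theorem evT_add (v : ℕ → R) (a b : ℕ) : evT v (ad a b) = evT v a + evT v b := by
  rw [evT, treeRec_pair _ _ _ (by norm_num)]; simp [evT]
@[simp] theorem evT_mul (v : ℕ → R) (a b : ℕ) : evT v (ml a b) = evT v a * evT v b := by
  rw [evT, treeRec_pair _ _ _ (by norm_num)]; simp [evT]
theorem evT_junk (v : ℕ → R) {t r : ℕ} (ht : 6 ≤ t) : evT v (pair t r) = 0 := by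
  rw [evT, treeRec_pair _ _ _ (by omega)]
  simp [byTag_junk _ _ _ _ _ _ _ ht]

theorem map_evT {F : Type*} [FunLike F R S] [RingHomClass F R S] (f : F) (v : ℕ → R) (c : ℕ) :
    f (evT v c) = evT (fun i => f (v i)) c := by
  induction c using term_induction with
  | junk t r h => simp [evT_junk _ h]
  | _ => simp_all

/-- The truth value of the quantifier-free formula with code `c` in a commutative ring under the
assignment `v`. Numbers that are not codes of such formulas are treated as false. -/
def evF (v : ℕ → R) (c : ℕ) : Prop :=
  treeRec False (fun (v : ℕ → R) c _ l r => byTag (unpair c).1 False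
    (evT v (unpair (unpair c).2).1 = evT v (unpair (unpair c).2).2) (l → r) False False False
    False) v c

@[simp] theorem evF_falsum (v : ℕ → R) (r : ℕ) : ¬ evF v (pair 0 r) := by
  rw [evF, treeRec]; simp
@[simp] theorem evF_equal (v : ℕ → R) (a b : ℕ) :
    evF v (pair 1 (pair a b)) ↔ evT v a = evT v b := by
  rw [evF, treeRec]; simp
@[simp] theorem evF_imp (v : ℕ → R) (a b : ℕ) :
    evF v (pair 2 (pair a b)) ↔ (evF v a → evF v b) := by
  rw [evF, treeRec_pair _ _ _ (by norm_num)]; simp [evF]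
theorem evF_junk (v : ℕ → R) {t r : ℕ} (ht : 3 ≤ t) : ¬ evF v (pair t r) := by
  rw [evF, treeRec_pair _ _ _ (by omega)]
  simp [byTag_const _ _ _ _ ht]

theorem evF_map_iff {F : Type*} [FunLike F R S] [RingHomClass F R S] (f : F)
    (hf : Function.Injective f) (v : ℕ → R) (c : ℕ) : evF (fun i => f (v i)) c ↔ evF v c := by
  induction c using formula_induction with
  | junk t r h => simp [evF_junk _ h]
  | equal a b => simp [← map_evT, hf.eq_iff]
  | _ => simp_all

/-- The assignment of `x` to the variable `0` and of `y` to all other variables. -/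
def xy (x y : R) : ℕ → R := fun i => if i = 0 then x else y

theorem map_xy {F : Type*} [FunLike F R S] [RingHomClass F R S] (f : F) (x y : R) :
    (fun i => f (xy x y i)) = xy (f x) (f y) := by
  funext i
  simp only [xy]
  split_ifs <;> rfl

theorem map_evT_xy {F : Type*} [FunLike F R S] [RingHomClass F R S] (f : F) (x y : R) (c : ℕ) :
    f (evT (xy x y) c) = evT (xy (f x) (f y)) c := by
  rw [map_evT, map_xy]

theorem evF_xy_map_iff {F : Type*} [FunLike F R S] [RingHomClass F R S] (f : F)
    (hf : Function.Injective f) (x y : R) (c : ℕ) :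
    evF (xy (f x) (f y)) c ↔ evF (xy x y) c := by
  rw [← map_xy, evF_map_iff f hf]

end Eval

/-! ### Codes of sentences -/

section Sentences

open FirstOrder FirstOrder.Language FirstOrder.Ring

/-- The Boolean test whether a number codes a term in the variables `0` and `1`. -/
def validT (c : ℕ) : Bool :=
  treeRec false (fun (_ : Unit) c p l r => byTag (unpair c).1 (decide ((unpair c).2 < 2))
    (decide ((unpair c).2 = 0)) (decide ((unpair c).2 = 0)) p (l && r) (l && r) false) () c

/-- The Boolean test whether a number codes a quantifier-free formula in the variables `0`
and `1`. -/
def validF (c : ℕ) : Bool :=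
  treeRec false (fun (_ : Unit) c _ l r => byTag (unpair c).1 (decide ((unpair c).2 = 0))
    (validT (unpair (unpair c).2).1 && validT (unpair (unpair c).2).2) (l && r) false false false
    false) () c

@[fun_prop] theorem primrec_decide {α : Type*} [Primcodable α] {p : α → Prop} [DecidablePred p]
    (hp : PrimrecPred p) : Primrec (fun a => decide (p a)) := hp.decide

@[fun_prop] theorem primrec_and {α : Type*} [Primcodable α] {f g : α → Bool} (hf : Primrec f)
    (hg : Primrec g) : Primrec (fun a => f a && g a) := Primrec.and.comp hf hg

@[fun_prop] theorem primrec_validT : Primrec validT :=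
  (primrec_treeRec (α := Unit) false (by fun_prop)).comp (g := fun c : ℕ => ((), c)) (by fun_prop)

@[fun_prop] theorem primrec_validF : Primrec validF :=
  (primrec_treeRec (α := Unit) false (by fun_prop)).comp (g := fun c : ℕ => ((), c)) (by fun_prop)

@[simp] theorem validT_var (i : ℕ) : validT (vr i) = decide (i < 2) := by
  rw [validT, treeRec]; simp
@[simp] theorem validT_zero (r : ℕ) : validT (pair 1 r) = decide (r = 0) := by
  rw [validT, treeRec]; simp
@[simp] theorem validT_one (r : ℕ) : validT (pair 2 r) = decide (r = 0) := by
  rw [validT, treeRec]; simp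
@[simp] theorem validT_neg (a : ℕ) : validT (ng a) = validT a := by
  rw [validT, treeRec_pair _ _ _ (by norm_num)]; simp [validT]
@[simp] theorem validT_add (a b : ℕ) : validT (ad a b) = (validT a && validT b) := by
  rw [validT, treeRec_pair _ _ _ (by norm_num)]; simp [validT]
@[simp] theorem validT_mul (a b : ℕ) : validT (ml a b) = (validT a && validT b) := by
  rw [validT, treeRec_pair _ _ _ (by norm_num)]; simp [validT]
theorem validT_junk {t r : ℕ} (ht : 6 ≤ t) : validT (pair t r) = false := by
  rw [validT, treeRec_pair _ _ _ (by omega)]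
  simp [byTag_junk _ _ _ _ _ _ _ ht]

@[simp] theorem validF_falsum (r : ℕ) : validF (pair 0 r) = decide (r = 0) := by
  rw [validF, treeRec]; simp
@[simp] theorem validF_equal (a b : ℕ) :
    validF (pair 1 (pair a b)) = (validT a && validT b) := by
  rw [validF, treeRec]; simp
@[simp] theorem validF_imp (a b : ℕ) :
    validF (pair 2 (pair a b)) = (validF a && validF b) := by
  rw [validF, treeRec_pair _ _ _ (by norm_num)]; simp [validF]
theorem validF_junk {t r : ℕ} (ht : 3 ≤ t) : validF (pair t r) = false := by
  rw [validF, treeRec_pair _ _ _ (by omega)]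
  simp [byTag_const _ _ _ _ ht]

theorem validT_termCode (t : Language.ring.Term (Empty ⊕ Fin 2)) :
    validT (termCode varCode t) = true := by
  induction t with
  | var a =>
    rcases a with a | a
    · exact a.elim
    · simp [termCode, varCode, Nat.le_of_lt_succ a.2]
  | func f ts ih => cases f <;> simp [termCode, ih]

theorem exists_term_of_validT (c : ℕ) (hc : validT c = true) :
    ∃ t : Language.ring.Term (Empty ⊕ Fin 2), termCode varCode t = c := by
  induction c using term_induction with
  | var i =>
    have hi : i < 2 := by simpa using hc
    exact ⟨.var (Sum.inr ⟨i, hi⟩), by simp [termCode, varCode]⟩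
  | zero r =>
    have hr : r = 0 := by simpa using hc
    exact ⟨.func ringFunc.zero Fin.elim0, by simp [termCode, hr]⟩
  | one r =>
    have hr : r = 0 := by simpa using hc
    exact ⟨.func ringFunc.one Fin.elim0, by simp [termCode, hr]⟩
  | neg a ih =>
    obtain ⟨t, ht⟩ := ih (by simpa using hc)
    exact ⟨.func ringFunc.neg ![t], by simp [termCode, ht]⟩
  | add a b iha ihb =>
    simp only [validT_add, Bool.and_eq_true] at hc
    obtain ⟨t, ht⟩ := iha hc.1
    obtain ⟨s, hs⟩ := ihb hc.2
    exact ⟨.func ringFunc.add ![t, s], by simp [termCode, ht, hs]⟩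
  | mul a b iha ihb =>
    simp only [validT_mul, Bool.and_eq_true] at hc
    obtain ⟨t, ht⟩ := iha hc.1
    obtain ⟨s, hs⟩ := ihb hc.2
    exact ⟨.func ringFunc.mul ![t, s], by simp [termCode, ht, hs]⟩
  | junk t r h => simp [validT_junk h] at hc

theorem validF_formulaCode (φ : Language.ring.BoundedFormula Empty 2) (hφ : φ.IsQF) :
    validF (formulaCode φ) = true := by
  induction hφ with
  | falsum =>
    show validF (formulaCode .falsum) = true
    simp [formulaCode]
  | of_isAtomic h =>
    cases h with
    | equal s t =>
      show validF (formulaCode (.equal s t)) = true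
      simp [formulaCode, validT_termCode]
    | rel R _ => exact Empty.elim R
  | imp h₁ h₂ ih₁ ih₂ => simp [formulaCode, ih₁, ih₂]

theorem exists_formula_of_validF (c : ℕ) (hc : validF c = true) :
    ∃ φ : Language.ring.BoundedFormula Empty 2, φ.IsQF ∧ formulaCode φ = c := by
  induction c using formula_induction with
  | falsum r =>
    have hr : r = 0 := by simpa using hc
    exact ⟨.falsum, .falsum, by simp [formulaCode, hr]⟩
  | equal a b =>
    simp only [validF_equal, Bool.and_eq_true] at hc
    obtain ⟨t, ht⟩ := exists_term_of_validT _ hc.1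
    obtain ⟨s, hs⟩ := exists_term_of_validT _ hc.2
    exact ⟨.equal t s, .of_isAtomic (.equal _ _), by simp [formulaCode, ht, hs]⟩
  | imp a b iha ihb =>
    simp only [validF_imp, Bool.and_eq_true] at hc
    obtain ⟨φ, hφ, h₁⟩ := iha hc.1
    obtain ⟨ψ, hψ, h₂⟩ := ihb hc.2
    exact ⟨.imp φ ψ, hφ.imp hψ, by simp [formulaCode, h₁, h₂]⟩
  | junk t r h => simp [validF_junk h] at hc

section Semantics

variable {K : Type*} [Field K] [CompatibleRing K]

theorem realize_term_iff (v : ℕ → K) {α : Type} (n : α → ℕ) (t : Language.ring.Term α) :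
    t.realize (fun a => v (n a)) = evT v (termCode n t) := by
  induction t with
  | var a => simp [termCode]
  | func f ts ih =>
    cases f
    · simp [termCode, ← ih]; exact CompatibleRing.funMap_add _
    · simp [termCode, ← ih]; exact CompatibleRing.funMap_mul _
    · simp [termCode, ← ih]; exact CompatibleRing.funMap_neg _
    · simp [termCode]; exact CompatibleRing.funMap_zero _
    · simp [termCode]; exact CompatibleRing.funMap_one _

/-- The evaluation of codes agrees with the satisfaction of formulas. -/
theorem realize_formula_iff (e : Empty → K) (xs : Fin 2 → K) (v : ℕ → K)
    (hv : ∀ i : Fin 2, xs i = v i)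
    (φ : Language.ring.BoundedFormula Empty 2) (hφ : φ.IsQF) :
    φ.Realize e xs ↔ evF v (formulaCode φ) := by
  have hs : (Sum.elim e xs : Empty ⊕ Fin 2 → K) = fun a => v (varCode a) := by
    funext a
    rcases a with a | a
    · exact a.elim
    · simp [varCode, hv]
  induction hφ with
  | falsum =>
    show BoundedFormula.Realize .falsum e xs ↔ evF v (formulaCode .falsum)
    rw [formulaCode]
    simp [BoundedFormula.Realize]
  | of_isAtomic h =>
    cases h with
    | equal s t =>
      show _ ↔ evF v (formulaCode (.equal s t))
      rw [formulaCode, evF_equal, ← realize_term_iff, ← realize_term_iff, ← hs]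
      simp [Term.bdEqual, BoundedFormula.Realize]
    | rel R _ => exact Empty.elim R
  | imp h₁ h₂ ih₁ ih₂ =>
    rw [formulaCode, evF_imp, BoundedFormula.realize_imp]
    exact imp_congr ih₁ ih₂

theorem realize_all_ex_iff (φ : Language.ring.BoundedFormula Empty 2) (hφ : φ.IsQF) :
    K ⊨ (φ.ex.all : Language.ring.Sentence) ↔ ∀ x : K, ∃ y, evF (xy x y) (formulaCode φ) := by
  simp only [Sentence.Realize, Formula.Realize, BoundedFormula.realize_all,
    BoundedFormula.realize_ex]
  refine forall_congr' fun x => exists_congr fun y => ?_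
  refine realize_formula_iff _ _ _ ?_ φ hφ
  intro i
  fin_cases i
  · simp [xy, Fin.snoc]
  · simp [xy, Fin.snoc]

end Semantics

/-- The sentence `∀ x, ∃ y, φ(x, y)` holds in every infinite field, where `c` is the code of
`φ`. -/
def Valid (c : ℕ) : Prop :=
  ∀ (K : Type u) [Field K] [Infinite K], ∀ x : K, ∃ y, evF (xy x y) c

/-- The code of `∀ x, ∃ y, φ`, where `c` is the code of `φ`. -/
def wrap (c : ℕ) : ℕ := pair 3 (pair 2 (pair (pair 3 (pair 2 (pair c 0))) 0))

/-- The inverse of `wrap`. -/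
def unwrap (k : ℕ) : ℕ :=
  (unpair (unpair (unpair (unpair (unpair (unpair k).2).2).1).2).2).1

theorem unwrap_wrap (c : ℕ) : unwrap (wrap c) = c := by simp [unwrap, wrap]

theorem sentenceCode_all_ex (φ : Language.ring.BoundedFormula Empty 2) :
    sentenceCode φ.ex.all = wrap (formulaCode φ) := by
  have h0 : pair 0 0 = 0 := rfl
  rw [sentenceCode, formulaCode, BoundedFormula.ex, BoundedFormula.not, formulaCode, formulaCode,
    BoundedFormula.not, formulaCode]
  show pair 3 (pair 2 (pair (pair 3 (pair 2 (pair _ (formulaCode .falsum))))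
    (formulaCode .falsum))) = _
  rw [formulaCode, formulaCode, h0, wrap]

theorem exists_code_iff (k : ℕ) :
    (∃ ψ ∈ forallExistsTheory.{u}, sentenceCode ψ = k) ↔
      wrap (unwrap k) = k ∧ validF (unwrap k) = true ∧ Valid.{u} (unwrap k) := by
  constructor
  · rintro ⟨_, ⟨⟨φ, hφ, rfl⟩, h⟩, rfl⟩
    rw [sentenceCode_all_ex, unwrap_wrap]
    refine ⟨rfl, validF_formulaCode φ hφ, fun K _ _ => ?_⟩
    let := compatibleRingOfRing K
    exact (realize_all_ex_iff φ hφ).1 (h K)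
  · rintro ⟨h, h', hV⟩
    obtain ⟨φ, hφ, hc⟩ := exists_formula_of_validF _ h'
    refine ⟨φ.ex.all, ⟨⟨φ, hφ, rfl⟩, fun K _ _ _ => ?_⟩, ?_⟩
    · rw [realize_all_ex_iff φ hφ, hc]
      exact hV K
    · rw [sentenceCode_all_ex, hc, h]

/-- Post's theorem reduces decidability to the enumerability of `Valid` and of its negation, as
`wrap` and the syntactic test `validF` are primitive recursive. -/
theorem computablePred_theory (h₁ : REPred Valid.{u}) (h₂ : REPred fun c => ¬ Valid.{u} c) :
    ComputablePred fun k : ℕ => ∃ ψ ∈ forallExistsTheory.{u}, sentenceCode ψ = k := by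
  have hV : ComputablePred Valid.{u} := ComputablePred.computable_iff_re_compl_re'.2 ⟨h₁, h₂⟩
  obtain ⟨f, hf, hfV⟩ := ComputablePred.computable_iff.1 hV
  refine ComputablePred.computable_iff.2
    ⟨fun k => decide (wrap (unwrap k) = k) && (validF (unwrap k) && f (unwrap k)), ?_, ?_⟩
  · have hu : Primrec unwrap := by unfold unwrap; fun_prop
    have hw : Primrec (fun k => decide (wrap (unwrap k) = k)) := by unfold wrap; fun_prop
    have hv : Primrec (fun k => validF (unwrap k)) := by fun_prop
    exact Primrec.and.to_comp.comp hw.to_comp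
      (Primrec.and.to_comp.comp hv.to_comp (hf.comp hu.to_comp))
  · funext k
    rw [exists_code_iff, hfV]
    simp

end Sentences

open Filter

/-! ### Validity is recursively enumerable -/

/-- The code of the term obtained from the term `c` by replacing all variables other than the
variable `0` by the term `y`. -/
def subst (y c : ℕ) : ℕ :=
  treeRec zr (fun y c p l r => byTag (unpair c).1 (if (unpair c).2 = 0 then vr 0 else y) zr on
    (ng p) (ad l r) (ml l r) zr) y c

theorem subst_var (y i : ℕ) : subst y (vr i) = if i = 0 then vr 0 else y := by
  rw [subst, treeRec]; simp
theorem subst_zero (y r : ℕ) : subst y (pair 1 r) = zr := by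
  rw [subst, treeRec]; simp
theorem subst_one (y r : ℕ) : subst y (pair 2 r) = on := by
  rw [subst, treeRec]; simp
theorem subst_neg (y a : ℕ) : subst y (ng a) = ng (subst y a) := by
  rw [subst, treeRec_pair _ _ _ (by norm_num)]; simp [subst]
theorem subst_add (y a b : ℕ) : subst y (ad a b) = ad (subst y a) (subst y b) := by
  rw [subst, treeRec_pair _ _ _ (by norm_num)]; simp [subst]
theorem subst_mul (y a b : ℕ) : subst y (ml a b) = ml (subst y a) (subst y b) := by
  rw [subst, treeRec_pair _ _ _ (by norm_num)]; simp [subst]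
theorem subst_junk (y : ℕ) {t r : ℕ} (ht : 6 ≤ t) : subst y (pair t r) = zr := by
  rw [subst, treeRec_pair _ _ _ (by omega)]
  simp [byTag_junk _ _ _ _ _ _ _ ht]

@[fun_prop] theorem primrec_subst {α : Type*} [Primcodable α] {f g : α → ℕ} (hf : Primrec f)
    (hg : Primrec g) : Primrec (fun a => subst (f a) (g a)) :=
  (primrec_treeRec (α := ℕ) zr (by fun_prop)).comp (g := fun a => (f a, g a)) (by fun_prop)

/-- If a map `m` from codes to a ring respects the operations, then it turns substitution into
evaluation. -/
theorem map_subst {R : Type*} [CommRing R] {m : ℕ → R} (h0 : m zr = 0) (h1 : m on = 1)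
    (hn : ∀ a, m (ng a) = - m a) (ha : ∀ a b, m (ad a b) = m a + m b)
    (hm : ∀ a b, m (ml a b) = m a * m b) (y c : ℕ) :
    m (subst y c) = evT (xy (m (vr 0)) (m y)) c := by
  induction c using term_induction with
  | var i => rw [subst_var, evT_var, xy]; split_ifs <;> rfl
  | zero r => rw [subst_zero, evT_zero, h0]
  | one r => rw [subst_one, evT_one, h1]
  | neg a ih => rw [subst_neg, evT_neg, hn, ih]
  | add a b iha ihb => rw [subst_add, evT_add, ha, iha, ihb]
  | mul a b iha ihb => rw [subst_mul, evT_mul, hm, iha, ihb]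
  | junk t r h => rw [subst_junk _ h, evT_junk _ h, h0]

/-- The number `ε`, read as a finite pattern of bits, asserts the equation `s = t`. -/
def Asserts (ε s t : ℕ) : Prop := ε / 2 ^ pair s t % 2 = 1

/-- The pattern of the first `N` bits of `ε` denies the equation `s = t`. -/
def Denies (N ε s t : ℕ) : Prop := pair s t < N ∧ ¬ Asserts ε s t

@[fun_prop] theorem primrecPred_asserts {α : Type*} [Primcodable α] {e s t : α → ℕ}
    (he : Primrec e) (hs : Primrec s) (ht : Primrec t) :
    PrimrecPred (fun a => Asserts (e a) (s a) (t a)) := by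
  unfold Asserts
  fun_prop

@[fun_prop] theorem primrecPred_denies {α : Type*} [Primcodable α] {n e s t : α → ℕ}
    (hn : Primrec n) (he : Primrec e) (hs : Primrec s) (ht : Primrec t) :
    PrimrecPred (fun a => Denies (n a) (e a) (s a) (t a)) := by
  unfold Denies
  fun_prop

instance (ε s t : ℕ) : Decidable (Asserts ε s t) := inferInstanceAs (Decidable (_ = _))
instance (N ε s t : ℕ) : Decidable (Denies N ε s t) := inferInstanceAs (Decidable (_ ∧ _))

/-- The value of the quantifier-free formula `c` at `(x, y)` as far as it is determined by the
pattern of the first `N` bits of `ε`: `1` if it is true, `2` if it is false, `0` if it is not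
determined. The first component of the argument is `(N, ε, y)`. -/
def partialTruth (w : ℕ × ℕ × ℕ) (c : ℕ) : ℕ :=
  treeRec 0 (fun (w : ℕ × ℕ × ℕ) c _ l r => byTag (unpair c).1 2
    (if Asserts w.2.1 (subst w.2.2 (unpair (unpair c).2).1) (subst w.2.2 (unpair (unpair c).2).2)
      then 1 else if Denies w.1 w.2.1 (subst w.2.2 (unpair (unpair c).2).1)
        (subst w.2.2 (unpair (unpair c).2).2) then 2 else 0)
    (if l = 2 ∨ r = 1 then 1 else if l = 1 ∧ r = 2 then 2 else 0) 2 2 2 2) w c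

@[fun_prop] theorem primrec_partialTruth {α : Type*} [Primcodable α] {f : α → ℕ × ℕ × ℕ}
    {g : α → ℕ} (hf : Primrec f) (hg : Primrec g) :
    Primrec (fun a => partialTruth (f a) (g a)) :=
  (primrec_treeRec (α := ℕ × ℕ × ℕ) 0 (by fun_prop)).comp (g := fun a => (f a, g a))
    (by fun_prop)

theorem partialTruth_falsum (w : ℕ × ℕ × ℕ) (r : ℕ) : partialTruth w (pair 0 r) = 2 := by
  rw [partialTruth, treeRec]; simp
theorem partialTruth_equal (w : ℕ × ℕ × ℕ) (a b : ℕ) : partialTruth w (pair 1 (pair a b)) =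
    if Asserts w.2.1 (subst w.2.2 a) (subst w.2.2 b) then 1 else
      if Denies w.1 w.2.1 (subst w.2.2 a) (subst w.2.2 b) then 2 else 0 := by
  rw [partialTruth, treeRec]; simp
theorem partialTruth_imp (w : ℕ × ℕ × ℕ) (a b : ℕ) : partialTruth w (pair 2 (pair a b)) =
    if partialTruth w a = 2 ∨ partialTruth w b = 1 then 1 else
      if partialTruth w a = 1 ∧ partialTruth w b = 2 then 2 else 0 := by
  rw [partialTruth, treeRec_pair _ _ _ (by norm_num)]
  simp only [Nat.unpair_pair, byTag_two]
  rfl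
theorem partialTruth_junk (w : ℕ × ℕ × ℕ) {t r : ℕ} (ht : 3 ≤ t) :
    partialTruth w (pair t r) = 2 := by
  rw [partialTruth, treeRec_pair _ _ _ (by omega)]
  simp [byTag_const _ _ _ _ ht]

/-- An instance, at the terms `a`, `b`, `d`, of the axioms of equality, of the axioms of fields,
or of the pairwise distinctness of the variables `pair a 2` is violated, where `T` and `F` are
the pairs of terms whose equality is asserted and denied. The variable `pair a 1` serves as a
name for the inverse of the term `a`. -/
def AxiomViolated (T F : ℕ → ℕ → Prop) (a b d : ℕ) : Prop :=
  F a a ∨ (T a b ∧ F b a) ∨ (T a b ∧ T b d ∧ F a d) ∨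
  (T a b ∧ F (ad a d) (ad b d)) ∨ (T a b ∧ F (ml a d) (ml b d)) ∨ (T a b ∧ F (ng a) (ng b)) ∨
  F (ad a b) (ad b a) ∨ F (ad (ad a b) d) (ad a (ad b d)) ∨ F (ad zr a) a ∨ F (ad (ng a) a) zr ∨
  F (ml a b) (ml b a) ∨ F (ml (ml a b) d) (ml a (ml b d)) ∨ F (ml on a) a ∨
  F (ml a (ad b d)) (ad (ml a b) (ml a d)) ∨ T zr on ∨
  (F a zr ∧ F (ml a (vr (pair a 1))) on) ∨
  (¬ a = b ∧ T (vr (pair a 2)) (vr (pair b 2)))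

/-- A set `E` of equations that violates no axiom is the theory of an infinite field `K` in which
all elements are named by codes of terms; `m` is the interpretation of the codes. -/
theorem exists_field_of_pattern {E : ℕ → ℕ → Prop}
    (hE : ∀ a b d, ¬ AxiomViolated E (fun s t => ¬ E s t) a b d) :
    ∃ (K : Type) (_ : Field K) (_ : Infinite K) (m : ℕ → K), Function.Surjective m ∧
      (∀ s t, m s = m t ↔ E s t) ∧ m zr = 0 ∧ m on = 1 ∧ (∀ a, m (ng a) = - m a) ∧
      (∀ a b, m (ad a b) = m a + m b) ∧ (∀ a b, m (ml a b) = m a * m b) := by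
  classical
  simp only [AxiomViolated, not_or, not_and, not_not] at hE
  have refl : ∀ a, E a a := fun a => (hE a 0 0).1
  have symm : ∀ a b, E a b → E b a := fun a b => (hE a b 0).2.1
  have trans : ∀ a b d, E a b → E b d → E a d := fun a b d => (hE a b d).2.2.1
  have addc : ∀ a b d, E a b → E (ad a d) (ad b d) := fun a b d => (hE a b d).2.2.2.1
  have mulc : ∀ a b d, E a b → E (ml a d) (ml b d) := fun a b d => (hE a b d).2.2.2.2.1
  have negc : ∀ a b, E a b → E (ng a) (ng b) := fun a b => (hE a b 0).2.2.2.2.2.1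
  have hE' := fun a b d => (hE a b d).2.2.2.2.2.2
  clear hE
  have addcomm : ∀ a b, E (ad a b) (ad b a) := fun a b => (hE' a b 0).1
  have addassoc : ∀ a b d, E (ad (ad a b) d) (ad a (ad b d)) := fun a b d => (hE' a b d).2.1
  have zeroadd : ∀ a, E (ad zr a) a := fun a => (hE' a 0 0).2.2.1
  have negadd : ∀ a, E (ad (ng a) a) zr := fun a => (hE' a 0 0).2.2.2.1
  have mulcomm : ∀ a b, E (ml a b) (ml b a) := fun a b => (hE' a b 0).2.2.2.2.1
  have mulassoc : ∀ a b d, E (ml (ml a b) d) (ml a (ml b d)) :=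
    fun a b d => (hE' a b d).2.2.2.2.2.1
  have onemul : ∀ a, E (ml on a) a := fun a => (hE' a 0 0).2.2.2.2.2.2.1
  have distrib : ∀ a b d, E (ml a (ad b d)) (ad (ml a b) (ml a d)) :=
    fun a b d => (hE' a b d).2.2.2.2.2.2.2.1
  have zeroone : ¬ E zr on := (hE' 0 0 0).2.2.2.2.2.2.2.2.1
  have inv : ∀ a, ¬ E a zr → E (ml a (vr (pair a 1))) on :=
    fun a => (hE' a 0 0).2.2.2.2.2.2.2.2.2.1
  have dist : ∀ a b, ¬ a = b → ¬ E (vr (pair a 2)) (vr (pair b 2)) :=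
    fun a b => (hE' a b 0).2.2.2.2.2.2.2.2.2.2
  have addc' : ∀ a a' b b', E a a' → E b b' → E (ad a b) (ad a' b') := fun a a' b b' h h' =>
    trans _ _ _ (addc _ _ b h) (trans _ _ _ (addcomm _ _) (trans _ _ _ (addc _ _ a' h')
      (addcomm _ _)))
  have mulc' : ∀ a a' b b', E a a' → E b b' → E (ml a b) (ml a' b') := fun a a' b b' h h' =>
    trans _ _ _ (mulc _ _ b h) (trans _ _ _ (mulcomm _ _) (trans _ _ _ (mulc _ _ a' h')
      (mulcomm _ _)))
  let st : Setoid ℕ := ⟨E, refl, fun {a b} => symm a b, fun {a b d} => trans a b d⟩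
  let K := Quotient st
  let m : ℕ → K := Quotient.mk st
  have hm : ∀ s t, m s = m t ↔ E s t := fun s t => Quotient.eq (r := st)
  have hsurj : Function.Surjective m := Quotient.mk_surjective
  let iadd : Add K := ⟨Quotient.map₂ ad (fun a a' h b b' h' => addc' a a' b b' h h')⟩
  let imul : Mul K := ⟨Quotient.map₂ ml (fun a a' h b b' h' => mulc' a a' b b' h h')⟩
  let ineg : Neg K := ⟨Quotient.map ng (fun a a' h => negc a a' h)⟩
  let izero : Zero K := ⟨m zr⟩
  let ione : One K := ⟨m on⟩
  let iinv : Inv K := ⟨fun q => if q = 0 then 0 else m (vr (pair q.out 1))⟩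
  have madd : ∀ a b, m (ad a b) = m a + m b := fun _ _ => rfl
  have mmul : ∀ a b, m (ml a b) = m a * m b := fun _ _ => rfl
  have mneg : ∀ a, m (ng a) = - m a := fun _ => rfl
  have mzero : m zr = 0 := rfl
  have mone : m on = 1 := rfl
  let F : Field K := Field.ofMinimalAxioms K
    (hsurj.forall₃.2 fun a b d => by simp only [← madd]; exact (hm _ _).2 (addassoc a b d))
    (hsurj.forall.2 fun a => by rw [← mzero, ← madd]; exact (hm _ _).2 (zeroadd a))
    (hsurj.forall.2 fun a => by rw [← mzero, ← mneg, ← madd]; exact (hm _ _).2 (negadd a))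
    (hsurj.forall₃.2 fun a b d => by simp only [← mmul]; exact (hm _ _).2 (mulassoc a b d))
    (hsurj.forall₂.2 fun a b => by simp only [← mmul]; exact (hm _ _).2 (mulcomm a b))
    (hsurj.forall.2 fun a => by rw [← mone, ← mmul]; exact (hm _ _).2 (onemul a))
    (fun q hq => by
      have hinv : q⁻¹ = m (vr (pair q.out 1)) := if_neg hq
      have hout : m q.out = q := Quotient.out_eq q
      rw [hinv]
      conv_lhs => rw [← hout]
      rw [← mmul, ← mone]
      simp only [hout]
      refine (hm _ _).2 (inv _ fun h => hq ?_)
      rw [← hout, ← mzero]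
      exact (hm _ _).2 h)
    (if_pos rfl)
    (hsurj.forall₃.2 fun a b d => by
      simp only [← mmul, ← madd]; exact (hm _ _).2 (distrib a b d))
    ⟨m zr, m on, fun h => zeroone ((hm _ _).1 h)⟩
  refine ⟨K, F, ?_, m, hsurj, hm, mzero, mone, mneg, madd, mmul⟩
  refine Infinite.of_injective (fun a : ℕ => m (vr (pair a 2))) fun a b h => ?_
  by_contra hab
  exact dist a b hab ((hm _ _).1 h)

/-- The bits of `ε` below `N` violate an instance of the axioms at `a`, `b`, `d`, or they make the
formula `c` true at `(x, a)`. -/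
def Refutes (c N ε a b d : ℕ) : Prop :=
  AxiomViolated (Asserts ε) (Denies N ε) a b d ∨ partialTruth (N, ε, a) c = 1

/-- The interpretation of all codes in an infinite field `K`: the variable `pair a 1` is the inverse
of the value of `a`, the variables `pair a 2` are distinct, and the other variables are `x`. -/
noncomputable def herbrandValue {K : Type*} [Field K] [Infinite K] (x : K) (c : ℕ) : K :=
  treeRec 0 (fun (_ : Unit) c p l r => byTag (unpair c).1
    (if (unpair (unpair c).2).2 = 1 then l⁻¹ else if (unpair (unpair c).2).2 = 2 then
      Infinite.natEmbedding K (unpair (unpair c).2).1 else x) 0 1 (-p) (l + r) (l * r) 0) () c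

section herbrandValue

variable {K : Type*} [Field K] [Infinite K] (x : K)

theorem herbrandValue_x : herbrandValue x (vr 0) = x := by
  rw [herbrandValue, treeRec]; simp
theorem herbrandValue_inv (a : ℕ) : herbrandValue x (vr (pair a 1)) = (herbrandValue x a)⁻¹ := by
  have h : a < pair 0 (pair a 1) :=
    (Nat.lt_of_lt_of_le (Nat.lt_succ_self a) (Nat.add_le_pair a 1)).trans_le (Nat.right_le_pair _ _)
  rw [herbrandValue, treeRec]
  simp only [Nat.unpair_pair, byTag_zero, if_true, h, dif_pos]
  rfl
theorem herbrandValue_const (a : ℕ) :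
    herbrandValue x (vr (pair a 2)) = Infinite.natEmbedding K a := by
  rw [herbrandValue, treeRec]; simp
theorem herbrandValue_zero (r : ℕ) : herbrandValue x (pair 1 r) = 0 := by
  rw [herbrandValue, treeRec]; simp
theorem herbrandValue_one (r : ℕ) : herbrandValue x (pair 2 r) = 1 := by
  rw [herbrandValue, treeRec]; simp
theorem herbrandValue_neg (a : ℕ) : herbrandValue x (ng a) = - herbrandValue x a := by
  rw [herbrandValue, treeRec_pair _ _ _ (by norm_num)]; simp [herbrandValue]
theorem herbrandValue_add (a b : ℕ) :
    herbrandValue x (ad a b) = herbrandValue x a + herbrandValue x b := by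
  rw [herbrandValue, treeRec_pair _ _ _ (by norm_num)]; simp [herbrandValue]
theorem herbrandValue_mul (a b : ℕ) :
    herbrandValue x (ml a b) = herbrandValue x a * herbrandValue x b := by
  rw [herbrandValue, treeRec_pair _ _ _ (by norm_num)]; simp [herbrandValue]

/-- A pattern of bits that agrees with the interpretation of the terms in a field violates no
axiom. -/
theorem not_axiomViolated {T F : ℕ → ℕ → Prop}
    (hT : ∀ s t, T s t → herbrandValue x s = herbrandValue x t)
    (hF : ∀ s t, F s t → herbrandValue x s ≠ herbrandValue x t) (a b d : ℕ) :
    ¬ AxiomViolated T F a b d := by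
  rintro (h | ⟨h, h'⟩ | ⟨h, h', h''⟩ | ⟨h, h'⟩ | ⟨h, h'⟩ | ⟨h, h'⟩ | h | h | h | h | h | h | h |
    h | h | ⟨h, h'⟩ | ⟨h, h'⟩)
  · exact hF _ _ h rfl
  · exact hF _ _ h' (hT _ _ h).symm
  · exact hF _ _ h'' ((hT _ _ h).trans (hT _ _ h'))
  · exact hF _ _ h' (by rw [herbrandValue_add, herbrandValue_add, hT _ _ h])
  · exact hF _ _ h' (by rw [herbrandValue_mul, herbrandValue_mul, hT _ _ h])
  · exact hF _ _ h' (by rw [herbrandValue_neg, herbrandValue_neg, hT _ _ h])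
  · exact hF _ _ h (by simp only [herbrandValue_add]; ring)
  · exact hF _ _ h (by simp only [herbrandValue_add]; ring)
  · exact hF _ _ h (by simp only [herbrandValue_add, herbrandValue_zero]; ring)
  · exact hF _ _ h (by simp only [herbrandValue_add, herbrandValue_neg, herbrandValue_zero]; ring)
  · exact hF _ _ h (by simp only [herbrandValue_mul]; ring)
  · exact hF _ _ h (by simp only [herbrandValue_mul]; ring)
  · exact hF _ _ h (by simp only [herbrandValue_mul, herbrandValue_one]; ring)
  · exact hF _ _ h (by simp only [herbrandValue_mul, herbrandValue_add]; ring)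
  · have := hT _ _ h
    rw [herbrandValue_zero, herbrandValue_one] at this
    exact zero_ne_one this
  · refine hF _ _ h' ?_
    have := hF _ _ h
    rw [herbrandValue_zero] at this
    rw [herbrandValue_mul, herbrandValue_inv, herbrandValue_one, mul_inv_cancel₀ this]
  · have := hT _ _ h'
    rw [herbrandValue_const, herbrandValue_const] at this
    exact h ((Infinite.natEmbedding K).injective this)

theorem partialTruth_of_agree {N ε : ℕ}
    (hT : ∀ s t, Asserts ε s t → herbrandValue x s = herbrandValue x t)
    (hF : ∀ s t, Denies N ε s t → herbrandValue x s ≠ herbrandValue x t) (y c : ℕ) :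
    (partialTruth (N, ε, y) c = 1 → evF (xy x (herbrandValue x y)) c) ∧
    (partialTruth (N, ε, y) c = 2 → ¬ evF (xy x (herbrandValue x y)) c) := by
  have hs : ∀ a, herbrandValue x (subst y a) = evT (xy x (herbrandValue x y)) a := by
    intro a
    rw [map_subst (herbrandValue_zero x 0) (herbrandValue_one x 0) (herbrandValue_neg x)
      (herbrandValue_add x) (herbrandValue_mul x), herbrandValue_x]
  induction c using formula_induction with
  | falsum r => simp [partialTruth_falsum]
  | equal a b =>
    rw [partialTruth_equal, evF_equal, ← hs, ← hs]
    dsimp only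
    split_ifs with h h'
    · simp [hT _ _ h]
    · simpa using hF _ _ h'
    · simp
  | imp a b iha ihb =>
    rw [partialTruth_imp, evF_imp]
    split_ifs with h h'
    · simp only [forall_const, OfNat.one_ne_ofNat, false_imp_iff, and_true]
      tauto
    · simp only [OfNat.ofNat_ne_one, false_imp_iff, forall_const, true_and]
      tauto
    · simp
  | junk t r h => simp [partialTruth_junk _ h, evF_junk _ h]

end herbrandValue

/-- Every pattern of bits is realized on an initial segment by a natural number. -/
theorem exists_nat_bits (N : ℕ) (p : ℕ → Prop) :
    ∃ ε < 2 ^ N, ∀ i, ε / 2 ^ i % 2 = 1 ↔ i < N ∧ p i := by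
  classical
  induction N generalizing p with
  | zero => exact ⟨0, by norm_num, by simp⟩
  | succ N ih =>
    obtain ⟨ε, hε, h⟩ := ih (fun i => p (i + 1))
    refine ⟨2 * ε + (if p 0 then 1 else 0), ?_, fun i => ?_⟩
    · rw [pow_succ]; split_ifs <;> omega
    · cases i with
      | zero => split_ifs with h0 <;> simp [h0]
      | succ i =>
        have : (2 * ε + (if p 0 then 1 else 0)) / 2 ^ (i + 1) = ε / 2 ^ i := by
          rw [pow_succ', ← Nat.div_div_eq_div_mul]
          congr 1
          split_ifs <;> omega
        rw [this, h]
        simp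

/-- If all patterns of `N` bits are refuted, so is the pattern of the equations that hold in a given
infinite field. As this pattern violates no axiom, the formula has a solution there. -/
theorem valid_of_certificate {c N : ℕ}
    (h : ∀ ε < 2 ^ N, ∃ a < N, ∃ b < N, ∃ d < N, Refutes c N ε a b d) : Valid.{u} c := by
  intro K _ _ x
  by_contra hx
  push Not at hx
  obtain ⟨ε, hε, hbits⟩ := exists_nat_bits N
    (fun i => herbrandValue x (unpair i).1 = herbrandValue x (unpair i).2)
  have hT : ∀ s t, Asserts ε s t → herbrandValue x s = herbrandValue x t := by
    intro s t hst
    simpa using ((hbits _).1 hst).2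
  have hF : ∀ s t, Denies N ε s t → herbrandValue x s ≠ herbrandValue x t := by
    rintro s t ⟨hN, hst⟩ heq
    exact hst ((hbits _).2 ⟨hN, by simpa using heq⟩)
  obtain ⟨a, -, b, -, d, -, hr | hr⟩ := h ε hε
  · exact not_axiomViolated x hT hF a b d hr
  · exact hx _ ((partialTruth_of_agree x hT hF a c).1 hr)

/-- The compactness half of Herbrand's theorem: if for all `N` there is a pattern that is not
refuted, these patterns converge to the diagram of an infinite field without a solution. -/
theorem Valid.exists_certificate {c : ℕ} (hc : Valid.{u} c) :
    ∃ N, ∀ ε < 2 ^ N, ∃ a < N, ∃ b < N, ∃ d < N, Refutes c N ε a b d := by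
  by_contra hcon
  push Not at hcon
  choose ε hε hbad using hcon
  -- The limit of the patterns `ε N` along an ultrafilter is a complete diagram of a field.
  let U : Ultrafilter ℕ := hyperfilter ℕ
  have hU : (U : Filter ℕ) ≤ atTop := by
    rw [← Nat.cofinite_eq_atTop]
    exact hyperfilter_le_cofinite
  let E : ℕ → ℕ → Prop := fun s t => ∀ᶠ N in (U : Filter ℕ), Asserts (ε N) s t
  have hE : ∀ s t, ∀ᶠ N in (U : Filter ℕ), (Asserts (ε N) s t ↔ E s t) ∧
      (Denies N (ε N) s t ↔ ¬ E s t) := by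
    intro s t
    have h1 : ∀ᶠ N in (U : Filter ℕ), (Asserts (ε N) s t ↔ E s t) := by
      by_cases h : E s t
      · exact h.mono fun N hN => by simp [hN, h]
      · have h' := Ultrafilter.eventually_not.2 h
        exact h'.mono fun N hN => by simp [hN, h]
    filter_upwards [h1, hU (eventually_gt_atTop (pair s t))] with N hN hN'
    exact ⟨hN, by simp [Denies, hN, hN']⟩
  have hax : ∀ a b d, ¬ AxiomViolated E (fun s t => ¬ E s t) a b d := by
    intro a b d
    have h1 : ∀ᶠ N in (U : Filter ℕ), a < N ∧ b < N ∧ d < N := by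
      filter_upwards [hU (eventually_gt_atTop a), hU (eventually_gt_atTop b),
        hU (eventually_gt_atTop d)] with N ha hb hd using ⟨ha, hb, hd⟩
    -- All terms that occur in the instance of the axioms at `a`, `b`, `d` are listed, so that a
    -- single pattern agrees with the limit on all equations between them.
    obtain ⟨N, hN, h⟩ := (h1.and (((eventually_all_finset
      ({a, b, d, ad a d, ad b d, ml a d, ml b d, ng a, ng b, ad a b, ad b a, ad (ad a b) d,
        ad a (ad b d), ad zr a, ad (ng a) a, zr, ml a b, ml b a, ml (ml a b) d, ml a (ml b d),
        ml on a, ml a (ad b d), ad (ml a b) (ml a d), on, ml a (vr (pair a 1)), vr (pair a 2),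
        vr (pair b 2)} : Finset ℕ)).2 fun s _ => (eventually_all_finset
      ({a, b, d, ad a d, ad b d, ml a d, ml b d, ng a, ng b, ad a b, ad b a, ad (ad a b) d,
        ad a (ad b d), ad zr a, ad (ng a) a, zr, ml a b, ml b a, ml (ml a b) d, ml a (ml b d),
        ml on a, ml a (ad b d), ad (ml a b) (ml a d), on, ml a (vr (pair a 1)), vr (pair a 2),
        vr (pair b 2)} : Finset ℕ)).2 fun t _ => hE s t))).exists
    have hb := hbad N a hN.1 b hN.2.1 d hN.2.2
    refine fun hv => hb (Or.inl ?_)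
    unfold AxiomViolated at hv ⊢
    have hT : ∀ s t, _ → _ → (Asserts (ε N) s t ↔ E s t) := fun s t hs ht => (h s hs t ht).1
    have hF : ∀ s t, _ → _ → (Denies N (ε N) s t ↔ ¬ E s t) := fun s t hs ht => (h s hs t ht).2
    simp (discharger := simp only [Finset.mem_insert, Finset.mem_singleton, true_or, or_true])
      only [hT, hF]
    exact hv
  obtain ⟨K, _, _, m, hsurj, hm, h0, h1, hn, ha, hmul⟩ := exists_field_of_pattern hax
  have hs := map_subst h0 h1 hn ha hmul
  have htruth : ∀ y c, ∀ᶠ N in (U : Filter ℕ),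
      (evF (xy (m (vr 0)) (m y)) c → partialTruth (N, ε N, y) c = 1) ∧
      (¬ evF (xy (m (vr 0)) (m y)) c → partialTruth (N, ε N, y) c = 2) := by
    intro y c
    induction c using formula_induction with
    | falsum r => simp [partialTruth_falsum]
    | equal a b =>
      filter_upwards [hE (subst y a) (subst y b)] with N hN
      rw [partialTruth_equal, evF_equal, ← hs, ← hs, hm]
      dsimp only
      constructor
      · intro h; rw [if_pos (hN.1.2 h)]
      · intro h; rw [if_neg (fun h' => h (hN.1.1 h')), if_pos (hN.2.2 h)]
    | imp a b iha ihb =>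
      filter_upwards [iha, ihb] with N hNa hNb
      rw [partialTruth_imp, evF_imp]
      constructor
      · intro h
        rw [if_pos]
        tauto
      · intro h
        have hab : evF (xy (m (vr 0)) (m y)) a ∧ ¬ evF (xy (m (vr 0)) (m y)) b := by tauto
        rw [hNa.1 hab.1, hNb.2 hab.2]
        rfl
    | junk t r h => simp [partialTruth_junk _ h, evF_junk _ h]
  -- The field `K` lives in `Type` and is lifted to the universe of `Valid`.
  obtain ⟨y, hy⟩ := hc (ULift.{u} K) (ULift.up (m (vr 0)))
  obtain ⟨a, ha⟩ := hsurj y.down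
  have hy' : evF (xy (m (vr 0)) (m a)) c := by
    rw [ha]
    exact (evF_xy_map_iff (ULift.ringEquiv (R := K)).symm
      (ULift.ringEquiv (R := K)).symm.injective _ _ _).1 hy
  obtain ⟨N, hN, haN⟩ := ((htruth a c).and (hU (eventually_gt_atTop a))).exists
  exact hbad N a haN a haN a haN (Or.inr (hN.1 hy'))

theorem rePred_valid : REPred Valid.{u} := by
  have h : REPred fun c => ∃ N, BAll (2 ^ N) fun ε => BEx N fun a => BEx N fun b => BEx N fun d =>
      Refutes c N ε a b d := by
    refine rePred_exists ?_
    unfold Refutes AxiomViolated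
    fun_prop
  exact h.of_eq fun c => ⟨fun ⟨N, hN⟩ => valid_of_certificate hN, fun h => h.exists_certificate⟩

open Polynomial

/-! ### Weights of polynomials -/

/-- A subadditive and submultiplicative size function on a ring. -/
structure IsWeight {R : Type*} [CommRing R] (ν : R → ℕ) : Prop where
  zero : ν 0 = 0
  one : ν 1 = 1
  neg : ∀ a, ν (-a) = ν a
  add_le : ∀ a b, ν (a + b) ≤ ν a + ν b
  mul_le : ∀ a b, ν (a * b) ≤ ν a * ν b

/-- The weight `∑ ν(aᵢ) 2ⁱ` of a polynomial `∑ aᵢ Xⁱ`. It bounds the coefficients and the degree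
at the same time. -/
def polyWeight {R : Type*} [CommRing R] (ν : R → ℕ) (p : R[X]) : ℕ :=
  p.sum fun i a => ν a * 2 ^ i

section Weight

variable {R : Type*} [CommRing R] {ν : R → ℕ} (hν : IsWeight ν)
include hν

theorem polyWeight_monomial (n : ℕ) (a : R) : polyWeight ν (monomial n a) = ν a * 2 ^ n :=
  sum_monomial_index _ _ (by simp [hν.zero])

theorem polyWeight_C (a : R) : polyWeight ν (C a) = ν a := by
  simpa using polyWeight_monomial hν 0 a

theorem polyWeight_X : polyWeight ν (X : R[X]) = 2 := by
  rw [X, polyWeight_monomial hν, hν.one]; rfl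

theorem polyWeight_eq_sum (p : R[X]) {n : ℕ} (hn : p.natDegree < n) :
    polyWeight ν p = ∑ i ∈ Finset.range n, ν (p.coeff i) * 2 ^ i :=
  sum_over_range' p (f := fun i a => ν a * 2 ^ i) (by simp [hν.zero]) n hn

theorem polyWeight_add_le (p q : R[X]) :
    polyWeight ν (p + q) ≤ polyWeight ν p + polyWeight ν q := by
  set n := max (max p.natDegree q.natDegree) (p + q).natDegree + 1
  rw [polyWeight_eq_sum hν (p + q) (n := n) (by omega), polyWeight_eq_sum hν p (n := n) (by omega),
    polyWeight_eq_sum hν q (n := n) (by omega), ← Finset.sum_add_distrib]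
  refine Finset.sum_le_sum fun i _ => ?_
  rw [coeff_add, ← add_mul]
  exact Nat.mul_le_mul_right _ (hν.add_le _ _)

theorem polyWeight_sum_le {ι : Type*} (s : Finset ι) (f : ι → R[X]) :
    polyWeight ν (∑ i ∈ s, f i) ≤ ∑ i ∈ s, polyWeight ν (f i) :=
  Finset.le_sum_of_subadditive _ (by simp [polyWeight]) (polyWeight_add_le hν) _ _

theorem isWeight_polyWeight : IsWeight (polyWeight ν) where
  zero := by simp [polyWeight]
  one := by rw [← C_1, polyWeight_C hν, hν.one]
  neg p := by
    rw [polyWeight_eq_sum hν (-p) (n := p.natDegree + 1) (by rw [natDegree_neg]; omega),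
      polyWeight_eq_sum hν p (n := p.natDegree + 1) (by omega)]
    simp [hν.neg]
  add_le := polyWeight_add_le hν
  mul_le p q := by
    rw [mul_eq_sum_sum]
    refine (polyWeight_sum_le hν _ _).trans ?_
    rw [polyWeight, Polynomial.sum, Finset.sum_mul]
    refine Finset.sum_le_sum fun i _ => ?_
    rw [Polynomial.sum]
    refine (polyWeight_sum_le hν _ _).trans ?_
    rw [polyWeight, Polynomial.sum, Finset.mul_sum]
    refine Finset.sum_le_sum fun j _ => ?_
    rw [polyWeight_monomial hν, pow_add]
    calc _ ≤ (ν (p.coeff i) * ν (q.coeff j)) * (2 ^ i * 2 ^ j) :=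
          Nat.mul_le_mul_right _ (hν.mul_le _ _)
      _ = _ := by ring

theorem coeff_mul_two_pow_le (p : R[X]) (i : ℕ) : ν (p.coeff i) * 2 ^ i ≤ polyWeight ν p := by
  rw [polyWeight_eq_sum hν p (n := max p.natDegree i + 1) (by omega)]
  exact Finset.single_le_sum (f := fun i => ν (p.coeff i) * 2 ^ i) (fun _ _ => Nat.zero_le _)
    (Finset.mem_range.2 (by omega))

theorem coeff_le_polyWeight (p : R[X]) (i : ℕ) : ν (p.coeff i) ≤ polyWeight ν p :=
  (Nat.le_mul_of_pos_right _ (by positivity)).trans (coeff_mul_two_pow_le hν p i)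

theorem natDegree_lt_polyWeight (hpos : ∀ a, a ≠ 0 → 0 < ν a) {p : R[X]} (hp : p ≠ 0) :
    p.natDegree < polyWeight ν p :=
  calc p.natDegree < 2 ^ p.natDegree := Nat.lt_two_pow_self
    _ ≤ ν (p.coeff p.natDegree) * 2 ^ p.natDegree :=
      Nat.le_mul_of_pos_left _ (hpos _ (by simpa using hp))
    _ ≤ _ := coeff_mul_two_pow_le hν p _

end Weight

theorem isWeight_natAbs : IsWeight Int.natAbs :=
  ⟨rfl, rfl, Int.natAbs_neg, Int.natAbs_add_le, fun a b => (Int.natAbs_mul a b).le⟩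

/-- The weight of a polynomial with integer coefficients. -/
def wt (p : ℤ[X]) : ℕ := polyWeight Int.natAbs p

/-- The weight of a polynomial in two variables with integer coefficients. -/
noncomputable def wt₂ (p : ℤ[X][X]) : ℕ := polyWeight wt p

theorem isWeight_wt : IsWeight wt := isWeight_polyWeight isWeight_natAbs

theorem isWeight_wt₂ : IsWeight wt₂ := isWeight_polyWeight isWeight_wt

theorem wt_pos {p : ℤ[X]} (hp : p ≠ 0) : 0 < wt p :=
  Nat.zero_lt_of_lt (natDegree_lt_polyWeight isWeight_natAbs (fun _ h => Int.natAbs_pos.2 h) hp)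

theorem natDegree_lt_wt {p : ℤ[X]} (hp : p ≠ 0) : p.natDegree < wt p :=
  natDegree_lt_polyWeight isWeight_natAbs (fun _ h => Int.natAbs_pos.2 h) hp

theorem abs_coeff_le_wt (p : ℤ[X]) (i : ℕ) : |p.coeff i| ≤ wt p := by
  have := coeff_le_polyWeight isWeight_natAbs p i
  rw [Int.abs_eq_natAbs]
  exact_mod_cast this

/-- `u` has degree less than `n` and coefficients of absolute value less than `b`. -/
def InBox (n b : ℕ) (u : ℤ[X]) : Prop := u.natDegree < n ∧ ∀ i, |u.coeff i| < b

theorem InBox.of_wt_lt {u : ℤ[X]} {n : ℕ} (h : wt u < n) : InBox n n u := by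
  refine ⟨?_, fun i => (abs_coeff_le_wt u i).trans_lt (by exact_mod_cast h)⟩
  by_cases hu : u = 0
  · rw [hu, natDegree_zero]; omega
  · exact (natDegree_lt_wt hu).trans h

theorem InBox.wt_le {u : ℤ[X]} {n b : ℕ} (h : InBox n b u) : wt u ≤ n * b * 2 ^ n := by
  rw [wt, polyWeight_eq_sum isWeight_natAbs u h.1]
  calc _ ≤ ∑ i ∈ Finset.range n, b * 2 ^ n := by
        refine Finset.sum_le_sum fun i hi => ?_
        refine Nat.mul_le_mul ?_ (Nat.pow_le_pow_right (by norm_num) (Finset.mem_range.1 hi).le)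
        have := h.2 i
        rw [Int.abs_eq_natAbs] at this
        exact_mod_cast this.le
    _ = _ := by simp [mul_assoc]

/-- The value at `t` of a polynomial with integer coefficients, in any ring. -/
noncomputable abbrev ev {R : Type*} [CommRing R] (t : R) (s : ℤ[X]) : R := aeval t s

/-! ### Codes as polynomials -/

/-- Read as a polynomial in `x` and `y`, a term has a weight bounded in terms of its code. -/
theorem wt₂_evT_le (c : ℕ) : wt₂ (evT (xy (C X) X) c) ≤ 2 ^ (c + 1) := by
  have h := isWeight_wt₂
  induction c using term_induction with
  | var i =>
    rw [evT_var, xy]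
    have h1 : 2 ≤ 2 ^ (vr i + 1) := by
      rw [pow_succ]; exact Nat.le_mul_of_pos_left _ (by positivity)
    split_ifs
    · rw [wt₂, polyWeight_C isWeight_wt, wt, polyWeight_X isWeight_natAbs]; exact h1
    · rw [wt₂, polyWeight_X isWeight_wt]; exact h1
  | zero r => rw [evT_zero, h.zero]; positivity
  | one r => rw [evT_one, h.one]; exact Nat.one_le_two_pow
  | neg a ih =>
    rw [evT_neg, h.neg]
    exact ih.trans (Nat.pow_le_pow_right (by norm_num) (Nat.succ_le_succ (Nat.right_le_pair _ _)))
  | add a b iha ihb =>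
    rw [evT_add]
    have h1 := Nat.add_le_pair a b
    have h2 : 4 + pair a b ≤ ad a b := Nat.add_le_pair _ _
    have ha : 2 ^ (a + 1) ≤ 2 ^ (a + b + 1) := Nat.pow_le_pow_right (by norm_num) (by omega)
    have hb : 2 ^ (b + 1) ≤ 2 ^ (a + b + 1) := Nat.pow_le_pow_right (by norm_num) (by omega)
    calc _ ≤ 2 ^ (a + 1) + 2 ^ (b + 1) := (h.add_le _ _).trans (add_le_add iha ihb)
      _ ≤ 2 ^ (a + b + 2) := by rw [pow_succ 2 (a + b + 1)]; omega
      _ ≤ _ := Nat.pow_le_pow_right (by norm_num) (by omega)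
  | mul a b iha ihb =>
    rw [evT_mul]
    have h1 := Nat.add_le_pair a b
    have h2 : 5 + pair a b ≤ ml a b := Nat.add_le_pair _ _
    calc _ ≤ 2 ^ (a + 1) * 2 ^ (b + 1) := (h.mul_le _ _).trans (Nat.mul_le_mul iha ihb)
      _ = 2 ^ (a + b + 2) := by rw [← pow_add]; congr 1; omega
      _ ≤ _ := Nat.pow_le_pow_right (by norm_num) (by omega)
  | junk t r ht => rw [evT_junk _ ht, h.zero]; positivity

theorem natDegree_evT_le {K : Type*} [Field K] (x : K) (c : ℕ) :
    (evT (xy (C x) X) c).natDegree ≤ c + 1 := by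
  induction c using term_induction with
  | var i =>
    rw [evT_var, xy]
    split_ifs
    · simp
    · exact natDegree_X_le.trans (by omega)
  | zero r => simp
  | one r => simp
  | neg a ih =>
    rw [evT_neg, natDegree_neg]
    exact ih.trans (Nat.succ_le_succ (Nat.right_le_pair _ _))
  | add a b iha ihb =>
    rw [evT_add]
    have h1 := Nat.add_le_pair a b
    have h2 : 4 + pair a b ≤ ad a b := Nat.add_le_pair _ _
    exact (natDegree_add_le _ _).trans (max_le (by omega) (by omega))
  | mul a b iha ihb =>
    rw [evT_mul]
    have h1 := Nat.add_le_pair a b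
    have h2 : 5 + pair a b ≤ ml a b := Nat.add_le_pair _ _
    exact natDegree_mul_le.trans (by omega)
  | junk t r ht => simp [evT_junk _ ht]

/-- Over a field, the truth of a quantifier-free formula at `(x, y)` does not depend on `y` outside
the finite set of the roots of the nonzero atomic polynomials. Its value there is the one at the
generic point `(x, X)`. -/
theorem exists_exceptional_set {K : Type*} [Field K] (x : K) (c : ℕ) :
    ∃ S : Finset K, S.card ≤ c + 1 ∧
      (∀ y ∈ S, ∃ a b, a + b ≤ c ∧ evT (xy (C x) X) a ≠ evT (xy (C x) X) b ∧
        evT (xy x y) a = evT (xy x y) b) ∧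
      ∀ y ∉ S, (evF (xy x y) c ↔ evF (xy (C x) X) c) := by
  classical
  induction c using formula_induction with
  | falsum r => exact ⟨∅, by simp⟩
  | equal a b =>
    have h1 := Nat.add_le_pair a b
    have h2 := Nat.add_le_pair 1 (pair a b)
    set g : K[X] := evT (xy (C x) X) a - evT (xy (C x) X) b with hg
    have hroot : ∀ y, g.eval y = evT (xy x y) a - evT (xy x y) b := by
      intro y
      have : ∀ d, (evT (xy (C x) X) d).eval y = evT (xy x y) d := by
        intro d
        rw [← coe_evalRingHom, map_evT_xy]
        simp
      rw [hg, eval_sub, this, this]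
    by_cases h0 : g = 0
    · refine ⟨∅, by simp, by simp, fun y _ => ?_⟩
      have := hroot y
      rw [h0, eval_zero] at this
      rw [evF_equal, evF_equal, ← sub_eq_zero, ← this, ← sub_eq_zero (b := evT (xy (C x) X) b),
        ← hg, h0]
      simp
    · refine ⟨g.roots.toFinset, ?_,
        fun y hy => ⟨a, b, by omega, fun h => h0 (sub_eq_zero.2 h), ?_⟩, fun y hy => ?_⟩
      · refine (Multiset.toFinset_card_le _).trans ((card_roots' g).trans ?_)
        have ha := natDegree_evT_le x a
        have hb := natDegree_evT_le x b
        exact (natDegree_sub_le _ _).trans (max_le (by omega) (by omega))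
      · rw [Multiset.mem_toFinset, mem_roots h0, IsRoot, hroot, sub_eq_zero] at hy
        exact hy
      · rw [Multiset.mem_toFinset, mem_roots h0, IsRoot, hroot, sub_eq_zero] at hy
        rw [evF_equal, evF_equal]
        exact iff_of_false hy fun h => h0 (sub_eq_zero.2 h)
  | imp a b iha ihb =>
    have h1 := Nat.add_le_pair a b
    have h2 := Nat.add_le_pair 2 (pair a b)
    obtain ⟨S, hS, hS', hS''⟩ := iha
    obtain ⟨T, hT, hT', hT''⟩ := ihb
    refine ⟨S ∪ T, (Finset.card_union_le _ _).trans (by omega), fun y hy => ?_, fun y hy => ?_⟩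
    · obtain hy | hy := Finset.mem_union.1 hy
      · obtain ⟨a', b', h, h'⟩ := hS' y hy
        exact ⟨a', b', by omega, h'⟩
      · obtain ⟨a', b', h, h'⟩ := hT' y hy
        exact ⟨a', b', by omega, h'⟩
    · rw [Finset.mem_union, not_or] at hy
      rw [evF_imp, evF_imp, hS'' y hy.1, hT'' y hy.2]
  | junk t r h => exact ⟨∅, by simp [evF_junk _ h]⟩

/-! ### Evaluation at fractions -/

/-- Numerator and denominator of the value of the term `c` at `(x, u / v)`; the argument is
`(x, u, v)`. -/
def fracT {R : Type*} [CommRing R] (w : R × R × R) (c : ℕ) : R × R :=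
  treeRec 0 (fun (w : R × R × R) c p l r => byTag (unpair c).1
    (if (unpair c).2 = 0 then (w.1, 1) else w.2) (0, 1) (1, 1) (-p.1, p.2)
    (l.1 * r.2 + r.1 * l.2, l.2 * r.2) (l.1 * r.1, l.2 * r.2) (0, 1)) w c

section fracT

variable {R : Type*} [CommRing R] (w : R × R × R)

theorem fracT_var (i : ℕ) : fracT w (vr i) = if i = 0 then (w.1, 1) else w.2 := by
  rw [fracT, treeRec]; simp
theorem fracT_zero (r : ℕ) : fracT w (pair 1 r) = (0, 1) := by
  rw [fracT, treeRec]; simp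
theorem fracT_one (r : ℕ) : fracT w (pair 2 r) = (1, 1) := by
  rw [fracT, treeRec]; simp
theorem fracT_neg (a : ℕ) : fracT w (ng a) = (-(fracT w a).1, (fracT w a).2) := by
  rw [fracT, treeRec_pair _ _ _ (by norm_num)]; simp [fracT]
theorem fracT_add (a b : ℕ) : fracT w (ad a b) =
    ((fracT w a).1 * (fracT w b).2 + (fracT w b).1 * (fracT w a).2,
      (fracT w a).2 * (fracT w b).2) := by
  rw [fracT, treeRec_pair _ _ _ (by norm_num)]; simp [fracT]
theorem fracT_mul (a b : ℕ) : fracT w (ml a b) =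
    ((fracT w a).1 * (fracT w b).1, (fracT w a).2 * (fracT w b).2) := by
  rw [fracT, treeRec_pair _ _ _ (by norm_num)]; simp [fracT]
theorem fracT_junk {t r : ℕ} (ht : 6 ≤ t) : fracT w (pair t r) = (0, 1) := by
  rw [fracT, treeRec_pair _ _ _ (by omega)]
  simp [byTag_junk _ _ _ _ _ _ _ ht]

/-- The value of a term at a fraction `u / v` is the fraction computed by `fracT`. -/
theorem evT_div {K : Type*} [Field K] (f : R →+* K) (x u v : R) (hv : f v ≠ 0) (c : ℕ) :
    f (fracT (x, u, v) c).2 ≠ 0 ∧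
      evT (xy (f x) (f u / f v)) c = f (fracT (x, u, v) c).1 / f (fracT (x, u, v) c).2 := by
  induction c using term_induction with
  | var i => rw [fracT_var, evT_var, xy]; split_ifs <;> simp [hv]
  | zero r => simp [fracT_zero]
  | one r => simp [fracT_one]
  | neg a ih => rw [fracT_neg, evT_neg, ih.2]; simp [ih.1, neg_div]
  | add a b iha ihb =>
    rw [fracT_add, evT_add, iha.2, ihb.2]
    have ha := iha.1
    have hb := ihb.1
    refine ⟨by simp [ha, hb], ?_⟩
    simp only [map_add, map_mul]
    field_simp
  | mul a b iha ihb =>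
    rw [fracT_mul, evT_mul, iha.2, ihb.2]
    refine ⟨by simp [iha.1, ihb.1], ?_⟩
    simp only [map_mul]
    rw [div_mul_div_comm]
  | junk t r h => simp [fracT_junk _ h, evT_junk _ h]

end fracT

theorem wt_fracT_le {u v : ℤ[X]} {N : ℕ} (hN : 1 ≤ N) (hu : wt u ≤ 2 * N) (hv : wt v ≤ 2 * N)
    (c : ℕ) : wt (fracT (X, u, v) c).1 ≤ (2 * N) ^ (c + 1) ∧
      wt (fracT (X, u, v) c).2 ≤ (2 * N) ^ (c + 1) := by
  have h := isWeight_wt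
  have hpow : ∀ {i j : ℕ}, i ≤ j → (2 * N) ^ i ≤ (2 * N) ^ j := fun hij =>
    Nat.pow_le_pow_right (by omega) hij
  have hone : ∀ i, 1 ≤ (2 * N) ^ i := fun i => Nat.one_le_pow _ _ (by omega)
  have hfst : ∀ i, 2 * N ≤ (2 * N) ^ (i + 1) := fun i => by
    simpa using hpow (show 1 ≤ i + 1 by omega)
  induction c using term_induction with
  | var i =>
    rw [fracT_var]
    split_ifs
    · refine ⟨?_, by rw [h.one]; exact hone _⟩
      rw [wt, polyWeight_X isWeight_natAbs]
      exact le_trans (by omega) (hfst _)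
    · exact ⟨hu.trans (hfst _), hv.trans (hfst _)⟩
  | zero r => rw [fracT_zero, h.zero, h.one]; exact ⟨by omega, hone _⟩
  | one r => rw [fracT_one, h.one]; exact ⟨hone _, hone _⟩
  | neg a ih =>
    rw [fracT_neg, h.neg]
    have := hpow (Nat.succ_le_succ (Nat.right_le_pair 3 a))
    exact ⟨ih.1.trans this, ih.2.trans this⟩
  | add a b iha ihb =>
    rw [fracT_add]
    have h1 := Nat.add_le_pair a b
    have h2 : 4 + pair a b ≤ ad a b := Nat.add_le_pair _ _
    have h3 : (2 * N) ^ (a + 1) * (2 * N) ^ (b + 1) = (2 * N) ^ (a + b + 2) := by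
      rw [← pow_add]; congr 1; omega
    have h4 : 2 * (2 * N) ^ (a + b + 2) ≤ (2 * N) ^ (a + b + 3) := by
      rw [pow_succ _ (a + b + 2), mul_comm]
      exact Nat.mul_le_mul_left _ (by omega)
    have h5 := (h.mul_le _ _).trans (Nat.mul_le_mul iha.1 ihb.2)
    have h6 := (h.mul_le _ _).trans (Nat.mul_le_mul ihb.1 iha.2)
    have h7 := (h.mul_le _ _).trans (Nat.mul_le_mul iha.2 ihb.2)
    have h8 := h.add_le ((fracT (X, u, v) a).1 * (fracT (X, u, v) b).2)
      ((fracT (X, u, v) b).1 * (fracT (X, u, v) a).2)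
    have h9 := hpow (show a + b + 3 ≤ ad a b + 1 by omega)
    rw [mul_comm ((2 * N) ^ (b + 1))] at h6
    constructor <;> dsimp only <;> omega
  | mul a b iha ihb =>
    rw [fracT_mul]
    have h1 := Nat.add_le_pair a b
    have h2 : 5 + pair a b ≤ ml a b := Nat.add_le_pair _ _
    have h3 : (2 * N) ^ (a + 1) * (2 * N) ^ (b + 1) = (2 * N) ^ (a + b + 2) := by
      rw [← pow_add]; congr 1; omega
    have h5 := (h.mul_le _ _).trans (Nat.mul_le_mul iha.1 ihb.1)
    have h7 := (h.mul_le _ _).trans (Nat.mul_le_mul iha.2 ihb.2)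
    have h9 := hpow (show a + b + 2 ≤ ml a b + 1 by omega)
    constructor <;> dsimp only <;> omega
  | junk t r ht => rw [fracT_junk _ ht, h.zero, h.one]; exact ⟨by omega, hone _⟩

/-- A bound for the weights of the integer polynomials whose vanishing decides the truth of a
formula with code at most `c` at a fraction with numerator and denominator in the box of size
`B`. -/
def testBound (c B : ℕ) : ℕ := (2 * (B * B * 2 ^ B + 1)) ^ (c + 3)

/-- If the integer polynomials of small weight vanish at `x` exactly when they vanish at `t`, then
the same formulas hold at corresponding fractions of small polynomials in `x` and `t`. -/
theorem evF_div_iff {K k : Type*} [Field K] [Field k] {x : K} {t : k} {c B : ℕ}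
    (hz : ∀ s : ℤ[X], wt s ≤ testBound c B → (ev x s = 0 ↔ ev t s = 0)) {u v : ℤ[X]}
    (hu : InBox B B u) (hv : InBox B B v) (hvx : ev x v ≠ 0) (hvt : ev t v ≠ 0) :
    evF (xy x (ev x u / ev x v)) c ↔ evF (xy t (ev t u / ev t v)) c := by
  set N := B * B * 2 ^ B + 1 with hN
  have hu' : wt u ≤ 2 * N := hu.wt_le.trans (by omega)
  have hv' : wt v ≤ 2 * N := hv.wt_le.trans (by omega)
  have key : ∀ d ≤ c, (evF (xy x (ev x u / ev x v)) d ↔ evF (xy t (ev t u / ev t v)) d) := by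
    intro d
    induction d using formula_induction with
    | falsum r => simp
    | equal a b =>
      intro hd
      have h1 := Nat.add_le_pair a b
      have h2 := Nat.add_le_pair 1 (pair a b)
      have hx : ∀ e, _ := evT_div (aeval x : ℤ[X] →ₐ[ℤ] K).toRingHom X u v hvx
      have ht : ∀ e, _ := evT_div (aeval t : ℤ[X] →ₐ[ℤ] k).toRingHom X u v hvt
      simp only [AlgHom.toRingHom_eq_coe, RingHom.coe_coe, aeval_X] at hx ht
      rw [evF_equal, evF_equal, (hx a).2, (hx b).2, (ht a).2, (ht b).2,
        div_eq_div_iff (hx a).1 (hx b).1, div_eq_div_iff (ht a).1 (ht b).1]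
      have hs := hz ((fracT (X, u, v) a).1 * (fracT (X, u, v) b).2 -
        (fracT (X, u, v) b).1 * (fracT (X, u, v) a).2) ?_
      · simpa only [ev, map_sub, map_mul, sub_eq_zero] using hs
      · have ha := wt_fracT_le (by omega : 1 ≤ N) hu' hv' a
        have hb := wt_fracT_le (by omega : 1 ≤ N) hu' hv' b
        have h := isWeight_wt
        have h3 : (2 * N) ^ (a + 1) * (2 * N) ^ (b + 1) = (2 * N) ^ (a + b + 2) := by
          rw [← pow_add]; congr 1; omega
        have h4 : 2 * (2 * N) ^ (a + b + 2) ≤ (2 * N) ^ (a + b + 3) := by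
          rw [pow_succ _ (a + b + 2), mul_comm]
          exact Nat.mul_le_mul_left _ (by omega)
        have h5 := (h.mul_le _ _).trans (Nat.mul_le_mul ha.1 hb.2)
        have h6 := (h.mul_le _ _).trans (Nat.mul_le_mul hb.1 ha.2)
        rw [mul_comm ((2 * N) ^ (b + 1))] at h6
        have h8 := h.add_le ((fracT (X, u, v) a).1 * (fracT (X, u, v) b).2)
          (-((fracT (X, u, v) b).1 * (fracT (X, u, v) a).2))
        rw [h.neg, ← sub_eq_add_neg] at h8
        have h9 : (2 * N) ^ (a + b + 3) ≤ (2 * N) ^ (c + 3) :=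
          Nat.pow_le_pow_right (by omega) (by omega)
        rw [testBound, ← hN]
        omega
    | imp a b iha ihb =>
      intro hd
      have h1 := Nat.add_le_pair a b
      have h2 := Nat.add_le_pair 2 (pair a b)
      rw [evF_imp, evF_imp, iha (by omega), ihb (by omega)]
    | junk t r h => simp [evF_junk _ h]
  exact key c le_rfl

/-- The formula `c` fails at `(t, y)` for all fractions `y` of polynomials in `t` from the box of
size `B`. -/
def BoxFails {k : Type*} [Field k] (t : k) (c B : ℕ) : Prop :=
  ∀ u v : ℤ[X], InBox B B u → InBox B B v → ev t v ≠ 0 → ¬ evF (xy t (ev t u / ev t v)) c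

/-- Transfer of a failure from `(k, t)` to `(K, x)`. It suffices that the integer polynomials of
small weight vanish at `x` exactly when they vanish at `t`, that the roots in `K` of the nonzero
atomic polynomials over `x` are fractions of polynomials from the box, and that the box yields more
elements of `K` than there are such roots. -/
theorem fails_of_boxFails {K k : Type*} [Field K] [Field k] {x : K} {t : k} {c B : ℕ}
    (hz : ∀ s : ℤ[X], wt s ≤ testBound c B → (ev x s = 0 ↔ ev t s = 0))
    (hr : ∀ (f : ℤ[X][X]) (y : K), wt₂ f ≤ 2 ^ (c + 2) → f.map (aeval x).toRingHom ≠ 0 →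
      (f.map (aeval x).toRingHom).eval y = 0 →
      ∃ u v : ℤ[X], InBox B B u ∧ InBox B B v ∧ ev x v ≠ 0 ∧ y = ev x u / ev x v)
    (hg : ∀ S : Finset K, S.card ≤ c + 1 → ∃ u : ℤ[X], InBox B B u ∧ ev x u ∉ S)
    (hB : 2 ≤ B) (hf : BoxFails t c B) (y : K) : ¬ evF (xy x y) c := by
  obtain ⟨S, hS, hroot, hgen⟩ := exists_exceptional_set x c
  have hbox : ∀ u v : ℤ[X], InBox B B u → InBox B B v → ev x v ≠ 0 →
      ¬ evF (xy x (ev x u / ev x v)) c := by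
    intro u v hu hv hvx
    have hvt : ev t v ≠ 0 := fun h => hvx ((hz v (hv.wt_le.trans
      (le_trans (by omega) (Nat.le_self_pow (by omega) (2 * (B * B * 2 ^ B + 1)))))).2 h)
    rw [evF_div_iff hz hu hv hvx hvt]
    exact hf u v hu hv hvt
  -- A root `y` lies in the box; any other `y` behaves like a generic point of the box.
  by_cases hy : y ∈ S
  · obtain ⟨a, b, hab, hne, heq⟩ := hroot y hy
    have hmap : ∀ d, (evT (xy (C X) X) d : ℤ[X][X]).map (aeval x).toRingHom =
        evT (xy (C x) X) d := by
      intro d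
      rw [← coe_mapRingHom, map_evT_xy]
      simp
    set f : ℤ[X][X] := evT (xy (C X) X : ℕ → ℤ[X][X]) a -
      evT (xy (C X) X : ℕ → ℤ[X][X]) b with hfdef
    have hwt : wt₂ f ≤ 2 ^ (c + 2) := by
      have h := isWeight_wt₂
      have h1 := h.add_le (evT (xy (C X) X) a) (-(evT (xy (C X) X) b : ℤ[X][X]))
      rw [h.neg, ← sub_eq_add_neg] at h1
      refine h1.trans ((add_le_add (wt₂_evT_le a) (wt₂_evT_le b)).trans ?_)
      have ha : 2 ^ (a + 1) ≤ 2 ^ (c + 1) := Nat.pow_le_pow_right (by norm_num) (by omega)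
      have hb : 2 ^ (b + 1) ≤ 2 ^ (c + 1) := Nat.pow_le_pow_right (by norm_num) (by omega)
      rw [pow_succ 2 (c + 1)]
      omega
    have hf0 : f.map (aeval x).toRingHom ≠ 0 := by
      rw [hfdef, Polynomial.map_sub, hmap, hmap]
      exact sub_ne_zero.2 hne
    have hfy : (f.map (aeval x).toRingHom).eval y = 0 := by
      rw [hfdef, Polynomial.map_sub, hmap, hmap, ← coe_evalRingHom, map_sub, map_evT_xy,
        map_evT_xy]
      simp [heq]
    obtain ⟨u, v, hu, hv, hvx, rfl⟩ := hr f y hwt hf0 hfy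
    exact hbox u v hu hv hvx
  · obtain ⟨u, hu, huS⟩ := hg S hS
    have h1 : InBox B B 1 := by
      refine ⟨by rw [natDegree_one]; omega, fun i => ?_⟩
      rw [coeff_one]
      split_ifs <;> simp <;> omega
    have := hbox u 1 hu h1 (by simp)
    simp only [ev, map_one, div_one] at this
    rw [hgen y hy, ← hgen _ huS]
    exact this

/-! ### Roots of small polynomials in number fields -/

/-- Cauchy's bound for roots. -/
theorem norm_leadingCoeff_mul_root_le {F : Type*} [NormedField F] {g : F[X]} {z : F}
    (hz : g.eval z = 0) :
    ‖g.leadingCoeff * z‖ ≤ ∑ i ∈ Finset.range (g.natDegree + 1), ‖g.coeff i‖ := by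
  have hnn : ∀ i ∈ Finset.range (g.natDegree + 1), 0 ≤ ‖g.coeff i‖ := fun i _ => norm_nonneg _
  obtain h1 | h1 := le_total ‖z‖ 1
  · rw [norm_mul]
    refine (mul_le_of_le_one_right (norm_nonneg _) h1).trans ?_
    exact Finset.single_le_sum hnn (Finset.mem_range.2 (Nat.lt_succ_self _))
  · obtain h0 | hm := Nat.eq_zero_or_eq_succ_pred g.natDegree
    · rw [eq_C_of_natDegree_eq_zero h0, eval_C] at hz
      rw [leadingCoeff, h0, hz, zero_mul, norm_zero]
      exact Finset.sum_nonneg fun i _ => norm_nonneg _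
    · set m := g.natDegree.pred
      have hz0 : 0 < ‖z‖ ^ m := by positivity
      rw [eval_eq_sum_range, Finset.sum_range_succ, add_comm, add_eq_zero_iff_eq_neg] at hz
      have h2 : ‖g.leadingCoeff * z‖ * ‖z‖ ^ m ≤
          (∑ i ∈ Finset.range g.natDegree, ‖g.coeff i‖) * ‖z‖ ^ m := by
        rw [← norm_pow, ← norm_mul, mul_assoc, ← pow_succ', ← Nat.succ_eq_add_one, ← hm,
          leadingCoeff, hz, norm_neg, norm_pow, Finset.sum_mul]
        refine (norm_sum_le _ _).trans (Finset.sum_le_sum fun i hi => ?_)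
        rw [norm_mul, norm_pow]
        have := Finset.mem_range.1 hi
        exact mul_le_mul_of_nonneg_left (pow_le_pow_right₀ h1 (by omega)) (norm_nonneg _)
      refine (le_of_mul_le_mul_right h2 hz0).trans ?_
      exact Finset.sum_le_sum_of_subset_of_nonneg (Finset.range_mono (Nat.le_succ _))
        fun i hi _ => norm_nonneg _

theorem map_ev {R S F : Type*} [CommRing R] [CommRing S] [FunLike F R S] [RingHomClass F R S]
    (f : F) (t : R) (s : ℤ[X]) : f (ev t s) = ev (f t) s :=
  (aeval_algHom_apply (f : R →+* S).toIntAlgHom t s).symm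

theorem sum_abs_coeff_le_wt (p : ℤ[X]) (n : ℕ) : ∑ i ∈ Finset.range n, |p.coeff i| ≤ wt p := by
  rw [wt, polyWeight_eq_sum isWeight_natAbs p (n := max n (p.natDegree + 1)) (by omega)]
  push_cast
  refine (Finset.sum_le_sum fun i _ => ?_).trans (Finset.sum_le_sum_of_subset_of_nonneg
    (Finset.range_mono (le_max_left n (p.natDegree + 1))) fun i _ _ => by positivity)
  exact le_mul_of_one_le_right (abs_nonneg _) (one_le_pow₀ (by norm_num))

theorem norm_ev_le {z : ℂ} {H n : ℕ} (hH : 1 ≤ H) (hz : ‖z‖ ≤ H) {s : ℤ[X]}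
    (hs : s.natDegree ≤ n) : ‖ev z s‖ ≤ wt s * H ^ n := by
  rw [ev, aeval_eq_sum_range]
  refine (norm_sum_le _ _).trans ?_
  calc ∑ i ∈ Finset.range (s.natDegree + 1), ‖s.coeff i • z ^ i‖
      ≤ ∑ i ∈ Finset.range (s.natDegree + 1), (|s.coeff i| : ℝ) * H ^ n := by
        refine Finset.sum_le_sum fun i hi => ?_
        have := Finset.mem_range.1 hi
        rw [zsmul_eq_mul, norm_mul, norm_pow, Complex.norm_intCast]
        refine mul_le_mul_of_nonneg_left ?_ (abs_nonneg _)
        exact (pow_le_pow_left₀ (norm_nonneg _) hz i).trans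
          (pow_le_pow_right₀ (by exact_mod_cast hH) (by omega))
    _ ≤ _ := by
        rw [← Finset.sum_mul]
        refine mul_le_mul_of_nonneg_right ?_ (by positivity)
        exact_mod_cast sum_abs_coeff_le_wt s _

/-- A monic complex polynomial whose roots are bounded by `H` has coefficients bounded in terms of
`H` and the degree. -/
theorem norm_coeff_le_of_roots_le {p : ℂ[X]} (hp : p.Monic) {H n : ℕ} (hH : 1 ≤ H)
    (hn : p.natDegree ≤ n) (h : ∀ z ∈ p.roots, ‖z‖ ≤ H) (i : ℕ) :
    ‖p.coeff i‖ ≤ (2 * H) ^ n := by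
  have h1 := coeff_le_of_roots_le (f := RingHom.id ℂ) (B := H) i hp (IsAlgClosed.splits _)
    (by rwa [Polynomial.map_id])
  rw [Polynomial.map_id] at h1
  refine h1.trans ?_
  rw [mul_pow, mul_comm]
  have h2 : p.natDegree.choose i ≤ 2 ^ n :=
    (Nat.choose_le_two_pow _ _).trans (Nat.pow_le_pow_right (by norm_num) hn)
  have h3 : H ^ (p.natDegree - i) ≤ H ^ n := Nat.pow_le_pow_right hH (by omega)
  have := Nat.mul_le_mul h2 h3
  exact_mod_cast this

section NumberField

variable {K : Type*} [Field K] [NumberField K]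

/-- Bounds for the conjugates of a root `a` of `h` and of its integral multiple. -/
theorem norm_generator_le {a : K} {h : ℤ[X]} (h0 : ev a h = 0) (hh : h ≠ 0) (σ : K →ₐ[ℚ] ℂ) :
    ‖σ (h.leadingCoeff * a)‖ ≤ wt h ∧ ‖σ a‖ ≤ wt h := by
  set g : ℂ[X] := h.map (Int.castRingHom ℂ) with hg
  have hinj : Function.Injective (Int.castRingHom ℂ) := Int.cast_injective
  have h1 : g.eval (σ a) = 0 := by
    rw [hg, ← algebraMap_int_eq, eval_map_algebraMap]
    exact (map_ev σ a h).symm.trans (by rw [h0, map_zero])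
  have h2 := norm_leadingCoeff_mul_root_le h1
  have h3 : ∑ i ∈ Finset.range (g.natDegree + 1), ‖g.coeff i‖ ≤ wt h := by
    have := sum_abs_coeff_le_wt h (g.natDegree + 1)
    simp only [hg, coeff_map, eq_intCast, Complex.norm_intCast]
    exact_mod_cast this
  have h4 : g.leadingCoeff = h.leadingCoeff := by
    rw [hg, leadingCoeff_map_of_injective hinj]; simp
  rw [h4] at h2
  have h5 := h2.trans h3
  refine ⟨by simpa using h5, ?_⟩
  refine le_trans ?_ h5
  rw [norm_mul, Complex.norm_intCast]
  refine le_mul_of_one_le_left (norm_nonneg _) ?_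
  exact_mod_cast Int.one_le_abs (leadingCoeff_ne_zero.2 hh)

/-- Multiplied by the different of a generator `α`, an integral element becomes an integral
polynomial in `α`, the coefficients of which are traces. -/
theorem mul_derivative_minpoly_eq_sum {α : K} (hα : IsIntegral ℤ α)
    (htop : Algebra.adjoin ℚ {α} = ⊤) (z : K) :
    z * ev α (derivative (minpoly ℤ α)) = ∑ i ∈ Finset.range (minpoly ℤ α).natDegree,
      algebraMap ℚ K (Algebra.trace ℚ K (z * (minpolyDiv ℚ α).coeff i)) * α ^ i := by
  have hα' : IsIntegral ℚ α := hα.tower_top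
  have hmin : minpoly ℚ α = (minpoly ℤ α).map (algebraMap ℤ ℚ) :=
    minpoly.isIntegrallyClosed_eq_field_fractions' ℚ hα
  set pb := PowerBasis.ofAdjoinEqTop hα' htop with hpb
  have hgen : pb.gen = α := PowerBasis.ofAdjoinEqTop_gen hα' htop
  have hdim : pb.dim = (minpoly ℤ α).natDegree := by
    rw [hpb, PowerBasis.ofAdjoinEqTop_dim, hmin, natDegree_map_eq_of_injective Int.cast_injective]
  have hder : ev α (derivative (minpoly ℤ α)) = aeval α (derivative (minpoly ℚ α)) := by
    rw [hmin, derivative_map, aeval_map_algebraMap]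
  have hne : aeval α (derivative (minpoly ℚ α)) ≠ 0 :=
    (Algebra.IsSeparable.isSeparable ℚ α).aeval_derivative_ne_zero (minpoly.aeval ℚ α)
  have hrepr : ∀ x i, pb.basis.repr x i = Algebra.traceForm ℚ K x (pb.basis.traceDual i) := by
    intro x i
    conv_lhs => rw [← pb.basis.traceDual_traceDual]
    exact Module.Basis.traceDual_repr_apply _ _ _
  rw [← pb.basis.sum_repr (z * ev α (derivative (minpoly ℤ α))), ← hdim,
    ← Fin.sum_univ_eq_sum_range (fun i => algebraMap ℚ K (Algebra.trace ℚ K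
      (z * (minpolyDiv ℚ α).coeff i)) * α ^ i)]
  refine Finset.sum_congr rfl fun i _ => ?_
  rw [hrepr, Module.Basis.traceDual_powerBasis_eq, Algebra.traceForm_apply, pb.basis_eq_pow, hgen,
    Algebra.smul_def, hder]
  congr 3
  field_simp

theorem exists_trace_eq_intCast {w : K} (hw : IsIntegral ℤ w) {r : ℝ}
    (hr : ∀ σ : K →ₐ[ℚ] ℂ, ‖σ w‖ ≤ r) :
    ∃ e : ℤ, algebraMap ℚ K (Algebra.trace ℚ K w) = e ∧ |(e : ℝ)| ≤ Module.finrank ℚ K * r := by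
  obtain ⟨e, he⟩ := IsIntegrallyClosed.isIntegral_iff.1 (Algebra.isIntegral_trace (L := ℚ) hw)
  refine ⟨e, by rw [← he]; simp, ?_⟩
  have h1 : (e : ℂ) = ∑ σ : K →ₐ[ℚ] ℂ, σ w := by
    rw [← trace_eq_sum_embeddings ℂ, ← he]; simp
  rw [← Complex.norm_intCast, h1, ← AlgHom.card ℚ K ℂ]
  refine (norm_sum_le _ _).trans ((Finset.sum_le_sum fun σ _ => hr σ).trans ?_)
  simp

theorem norm_root_minpoly_le {α : K} {H : ℕ} (h : ∀ σ : K →ₐ[ℚ] ℂ, ‖σ α‖ ≤ H) {z : ℂ}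
    (hz : z ∈ ((minpoly ℚ α).map (algebraMap ℚ ℂ)).roots) : ‖z‖ ≤ H := by
  have h1 : z ∈ (minpoly ℚ α).rootSet ℂ := by
    rw [rootSet_def, Finset.mem_coe, Multiset.mem_toFinset]
    exact hz
  rw [← Algebra.IsAlgebraic.range_eval_eq_rootSet_minpoly] at h1
  obtain ⟨σ, rfl⟩ := h1
  exact h σ

theorem abs_coeff_minpoly_le {α : K} (hα : IsIntegral ℤ α) {H n : ℕ} (hH : 1 ≤ H)
    (h : ∀ σ : K →ₐ[ℚ] ℂ, ‖σ α‖ ≤ H) (hn : (minpoly ℤ α).natDegree ≤ n) (i : ℕ) :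
    |(minpoly ℤ α).coeff i| ≤ ((2 * H) ^ n : ℕ) := by
  have hmin : minpoly ℚ α = (minpoly ℤ α).map (algebraMap ℤ ℚ) :=
    minpoly.isIntegrallyClosed_eq_field_fractions' ℚ hα
  have hmap : (minpoly ℚ α).map (algebraMap ℚ ℂ) = (minpoly ℤ α).map (algebraMap ℤ ℂ) := by
    rw [hmin, Polynomial.map_map, ← IsScalarTower.algebraMap_eq]
  have h1 := norm_coeff_le_of_roots_le (p := (minpoly ℤ α).map (algebraMap ℤ ℂ)) (n := n)
    ((minpoly.monic hα).map _) hH (natDegree_map_le.trans hn)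
    (fun z hz => norm_root_minpoly_le h (by rwa [hmap])) i
  rw [coeff_map, eq_intCast, Complex.norm_intCast] at h1
  exact_mod_cast h1

theorem norm_coeff_minpolyDiv_le {α : K} (hα : IsIntegral ℚ α) {H n : ℕ} (hH : 1 ≤ H)
    (h : ∀ σ : K →ₐ[ℚ] ℂ, ‖σ α‖ ≤ H) (hn : (minpoly ℚ α).natDegree ≤ n) (i : ℕ) (σ : K →ₐ[ℚ] ℂ) :
    ‖σ ((minpolyDiv ℚ α).coeff i)‖ ≤ (2 * H) ^ n := by
  have h1 := norm_coeff_le_of_roots_le (p := (minpolyDiv ℚ α).map (σ : K →+* ℂ)) (n := n)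
    ((minpolyDiv_monic hα).map _) hH (natDegree_map_le.trans
      ((natDegree_minpolyDiv_lt hα).le.trans hn)) (fun z hz => norm_root_minpoly_le h ?_) i
  · rwa [coeff_map] at h1
  · have h2 := congrArg (Polynomial.map (σ : K →+* ℂ)) (minpolyDiv_spec ℚ α)
    rw [Polynomial.map_mul, Polynomial.map_map] at h2
    have h3 : (σ : K →+* ℂ).comp (algebraMap ℚ K) = algebraMap ℚ ℂ := σ.comp_algebraMap
    have hmon : ((minpoly ℚ α).map (algebraMap ℚ ℂ)).Monic := (minpoly.monic hα).map _
    rw [h3] at h2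
    rw [mem_roots'] at hz
    rw [mem_roots hmon.ne_zero, ← h2, IsRoot, eval_mul, hz.2, zero_mul]

/-- A bound for numerators and denominators of the roots of polynomials of weight at most `W` over
a number field generated by a root of a polynomial of weight `H`. -/
def rootBound (W H : ℕ) : ℕ := (2 + W + H) ^ (10 * (2 + W + H))

theorem rootBound_mono {W H H' : ℕ} (h : H ≤ H') : rootBound W H ≤ rootBound W H' :=
  (Nat.pow_le_pow_left (by omega) _).trans (Nat.pow_le_pow_right (by omega) (by omega))

/-- A root `y` in the number field `ℚ(a)` of a polynomial with coefficients in `ℤ[a]` is a fraction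
of bounded integer polynomials in `a`. With the leading coefficients `l` of `h` and `γ` of
`f(a, Y)`, the elements `α = l a` and `z = l ^ W γ y` are integral with bounded conjugates. For the
minimal polynomial `m` of `α`, the element `z m'(α)` is an integer polynomial in `α` with bounded
coefficients, and `y = z m'(α) / (l ^ W γ m'(α))`. -/
theorem exists_fraction_numberField {a : K} (htop : Algebra.adjoin ℚ {a} = ⊤) {h : ℤ[X]}
    (h0 : ev a h = 0) (hdeg : 0 < h.natDegree) {f : ℤ[X][X]} {W : ℕ} (hW : wt₂ f ≤ W)
    (hf : f.map (aeval a).toRingHom ≠ 0) {y : K} (hy : (f.map (aeval a).toRingHom).eval y = 0)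
    {N : ℕ} (hN : rootBound W (wt h) ≤ N) :
    ∃ u v : ℤ[X], InBox N N u ∧ InBox N N v ∧ ev a v ≠ 0 ∧ y = ev a u / ev a v := by
  set H := wt h with hH
  set l := h.leadingCoeff with hl
  have hh : h ≠ 0 := by rintro rfl; simp at hdeg
  have hl0 : l ≠ 0 := leadingCoeff_ne_zero.2 hh
  have hH1 : 1 ≤ H := wt_pos hh
  have hlH : |l| ≤ H := abs_coeff_le_wt h _
  set α : K := l * a with hαdef
  have hα : IsIntegral ℤ α := by
    have := isIntegral_leadingCoeff_smul h a h0
    rwa [zsmul_eq_mul] at this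
  have hσa : ∀ σ : K →ₐ[ℚ] ℂ, ‖σ a‖ ≤ H := fun σ => (norm_generator_le h0 hh σ).2
  have hσα : ∀ σ : K →ₐ[ℚ] ℂ, ‖σ α‖ ≤ H := fun σ => (norm_generator_le h0 hh σ).1
  have htopα : Algebra.adjoin ℚ {α} = ⊤ := by
    rw [eq_top_iff, ← htop, Algebra.adjoin_le_iff, Set.singleton_subset_iff]
    have : a = (l : ℚ)⁻¹ • α := by
      rw [hαdef, Algebra.smul_def]
      have : (l : K) ≠ 0 := by exact_mod_cast hl0
      simp
      field_simp
    rw [this]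
    exact Subalgebra.smul_mem _ (Algebra.self_mem_adjoin_singleton ℚ α) _
  have hα' : IsIntegral ℚ α := hα.tower_top
  have hmin : minpoly ℚ α = (minpoly ℤ α).map (algebraMap ℤ ℚ) :=
    minpoly.isIntegrallyClosed_eq_field_fractions' ℚ hα
  have hdegα : Module.finrank ℚ K = (minpoly ℤ α).natDegree := by
    rw [(PowerBasis.ofAdjoinEqTop hα' htopα).finrank, PowerBasis.ofAdjoinEqTop_dim, hmin,
      natDegree_map_eq_of_injective Int.cast_injective]
  set d := (minpoly ℤ α).natDegree with hd
  have hdH : d ≤ H := by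
    have h1 : (minpoly ℚ a).natDegree = d := by
      have ha : IsIntegral ℚ a := Algebra.IsIntegral.isIntegral a
      rw [← hdegα, (PowerBasis.ofAdjoinEqTop ha htop).finrank, PowerBasis.ofAdjoinEqTop_dim]
    have h2 : (minpoly ℚ a).natDegree ≤ (h.map (algebraMap ℤ ℚ)).natDegree :=
      natDegree_le_of_dvd (minpoly.dvd _ _ (by rwa [aeval_map_algebraMap]))
        ((Polynomial.map_ne_zero_iff Int.cast_injective).2 hh)
    rw [h1] at h2
    exact h2.trans (natDegree_map_le.trans (natDegree_lt_wt hh).le)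
  -- the leading coefficient makes the root `y` integral
  set g : K[X] := f.map (aeval a).toRingHom with hg
  set m := g.natDegree with hm
  have hfW : ∀ i, (f.coeff i).natDegree ≤ W ∧ wt (f.coeff i) ≤ W := by
    intro i
    have h1 : wt (f.coeff i) ≤ W := (coeff_le_polyWeight isWeight_wt f i).trans hW
    refine ⟨?_, h1⟩
    by_cases hi : f.coeff i = 0
    · rw [hi, natDegree_zero]; omega
    · exact (natDegree_lt_wt hi).le.trans h1
  have hgc : ∀ i, g.coeff i = ev a (f.coeff i) := fun i => by rw [hg, coeff_map]; rfl
  have hA : ∀ i, IsIntegral ℤ ((l : K) ^ W * g.coeff i) := by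
    intro i
    rw [hgc, ev, aeval_eq_sum_range, Finset.mul_sum]
    refine IsIntegral.sum _ fun j hj => ?_
    have h1 : j + (W - j) = W := by
      have := Finset.mem_range.1 hj
      have := (hfW i).1
      omega
    have h2 : (l : K) ^ W * (f.coeff i).coeff j • a ^ j =
        ((l ^ (W - j) * (f.coeff i).coeff j : ℤ) : K) * α ^ j := by
      rw [hαdef, zsmul_eq_mul, mul_pow]
      nth_rewrite 1 [← h1]
      push_cast
      ring
    rw [h2, ← eq_intCast (algebraMap ℤ K)]
    exact isIntegral_algebraMap.mul (hα.pow j)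
  set z : K := l ^ W * g.leadingCoeff * y with hz
  have hlK : (l : K) ^ W ≠ 0 := pow_ne_zero _ (by exact_mod_cast hl0)
  have hgl : g.leadingCoeff ≠ 0 := leadingCoeff_ne_zero.2 hf
  have hqc : ∀ i, (C ((l : K) ^ W) * g).coeff i = l ^ W * g.coeff i := fun i => coeff_C_mul _
  have hql : (C ((l : K) ^ W) * g).leadingCoeff = l ^ W * g.leadingCoeff := by
    rw [leadingCoeff_mul, leadingCoeff_C]
  have hqy : (C ((l : K) ^ W) * g).eval y = 0 := by rw [eval_mul, hy, mul_zero]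
  have hzint : IsIntegral ℤ z := by
    obtain ⟨q, hq⟩ : C ((l : K) ^ W) * g ∈ lifts (algebraMap (integralClosure ℤ K) K) := by
      rw [lifts_iff_coeff_lifts]
      exact fun i => ⟨⟨_, hA i⟩, (hqc i).symm⟩
    rw [coe_mapRingHom] at hq
    have h1 := isIntegral_leadingCoeff_smul q y
      (by rw [← eval_map_algebraMap, hq, hqy])
    have h2 : algebraMap (integralClosure ℤ K) K q.leadingCoeff = l ^ W * g.leadingCoeff := by
      rw [← hql, ← hq, leadingCoeff_map_of_injective Subtype.val_injective]
    rw [Algebra.smul_def, h2] at h1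
    exact isIntegral_trans _ h1
  have hσz : ∀ σ : K →ₐ[ℚ] ℂ, ‖σ z‖ ≤ H ^ W * (W * H ^ W) := by
    intro σ
    have h1 := norm_leadingCoeff_mul_root_le
      (g := (C ((l : K) ^ W) * g).map (σ : K →+* ℂ)) (z := σ y) (by
        rw [eval_map, ← RingHom.coe_coe, eval₂_hom, hqy, map_zero])
    rw [leadingCoeff_map, hql, natDegree_map] at h1
    have h2 : (σ : K →+* ℂ) (l ^ W * g.leadingCoeff) * σ y = σ z := by rw [hz]; simp
    rw [h2] at h1
    refine h1.trans ?_
    have h3 : ∀ i, ‖((C ((l : K) ^ W) * g).map (σ : K →+* ℂ)).coeff i‖ ≤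
        H ^ W * (wt (f.coeff i) * H ^ W) := by
      intro i
      rw [coeff_map, hqc, map_mul, norm_mul, hgc]
      have h4 : ‖(σ : K →+* ℂ) ((l : K) ^ W)‖ ≤ H ^ W := by
        simp only [map_pow, map_intCast, norm_pow, Complex.norm_intCast]
        exact pow_le_pow_left₀ (abs_nonneg _) (by exact_mod_cast hlH) _
      refine mul_le_mul h4 ?_ (norm_nonneg _) (by positivity)
      rw [map_ev]
      exact norm_ev_le hH1 (hσa σ) (hfW i).1
    refine (Finset.sum_le_sum fun i _ => h3 i).trans ?_
    rw [← Finset.mul_sum, ← Finset.sum_mul]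
    gcongr
    set n := (C ((l : K) ^ W) * g).natDegree + 1
    have h5 := polyWeight_eq_sum isWeight_wt f (n := max n (f.natDegree + 1)) (by omega)
    have h6 : ∑ i ∈ Finset.range n, wt (f.coeff i) ≤ W := by
      refine le_trans ?_ hW
      rw [wt₂, h5]
      refine (Finset.sum_le_sum fun i _ => ?_).trans (Finset.sum_le_sum_of_subset
        (Finset.range_mono (le_max_left n (f.natDegree + 1))))
      exact Nat.le_mul_of_pos_right _ (by positivity)
    exact_mod_cast h6
  -- the coefficients of `z m'(α)` with respect to the powers of `α` are bounded integers `e i`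
  have hb : ∀ i, IsIntegral ℤ (z * (minpolyDiv ℚ α).coeff i) := by
    intro i
    refine hzint.mul ?_
    rw [← minpolyDiv_eq_of_isIntegrallyClosed (R := ℤ) ℚ hα]
    have h1 : Algebra.adjoin ℤ {α} ≤ integralClosure ℤ K :=
      Algebra.adjoin_le (Set.singleton_subset_iff.2 hα)
    exact h1 (coeff_minpolyDiv_mem_adjoin α i)
  choose e he heR using fun i => exists_trace_eq_intCast (hb i)
    (r := H ^ W * (W * H ^ W) * (2 * H) ^ H) (fun σ => by
      rw [map_mul, norm_mul]
      exact mul_le_mul (hσz σ) (norm_coeff_minpolyDiv_le hα' hH1 hσα (by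
        rwa [hmin, natDegree_map_eq_of_injective Int.cast_injective]) i σ) (norm_nonneg _)
        (by positivity))
  have hsum := mul_derivative_minpoly_eq_sum hα htopα z
  simp only [he] at hsum
  set u : ℤ[X] := ∑ i ∈ Finset.range d, monomial i (e i * l ^ i) with hu
  set v : ℤ[X] := C (l ^ W) * f.coeff m * (derivative (minpoly ℤ α)).comp (C l * X) with hv
  have hua : ev a u = z * ev α (derivative (minpoly ℤ α)) := by
    rw [hsum, hu, ev, map_sum]
    refine Finset.sum_congr rfl fun i _ => ?_
    rw [aeval_monomial, hαdef, mul_pow]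
    simp [mul_assoc]
  have hva : ev a v = l ^ W * g.leadingCoeff * ev α (derivative (minpoly ℤ α)) := by
    have h1 : aeval a (C l * X) = α := by simp [hαdef]
    rw [hv, leadingCoeff, hgc, ev, map_mul, map_mul, aeval_comp, h1]
    simp [← hm]
  have hder : ev α (derivative (minpoly ℤ α)) ≠ 0 := by
    have := (Algebra.IsSeparable.isSeparable ℚ α).aeval_derivative_ne_zero (minpoly.aeval ℚ α)
    rwa [hmin, derivative_map, aeval_map_algebraMap] at this
  -- all quantities are estimated by powers of `M`
  have hw := isWeight_wt
  set M := 2 + W + H with hM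
  have hpow : ∀ {i j : ℕ}, i ≤ j → M ^ i ≤ M ^ j := fun h => Nat.pow_le_pow_right (by omega) h
  have hlH' : l.natAbs ≤ M := by
    have : l.natAbs ≤ H := by rw [Int.abs_eq_natAbs] at hlH; exact_mod_cast hlH
    omega
  have h2H : 2 * H ≤ M ^ 2 := by nlinarith
  have hlpow : ∀ i ≤ H, l.natAbs ^ i ≤ M ^ H := fun i hi =>
    (Nat.pow_le_pow_left hlH' i).trans (hpow hi)
  have h2Hpow : (2 * H) ^ H ≤ M ^ (2 * H) := by
    rw [pow_mul]; exact Nat.pow_le_pow_left h2H _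
  have heM : ∀ i, (e i).natAbs ≤ M ^ (2 + 2 * W + 2 * H) := by
    intro i
    have h1 : (e i).natAbs ≤ d * (H ^ W * (W * H ^ W) * (2 * H) ^ H) := by
      have := heR i
      rw [hdegα, ← Int.cast_abs, Int.abs_eq_natAbs] at this
      exact_mod_cast this
    refine h1.trans ?_
    calc _ ≤ M * (M ^ W * (M * M ^ W) * M ^ (2 * H)) := by
          gcongr <;> omega
      _ = _ := by ring
  have huwt : wt u < N := by
    refine lt_of_lt_of_le ?_ hN
    have h1 : wt u ≤ ∑ i ∈ Finset.range d, M ^ (2 + 2 * W + 2 * H) * M ^ H * M ^ H := by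
      refine (polyWeight_sum_le isWeight_natAbs _ _).trans (Finset.sum_le_sum fun i hi => ?_)
      have hi' := Finset.mem_range.1 hi
      rw [polyWeight_monomial isWeight_natAbs, Int.natAbs_mul, Int.natAbs_pow]
      exact Nat.mul_le_mul (Nat.mul_le_mul (heM i) (hlpow i (by omega)))
        ((Nat.pow_le_pow_left (by omega) i).trans (hpow (by omega)))
    calc wt u ≤ M * (M ^ (2 + 2 * W + 2 * H) * M ^ H * M ^ H) := by
          refine h1.trans ?_
          rw [Finset.sum_const, Finset.card_range, smul_eq_mul]
          exact Nat.mul_le_mul_right _ (by omega)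
      _ = M ^ (3 + 2 * W + 4 * H) := by ring
      _ < _ := Nat.pow_lt_pow_right (by omega) (by omega)
  have hvwt : wt v < N := by
    refine lt_of_lt_of_le ?_ hN
    have hd0 : 0 < d := hdegα ▸ Module.finrank_pos
    have h1 : wt ((derivative (minpoly ℤ α)).comp (C l * X)) ≤
        ∑ i ∈ Finset.range d, M ^ (2 * H + 1) * M ^ (2 * H) := by
      rw [comp, eval₂_eq_sum_range' C (n := d) (lt_of_le_of_lt (natDegree_derivative_le _)
        (by omega))]
      refine (polyWeight_sum_le isWeight_natAbs _ _).trans (Finset.sum_le_sum fun i hi => ?_)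
      have hi' := Finset.mem_range.1 hi
      refine (hw.mul_le _ _).trans (Nat.mul_le_mul ?_ ?_)
      · rw [wt, polyWeight_C isWeight_natAbs, coeff_derivative, Int.natAbs_mul, pow_succ]
        have h2 := abs_coeff_minpoly_le hα hH1 hσα hdH (i + 1)
        rw [Int.abs_eq_natAbs] at h2
        refine Nat.mul_le_mul ((Nat.cast_le.1 h2).trans h2Hpow) ?_
        omega
      · have h2 : wt (C l * X) ≤ M ^ 2 := by
          refine (hw.mul_le _ _).trans ?_
          rw [wt, wt, polyWeight_C isWeight_natAbs, polyWeight_X isWeight_natAbs, pow_two]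
          exact Nat.mul_le_mul hlH' (by omega)
        have h3 : ∀ i, wt ((C l * X) ^ i) ≤ (M ^ 2) ^ i := by
          intro i
          induction i with
          | zero => rw [pow_zero, pow_zero, hw.one]
          | succ i ih =>
            rw [pow_succ, pow_succ]
            exact (hw.mul_le _ _).trans (Nat.mul_le_mul ih h2)
        refine (h3 i).trans ?_
        rw [← pow_mul]
        exact hpow (by omega)
    have h4 : wt (C (l ^ W)) ≤ M ^ W := by
      rw [wt, polyWeight_C isWeight_natAbs, Int.natAbs_pow]
      exact Nat.pow_le_pow_left hlH' _
    calc wt v ≤ M ^ W * M * (M * (M ^ (2 * H + 1) * M ^ (2 * H))) := by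
          refine (hw.mul_le _ _).trans (Nat.mul_le_mul ((hw.mul_le _ _).trans
            (Nat.mul_le_mul h4 ((hfW m).2.trans (by omega)))) (h1.trans ?_))
          rw [Finset.sum_const, Finset.card_range, smul_eq_mul]
          exact Nat.mul_le_mul_right _ (by omega)
      _ = M ^ (W + 3 + 4 * H) := by ring
      _ < _ := Nat.pow_lt_pow_right (by omega) (by omega)
  refine ⟨u, v, .of_wt_lt huwt, .of_wt_lt hvwt, ?_, ?_⟩
  · rw [hva]
    exact mul_ne_zero (mul_ne_zero hlK hgl) hder
  · rw [hua, hva, hz]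
    field_simp

end NumberField

/-! ### Certificates of falsity -/

/-- The only polynomials from the box that vanish at `t` are those whose coefficients vanish. -/
def Generic {k : Type*} [Field k] (t : k) (n G : ℕ) : Prop :=
  ∀ u : ℤ[X], InBox n G u → ev t u = 0 → ∀ i, (u.coeff i : k) = 0

/-- The characteristic of `k` is zero or larger than `G`. -/
def LargeChar (k : Type*) [Field k] (G : ℕ) : Prop :=
  ∀ i : ℕ, 0 < i → i ≤ G → (i : k) ≠ 0

theorem LargeChar.intCast_ne_zero {k : Type*} [Field k] {G : ℕ} (hk : LargeChar k G) {m : ℤ}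
    (hm : m ≠ 0) (hmG : |m| ≤ G) : (m : k) ≠ 0 := by
  have h1 : ((m.natAbs : ℕ) : k) ≠ 0 := hk _ (Int.natAbs_pos.2 hm) (by
    rw [Int.abs_eq_natAbs] at hmG; exact_mod_cast hmG)
  obtain h2 | h2 := Int.natAbs_eq m <;> rw [h2]
  · rwa [Int.cast_natCast]
  · rwa [Int.cast_neg, Int.cast_natCast, neg_ne_zero]

/-- A box of this size contains numerators and denominators of the roots of all nonzero atomic
polynomials of a formula with code at most `c`, over rational function fields and over number
fields generated by a root of a polynomial from the box of size `b`. -/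
def minBox (c b : ℕ) : ℕ :=
  rootBound (2 ^ (c + 2)) (b * b * 2 ^ b) + 2 ^ (c + 2) * 2 ^ 2 ^ (c + 2) + c + 3

/-- A degree of genericity that decides the vanishing of the polynomials with weight at most
`testBound c B`. -/
def minGen (c b B : ℕ) : ℕ :=
  (2 * (b * b * 2 ^ b)) ^ (testBound c B + 1) * testBound c B + testBound c B + b + 1

/-- A certificate, in a finite field `k`, for the falsity of the formula `c` in some infinite
field. The infinite field is the rational function field over `k` in the first case. In the second
case `t` imitates a generator of the infinite field: the variable of the rational function field
over a prime field, or a root of the polynomial `h`. -/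
def FiniteRefutation {k : Type*} [Field k] (t : k) (c : ℕ) : Prop :=
  ((c + 1 < Nat.card k) ∧ ∀ y, ¬ evF (xy t y) c) ∨
  ∃ b B G n : ℕ, minBox c b ≤ B ∧ minGen c b B ≤ G ∧ Generic t n G ∧ BoxFails t c B ∧
    ((n = G ∧ ∃ p : ℕ, 0 < p ∧ p ≤ B ∧ (p : k) = 0) ∨
     (n = G ∧ LargeChar k G) ∨
     (LargeChar k G ∧ ∃ h : ℤ[X], InBox b b h ∧ h.natDegree = n ∧ 0 < n ∧ ev t h = 0))

/-! ### Roots in fraction fields -/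

/-- A form of the rational root theorem. -/
theorem exists_dvd_coeff_of_root {R K : Type*} [CommRing R] [IsDomain R]
    [UniqueFactorizationMonoid R] [Field K] [Algebra R K] [IsFractionRing R K] {f : R[X]}
    (hf : f ≠ 0) {y : K} (hy : aeval y f = 0) :
    ∃ u v : R, (u = 0 ∨ ∃ i, f.coeff i ≠ 0 ∧ u ∣ f.coeff i) ∧
      (∃ i, f.coeff i ≠ 0 ∧ v ∣ f.coeff i) ∧
      algebraMap R K v ≠ 0 ∧ y = algebraMap R K u / algebraMap R K v := by
  have hden : algebraMap R K (IsFractionRing.den R y) ≠ 0 :=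
    IsLocalization.to_map_ne_zero_of_mem_nonZeroDivisors K le_rfl (IsFractionRing.den R y).2
  refine ⟨IsFractionRing.num R y, IsFractionRing.den R y, ?_,
    ⟨_, leadingCoeff_ne_zero.2 hf, den_dvd_of_is_root hy⟩, hden, ?_⟩
  · by_cases hy0 : y = 0
    · left
      rw [hy0, IsFractionRing.num_zero]
    · right
      obtain ⟨g, hg, hX⟩ := exists_eq_pow_rootMultiplicity_mul_and_not_dvd f hf 0
      rw [C_0, sub_zero] at hg hX
      refine ⟨f.rootMultiplicity 0, ?_⟩
      set n := f.rootMultiplicity 0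
      have h1 : f.coeff n = g.coeff 0 := by
        rw [hg, coeff_X_pow_mul', if_pos le_rfl, Nat.sub_self]
      rw [h1]
      refine ⟨fun h => hX (X_dvd_iff.2 h), num_dvd_of_is_root (K := K) ?_⟩
      rw [hg, map_mul, map_pow, aeval_X] at hy
      exact (mul_eq_zero.1 hy).resolve_left (pow_ne_zero _ hy0)
  · exact (IsFractionRing.mk'_num_den' R y).symm

/-- If the formula `c` fails at `(t, y)` for all `y` in a field `k` with enough elements, then it
fails at `(t, y)` for all `y` in the field of rational functions over `k`. -/
theorem fails_fractionRing {k : Type*} [Field k] {t : k} {c : ℕ}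
    (hk : c + 1 < Nat.card k) (h : ∀ y, ¬ evF (xy t y) c) :
    ∀ y, ¬ evF (xy (algebraMap k (FractionRing k[X]) t) y) c := by
  classical
  set K := FractionRing k[X]
  intro y
  set φ := algebraMap k K with hφ
  have hφi : Function.Injective φ := φ.injective
  obtain ⟨S, hS, hroot, hgen⟩ := exists_exceptional_set (φ t) c
  by_cases hy : y ∈ S
  -- A root of a polynomial over `k` is a quotient of constants, by the rational root theorem.
  · obtain ⟨a, b, -, hne, heq⟩ := hroot y hy
    have hmap : ∀ d, (evT (xy (C t) X) d : k[X]).map φ = evT (xy (C (φ t)) X) d := by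
      intro d
      rw [← coe_mapRingHom, map_evT_xy]
      simp
    set g : k[X] := evT (xy (C t) X : ℕ → k[X]) a - evT (xy (C t) X : ℕ → k[X]) b with hg
    have hg0 : g ≠ 0 := by
      intro h0
      apply hne
      rw [← hmap, ← hmap, sub_eq_zero.1 h0]
    have hgy : aeval y (g.map (C : k →+* k[X])) = 0 := by
      have h1 : (C : k →+* k[X]) = algebraMap k k[X] := rfl
      rw [h1, aeval_map_algebraMap, aeval_def, ← eval_map, hg, Polynomial.map_sub, hmap, hmap,
        ← coe_evalRingHom, map_sub, map_evT_xy, map_evT_xy]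
      simp [heq]
    obtain ⟨u, v, hu, ⟨i, hi, hv⟩, hv0, rfl⟩ := exists_dvd_coeff_of_root
      ((Polynomial.map_ne_zero_iff C_injective).2 hg0) hgy
    have hconst : ∀ w : k[X], (∃ i, (g.map (C : k →+* k[X])).coeff i ≠ 0 ∧
        w ∣ (g.map (C : k →+* k[X])).coeff i) → ∃ r, w = C r := by
      rintro w ⟨i, hi, hw⟩
      rw [coeff_map] at hi hw
      have h1 : IsUnit (C (g.coeff i)) := isUnit_C.2 (IsUnit.mk0 _ fun h => hi (by rw [h, C_0]))
      obtain ⟨r, -, hr⟩ := Polynomial.isUnit_iff.1 (isUnit_of_dvd_unit hw h1)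
      exact ⟨r, hr.symm⟩
    obtain ⟨s, rfl⟩ := hconst v ⟨i, hi, hv⟩
    obtain ⟨r, rfl⟩ : ∃ r, u = C r := hu.elim (fun h => ⟨0, by rw [h, C_0]⟩) (hconst u)
    have h1 : ∀ r, algebraMap k[X] K (C r) = φ r := fun r =>
      (IsScalarTower.algebraMap_apply k k[X] K r).symm
    rw [h1, h1, ← map_div₀, evF_xy_map_iff φ hφi]
    exact h _
  · obtain ⟨y₀, hy₀⟩ : ∃ y₀ : k, φ y₀ ∉ S := by
      by_contra! hall
      have hcard : Set.range φ ⊆ S := by rintro _ ⟨y₀, rfl⟩; exact hall y₀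
      have h1 := Set.ncard_le_ncard hcard S.finite_toSet
      rw [Set.ncard_coe_finset, ← Set.image_univ, Set.ncard_image_of_injective _ hφi,
        Set.ncard_univ] at h1
      omega
    rw [hgen y hy, ← hgen _ hy₀, evF_xy_map_iff φ hφi]
    exact h _

theorem ev_eq_zero_of_coeff {R : Type*} [CommRing R] {t : R} {s : ℤ[X]}
    (h : ∀ i, (s.coeff i : R) = 0) : ev t s = 0 := by
  rw [ev, aeval_eq_sum_range]
  exact Finset.sum_eq_zero fun i _ => by rw [zsmul_eq_mul, h, zero_mul]

/-- The box is large enough if it contains sufficiently many polynomials with distinct values. -/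
theorem exists_ev_notMem {K : Type*} [Field K] {x : K} {c B : ℕ} (g : ℕ → ℤ[X])
    (hg : ∀ i < c + 2, InBox B B (g i)) (hinj : Function.Injective fun i => ev x (g i))
    (S : Finset K) (hS : S.card ≤ c + 1) : ∃ u : ℤ[X], InBox B B u ∧ ev x u ∉ S := by
  classical
  have h1 : S.card < ((Finset.range (c + 2)).image fun i => ev x (g i)).card := by
    rw [Finset.card_image_of_injective _ hinj, Finset.card_range]
    omega
  obtain ⟨y, hy, hyS⟩ := Finset.exists_mem_notMem_of_card_lt_card h1
  obtain ⟨i, hi, rfl⟩ := Finset.mem_image.1 hy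
  exact ⟨g i, hg i (Finset.mem_range.1 hi), hyS⟩

theorem exists_ev_notMem_of_charZero {K : Type*} [Field K] [CharZero K] {x : K} {c B : ℕ}
    (hB : c + 2 ≤ B) (S : Finset K) (hS : S.card ≤ c + 1) :
    ∃ u : ℤ[X], InBox B B u ∧ ev x u ∉ S := by
  refine exists_ev_notMem (c := c) (fun i => C (i : ℤ)) (fun i hi => ⟨by rw [natDegree_C]; omega,
    fun j => ?_⟩) (fun i j hij => ?_) S hS
  · rw [coeff_C]
    split_ifs
    · rw [Nat.abs_cast]; omega
    · simp; omega
  · simpa using hij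

theorem rootBound_le_minBox (c b : ℕ) : rootBound (2 ^ (c + 2)) (b * b * 2 ^ b) ≤ minBox c b := by
  rw [minBox]; omega

theorem two_pow_lt_minBox (c b : ℕ) : 2 ^ (c + 2) * 2 ^ 2 ^ (c + 2) + c + 2 < minBox c b := by
  rw [minBox]; omega

theorem natDegree_coeff_lt {f : ℤ[X][X]} {W : ℕ} (hW : wt₂ f ≤ W) {i : ℕ} (hi : f.coeff i ≠ 0) :
    (f.coeff i).natDegree < W :=
  (natDegree_lt_wt hi).trans_le ((coeff_le_polyWeight isWeight_wt f i).trans hW)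

/-- A failure in a finite field of small characteristic `p` transfers to the rational function
field over the prime field of characteristic `p`. -/
theorem fails_of_generic_of_charP {k : Type*} [Field k] {t : k} {c b B G p : ℕ} [Fact p.Prime]
    [CharP k p] {K : Type*} [Field K] [Algebra (ZMod p)[X] K] [IsFractionRing (ZMod p)[X] K]
    (hB : minBox c b ≤ B) (hG : minGen c b B ≤ G) (hgen : Generic t G G) (hf : BoxFails t c B)
    (hp : p ≤ B) :
    ∀ y, ¬ evF (xy (algebraMap (ZMod p)[X] K X) y) c := by
  set x : K := algebraMap _ _ (X : (ZMod p)[X]) with hx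
  have hbox := two_pow_lt_minBox c b
  set ρ := Int.castRingHom (ZMod p) with hρ
  have hev : ∀ s : ℤ[X], ev x s = algebraMap _ K (s.map ρ) := by
    intro s
    have h1 : s.map ρ = ev (X : (ZMod p)[X]) s := by
      rw [ev, ← aeval_map_algebraMap (ZMod p), aeval_X_left_apply]; rfl
    rw [h1, map_ev, hx]
  have hev0 : ∀ s : ℤ[X], ev x s = 0 ↔ s.map ρ = 0 := fun s => by
    rw [hev]
    exact map_eq_zero_iff _ (IsFractionRing.injective (ZMod p)[X] K)
  have hcoeff : ∀ s : ℤ[X], s.map ρ = 0 ↔ ∀ i, (s.coeff i : k) = 0 := by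
    intro s
    rw [Polynomial.ext_iff]
    refine forall_congr' fun i => ?_
    rw [coeff_map, coeff_zero, hρ, eq_intCast, ZMod.intCast_zmod_eq_zero_iff_dvd,
      CharP.intCast_eq_zero_iff k p]
  refine fails_of_boxFails (fun s hs => ?_) (fun f y hfW hf0 hfy => ?_) (fun S hS => ?_)
    (by omega) hf
  · rw [hev0, hcoeff]
    refine ⟨ev_eq_zero_of_coeff, fun h => hgen s (.of_wt_lt ?_) h⟩
    rw [minGen] at hG
    omega
  · have hmap : f.map (aeval x).toRingHom =
        (f.map (mapRingHom ρ)).map (algebraMap (ZMod p)[X] K) := by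
      rw [Polynomial.map_map]
      congr 1
      exact RingHom.ext hev
    rw [hmap] at hf0 hfy
    rw [eval_map_algebraMap] at hfy
    have hlift : ∀ w : (ZMod p)[X], (w = 0 ∨ ∃ i, (f.map (mapRingHom ρ)).coeff i ≠ 0 ∧
        w ∣ (f.map (mapRingHom ρ)).coeff i) → ∃ s : ℤ[X], InBox B B s ∧ s.map ρ = w := by
      intro w hw
      have hdeg : w.natDegree < B := by
        obtain rfl | ⟨i, hi, hw⟩ := hw
        · rw [natDegree_zero]; omega
        · refine (natDegree_le_of_dvd hw hi).trans_lt ?_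
          rw [coeff_map, coe_mapRingHom] at *
          have h1 := natDegree_coeff_lt hfW (i := i) (by rintro h; simp [h] at hi)
          have h2 : 2 ^ (c + 2) ≤ 2 ^ (c + 2) * 2 ^ 2 ^ (c + 2) :=
            Nat.le_mul_of_pos_right _ (by positivity)
          exact natDegree_map_le.trans_lt (by omega)
      have hval : ∀ r : ZMod p, ((r.val : ℤ) : ZMod p) = r := fun r => by simp
      set s : ℤ[X] := ∑ i ∈ Finset.range B, monomial i ((w.coeff i).val : ℤ) with hs
      have hsc : ∀ i, s.coeff i = if i < B then ((w.coeff i).val : ℤ) else 0 := by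
        intro i
        rw [hs, finsetSum_coeff]
        simp [coeff_monomial]
      refine ⟨s, ⟨?_, fun i => ?_⟩, ?_⟩
      · refine (natDegree_le_iff_coeff_eq_zero (n := B - 1)).2 (fun i hi => ?_) |>.trans_lt
          (by omega)
        rw [hsc, if_neg (by omega)]
      · rw [hsc]
        split_ifs
        · rw [Nat.abs_cast]
          have := ZMod.val_lt (w.coeff i)
          omega
        · simp; omega
      · ext i
        rw [coeff_map, hsc]
        split_ifs with hi
        · simp [hρ]
        · rw [coeff_eq_zero_of_natDegree_lt (by omega), map_zero]
    obtain ⟨u, v, hu, hv, hv0, rfl⟩ := exists_dvd_coeff_of_root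
      (fun h => hf0 (by rw [h, Polynomial.map_zero])) hfy
    obtain ⟨u', hu', rfl⟩ := hlift u hu
    obtain ⟨v', hv', rfl⟩ := hlift v (.inr hv)
    exact ⟨u', v', hu', hv', by rwa [hev], by rw [hev, hev]⟩
  · refine exists_ev_notMem (c := c) (fun i => X ^ i) (fun i hi => ⟨by rw [natDegree_X_pow]; omega,
      fun j => ?_⟩) (fun i j hij => ?_) S hS
    · rw [coeff_X_pow]
      split_ifs <;> simp <;> omega
    · have h1 : (X : (ZMod p)[X]) ^ i = X ^ j := by
        have h2 : ev x (X ^ i) = ev x (X ^ j) := hij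
        rw [hev, hev] at h2
        simpa using IsFractionRing.injective (ZMod p)[X] K h2
      simpa using congrArg natDegree h1

/-- Mignotte's bound for the coefficients of divisors. -/
theorem abs_coeff_le_of_dvd {u f : ℤ[X]} (hf : f ≠ 0) (huf : u ∣ f) {W : ℕ} (hW : wt f ≤ W)
    (i : ℕ) : |u.coeff i| ≤ W * 2 ^ W := by
  obtain ⟨v, rfl⟩ := huf
  have hv : v ≠ 0 := right_ne_zero_of_mul hf
  have h1 := norm_coeff_le_choose_mul_mahlerMeasure_of_one_le_mahlerMeasure i
    (u.map (Int.castRingHom ℂ)) (v.map (Int.castRingHom ℂ)) (one_le_mahlerMeasure_of_ne_zero hv)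
  rw [← Polynomial.map_mul, coeff_map, eq_intCast, Complex.norm_intCast] at h1
  have h2 : ((u * v).map (Int.castRingHom ℂ)).mahlerMeasure ≤ W := by
    refine (mahlerMeasure_le_sum_norm_coeff _).trans ?_
    rw [sum_over_range _ (by simp)]
    simp only [coeff_map, eq_intCast, Complex.norm_intCast]
    have h3 := sum_abs_coeff_le_wt (u * v) (((u * v).map (Int.castRingHom ℂ)).natDegree + 1)
    have h4 : ((wt (u * v) : ℤ) : ℝ) ≤ W := by exact_mod_cast hW
    refine le_trans ?_ h4
    exact_mod_cast h3
  have h3 : (u.map (Int.castRingHom ℂ)).natDegree ≤ W :=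
    natDegree_map_le.trans ((natDegree_le_of_dvd (Dvd.intro _ rfl) hf).trans
      ((natDegree_lt_wt hf).le.trans hW))
  have h4 : (((u.map (Int.castRingHom ℂ)).natDegree.choose i : ℕ) : ℝ) ≤ 2 ^ W := by
    exact_mod_cast (Nat.choose_le_two_pow _ _).trans (Nat.pow_le_pow_right (by norm_num) h3)
  have h5 : |(u.coeff i : ℝ)| ≤ W * 2 ^ W := by
    refine h1.trans ?_
    rw [mul_comm (W : ℝ)]
    exact mul_le_mul h4 h2 (mahlerMeasure_nonneg _) (by positivity)
  exact_mod_cast h5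

/-- A failure in a finite field of large characteristic transfers to the rational function field
over the rational numbers. -/
theorem fails_of_generic_of_largeChar {k : Type*} [Field k] {t : k} {c b B G : ℕ}
    {K : Type*} [Field K] [Algebra ℤ[X] K] [IsFractionRing ℤ[X] K]
    (hB : minBox c b ≤ B) (hG : minGen c b B ≤ G) (hgen : Generic t G G) (hf : BoxFails t c B)
    (hk : LargeChar k G) :
    ∀ y, ¬ evF (xy (algebraMap ℤ[X] K X) y) c := by
  set x : K := algebraMap _ _ (X : ℤ[X]) with hx
  have hbox := two_pow_lt_minBox c b
  have hinj := IsFractionRing.injective ℤ[X] K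
  have : CharZero K := charZero_of_injective_algebraMap hinj
  have hev : ∀ s : ℤ[X], ev x s = algebraMap _ K s := by
    intro s
    rw [hx, ← map_ev]
    exact congrArg _ (aeval_X_left_apply s)
  refine fails_of_boxFails (fun s hs => ?_) (fun f y hfW hf0 hfy => ?_) (fun S hS => ?_)
    (by omega) hf
  · rw [hev, map_eq_zero_iff _ hinj]
    refine ⟨fun h => by rw [h, ev, map_zero], fun h => ?_⟩
    have hsG : wt s < G := by
      rw [minGen] at hG
      omega
    have h1 := hgen s (.of_wt_lt hsG) h
    ext i
    by_contra hi
    exact hk.intCast_ne_zero hi ((abs_coeff_le_wt s i).trans (by exact_mod_cast hsG.le)) (h1 i)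
  · have hmap : f.map (aeval x).toRingHom = f.map (algebraMap ℤ[X] K) := by
      congr 1
      exact RingHom.ext hev
    rw [hmap] at hf0 hfy
    rw [eval_map_algebraMap] at hfy
    have hin : ∀ w : ℤ[X], (w = 0 ∨ ∃ i, f.coeff i ≠ 0 ∧ w ∣ f.coeff i) → InBox B B w := by
      rintro w (rfl | ⟨i, hi, hw⟩)
      · refine ⟨by rw [natDegree_zero]; omega, fun i => by simp; omega⟩
      · refine ⟨?_, fun j => ?_⟩
        · have h1 := natDegree_coeff_lt hfW hi
          have h2 : 2 ^ (c + 2) ≤ 2 ^ (c + 2) * 2 ^ 2 ^ (c + 2) :=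
            Nat.le_mul_of_pos_right _ (by positivity)
          exact (natDegree_le_of_dvd hw hi).trans_lt (by omega)
        · refine (abs_coeff_le_of_dvd hi hw ((coeff_le_polyWeight isWeight_wt f i).trans hfW)
            j).trans_lt ?_
          have : 2 ^ (c + 2) * 2 ^ 2 ^ (c + 2) < B := by omega
          exact_mod_cast this
    obtain ⟨u, v, hu, hv, hv0, rfl⟩ := exists_dvd_coeff_of_root
      (fun h => hf0 (by rw [h, Polynomial.map_zero])) hfy
    exact ⟨u, v, hin u hu, hin v (.inr hv), by rwa [hev], by rw [hev, hev]⟩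
  · exact exists_ev_notMem_of_charZero (by omega) S hS

/-! ### Soundness of certificates for number fields -/

/-- Pseudo-division with a bound for the weight of the remainder. -/
theorem exists_pseudoDivision {h : ℤ[X]} (hh : 0 < h.natDegree) (N : ℕ) (s : ℤ[X])
    (hs : s.natDegree < N) : ∃ (m : ℕ) (q r : ℤ[X]), C (h.leadingCoeff ^ m) * s = q * h + r ∧
      r.natDegree < h.natDegree ∧ wt r ≤ (2 * wt h) ^ N * wt s := by
  have hw := isWeight_wt
  have hh0 : h ≠ 0 := by rintro rfl; simp at hh
  have hpos := wt_pos hh0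
  induction N generalizing s with
  | zero => omega
  | succ N ih =>
    by_cases hsh : s.natDegree < h.natDegree
    · exact ⟨0, 0, s, by simp, hsh, Nat.le_mul_of_pos_left _ (by positivity)⟩
    set e := s.natDegree - h.natDegree with he
    set s' : ℤ[X] := C h.leadingCoeff * s - monomial e s.leadingCoeff * h with hs'
    have hc : ∀ i, N ≤ i → s'.coeff i = 0 := by
      intro i hi
      rw [hs', coeff_sub, coeff_C_mul]
      have h2 : i = (i - e) + e := by omega
      rw [h2, coeff_monomial_mul, ← h2]
      obtain h1 | h1 := (show s.natDegree ≤ i by omega).eq_or_lt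
      · have h3 : i - e = h.natDegree := by omega
        rw [h3, ← h1, coeff_natDegree, coeff_natDegree]
        ring
      · rw [coeff_eq_zero_of_natDegree_lt h1, coeff_eq_zero_of_natDegree_lt (p := h) (by omega)]
        simp
    have hdeg : s'.natDegree < N := by
      refine (natDegree_le_iff_coeff_eq_zero (n := N - 1)).2
        (fun i hi => hc i (by omega)) |>.trans_lt (by omega)
    have hwt : wt s' ≤ 2 * wt h * wt s := by
      have h1 : wt (C h.leadingCoeff * s) ≤ wt h * wt s := by
        refine (hw.mul_le _ _).trans (Nat.mul_le_mul_right _ ?_)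
        rw [wt, polyWeight_C isWeight_natAbs]
        exact coeff_le_polyWeight isWeight_natAbs h _
      have h2 : wt (monomial e s.leadingCoeff * h) ≤ wt s * wt h := by
        refine (hw.mul_le _ _).trans (Nat.mul_le_mul_right _ ?_)
        rw [wt, polyWeight_monomial isWeight_natAbs]
        exact (Nat.mul_le_mul_left _ (Nat.pow_le_pow_right (by norm_num) (by omega))).trans
          (coeff_mul_two_pow_le isWeight_natAbs s s.natDegree)
      have h3 := hw.add_le (C h.leadingCoeff * s) (-(monomial e s.leadingCoeff * h))
      rw [hw.neg, ← sub_eq_add_neg, ← hs'] at h3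
      nlinarith
    obtain ⟨m, q, r, h1, h2, h3⟩ := ih s' hdeg
    refine ⟨m + 1, q + C (h.leadingCoeff ^ m) * monomial e s.leadingCoeff, r, ?_, h2,
      h3.trans ?_⟩
    · rw [add_mul, add_right_comm, ← h1, hs', pow_succ, C_mul]
      ring
    · rw [pow_succ, mul_assoc]
      exact Nat.mul_le_mul_left _ hwt

/-- A polynomial with a root in a field where its leading coefficient does not vanish has a
nonconstant irreducible factor with the same root. -/
theorem exists_irreducible_factor {k : Type*} [Field k] {t : k} {h : ℤ[X]}
    (hl : (h.leadingCoeff : k) ≠ 0) (ht : ev t h = 0) :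
    ∃ h₁ : ℤ[X], Irreducible h₁ ∧ h₁.natDegree ≠ 0 ∧ h₁ ∣ h ∧ ev t h₁ = 0 := by
  have hh : h ≠ 0 := by rintro rfl; simp at hl
  obtain ⟨F, hF, hFh⟩ := UniqueFactorizationMonoid.exists_prime_factors h hh
  have h1 : (F.map (ev t)).prod = 0 := by
    rw [Multiset.prod_hom F (aeval t : ℤ[X] →ₐ[ℤ] k)]
    obtain ⟨w, hw⟩ := hFh.symm
    rw [← hw, map_mul, show aeval t h = 0 from ht, zero_mul]
  obtain ⟨h₁, hh₁, h0⟩ := Multiset.mem_map.1 (Multiset.prod_eq_zero_iff.1 h1)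
  have hdvd : h₁ ∣ h := (Multiset.dvd_prod hh₁).trans hFh.dvd
  refine ⟨h₁, (hF _ hh₁).irreducible, fun hdeg => hl ?_, hdvd, h0⟩
  rw [eq_C_of_natDegree_eq_zero hdeg] at hdvd h0
  obtain ⟨m, hm⟩ := C_dvd_iff_dvd_coeff _ _ |>.1 hdvd h.natDegree
  rw [leadingCoeff, hm, Int.cast_mul]
  rw [ev, aeval_C, algebraMap_int_eq, eq_intCast] at h0
  rw [h0, zero_mul]

/-- A nonconstant irreducible integer polynomial is primitive, so by Gauss's lemma it divides all
integer polynomials that vanish at its root in the number field it defines. -/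
theorem exists_numberField_root {h : ℤ[X]} (hirr : Irreducible h) (hdeg : h.natDegree ≠ 0) :
    ∃ (K : Type) (_ : Field K) (_ : NumberField K) (x : K), Algebra.adjoin ℚ {x} = ⊤ ∧
      ∀ s : ℤ[X], ev x s = 0 ↔ h ∣ s := by
  have hprim : h.IsPrimitive := hirr.isPrimitive hdeg
  set H := h.map (Int.castRingHom ℚ) with hH
  have hirrQ : Irreducible H := (IsPrimitive.Int.irreducible_iff_irreducible_map_cast hprim).1 hirr
  have : Fact (Irreducible H) := ⟨hirrQ⟩
  have hfin : FiniteDimensional ℚ (AdjoinRoot H) := (AdjoinRoot.powerBasis hirrQ.ne_zero).finite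
  refine ⟨AdjoinRoot H, inferInstance, @NumberField.mk _ _ (algebraRat.charZero _) hfin,
    AdjoinRoot.root H, AdjoinRoot.adjoinRoot_eq_top, fun s => ?_⟩
  rw [IsPrimitive.Int.dvd_iff_map_cast_dvd_map_cast _ _ hprim, ← hH, ← AdjoinRoot.mk_eq_zero,
    ← AdjoinRoot.aeval_eq, aeval_def, eval₂_map, ev, aeval_def]
  refine Eq.congr_left ?_
  congr 1

/-- A failure in a finite field, at a root of a polynomial of small weight, transfers to a number
field. -/
theorem fails_of_generic_root {k : Type*} [Field k] {t : k} {c b B G : ℕ} {h : ℤ[X]}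
    (hB : minBox c b ≤ B) (hG : minGen c b B ≤ G) (hgen : Generic t h.natDegree G)
    (hf : BoxFails t c B) (hk : LargeChar k G) (hb : InBox b b h) (hdeg : 0 < h.natDegree)
    (ht : ev t h = 0) :
    ∃ (K : Type) (_ : Field K) (_ : CharZero K) (x : K), ∀ y, ¬ evF (xy x y) c := by
  have hh : h ≠ 0 := by rintro rfl; simp at hdeg
  have hl0 : h.leadingCoeff ≠ 0 := leadingCoeff_ne_zero.2 hh
  have hbG : b ≤ G := by rw [minGen] at hG; omega
  have hl : (h.leadingCoeff : k) ≠ 0 :=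
    hk.intCast_ne_zero hl0 ((hb.2 _).le.trans (by exact_mod_cast hbG))
  obtain ⟨h₁, hirr, hdeg₁, hdvd, ht₁⟩ := exists_irreducible_factor hl ht
  obtain ⟨K, _, _, x, htop, hev⟩ := exists_numberField_root hirr hdeg₁
  refine ⟨K, inferInstance, inferInstance, x, ?_⟩
  have hxh : ev x h = 0 := (hev h).2 hdvd
  have hbox := two_pow_lt_minBox c b
  refine fails_of_boxFails (fun s hs => ?_) (fun f y hfW hf0 hfy => ?_) (fun S hS => ?_)
    (by omega) hf
  · refine ⟨fun h0 => ?_, fun h0 => ?_⟩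
    · obtain ⟨q, rfl⟩ := (hev s).1 h0
      rw [ev, map_mul, show aeval t h₁ = 0 from ht₁, zero_mul]
    -- The remainder of `s` modulo `h` vanishes at `t`, hence is zero by genericity.
    · have hsN : s.natDegree < testBound c B + 1 := by
        by_cases hs0 : s = 0
        · rw [hs0, natDegree_zero]; omega
        · exact (natDegree_lt_wt hs0).trans (by omega)
      obtain ⟨m, q, r, hqr, hr, hwr⟩ := exists_pseudoDivision hdeg _ s hsN
      have hrG : wt r < G := by
        have h1 : (2 * wt h) ^ (testBound c B + 1) * wt s ≤
            (2 * (b * b * 2 ^ b)) ^ (testBound c B + 1) * testBound c B :=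
          Nat.mul_le_mul (Nat.pow_le_pow_left (Nat.mul_le_mul_left _ hb.wt_le) _) hs
        rw [minGen] at hG
        omega
      have htr : ev t r = 0 := by
        have := congrArg (ev t) hqr
        simp only [ev, map_mul, map_add, show aeval t s = 0 from h0,
          show aeval t h = 0 from ht] at this
        simpa using this.symm
      have hr0 : r = 0 := by
        have h1 := hgen r ⟨hr, (InBox.of_wt_lt hrG).2⟩ htr
        ext i
        by_contra hi
        exact hk.intCast_ne_zero hi ((abs_coeff_le_wt r i).trans (by exact_mod_cast hrG.le)) (h1 i)
      have := congrArg (ev x) hqr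
      simp only [ev, map_mul, map_add, hr0, show aeval x h = 0 from hxh, aeval_C, map_pow] at this
      simpa [hl0] using this
  · exact exists_fraction_numberField htop hxh hdeg hfW hf0 hfy
      ((rootBound_mono hb.wt_le).trans ((rootBound_le_minBox c b).trans hB))
  · exact exists_ev_notMem_of_charZero (by omega) S hS

theorem not_valid_of_fails {K : Type} [Field K] [Infinite K] {x : K} {c : ℕ}
    (h : ∀ y, ¬ evF (xy x y) c) : ¬ Valid.{u} c := by
  intro hv
  let e : ULift.{u} K ≃+* K := ULift.ringEquiv
  have : Infinite (ULift.{u} K) := e.toEquiv.infinite_iff.2 ‹_›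
  obtain ⟨y, hy⟩ := hv (ULift.{u} K) (e.symm x)
  rw [← evF_xy_map_iff e e.injective, e.apply_symm_apply] at hy
  exact h _ hy

/-- Certificates are sound. -/
theorem not_valid_of_finiteRefutation {k : Type} [Field k] [Finite k] {t : k} {c : ℕ}
    (h : FiniteRefutation t c) : ¬ Valid.{u} c := by
  obtain ⟨hk, h⟩ | ⟨b, B, G, n, hB, hG, hgen, hf, h⟩ := h
  · have : Infinite (FractionRing k[X]) :=
      Infinite.of_injective _ (IsFractionRing.injective k[X] (FractionRing k[X]))
    exact not_valid_of_fails (fails_fractionRing hk h)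
  obtain ⟨rfl, p, hp0, hpB, hpk⟩ | ⟨rfl, hk⟩ | ⟨hk, h, hb, rfl, hdeg, ht⟩ := h
  · obtain ⟨q, hq⟩ := CharP.exists k
    have hq0 : q.Prime := (CharP.char_is_prime_or_zero k q).resolve_right
      (CharP.char_ne_zero_of_finite k q)
    have : Fact q.Prime := ⟨hq0⟩
    have hqp : q ≤ p := Nat.le_of_dvd hp0 ((CharP.cast_eq_zero_iff k q p).1 hpk)
    have : Infinite (FractionRing (ZMod q)[X]) :=
      Infinite.of_injective _ (IsFractionRing.injective (ZMod q)[X] (FractionRing (ZMod q)[X]))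
    exact not_valid_of_fails (fails_of_generic_of_charP (K := FractionRing (ZMod q)[X]) (p := q)
      hB hG hgen hf (hqp.trans hpB))
  · have : Infinite (FractionRing ℤ[X]) :=
      Infinite.of_injective _ (IsFractionRing.injective ℤ[X] (FractionRing ℤ[X]))
    exact not_valid_of_fails (fails_of_generic_of_largeChar (K := FractionRing ℤ[X])
      hB hG hgen hf hk)
  · obtain ⟨K, _, _, x, h⟩ := fails_of_generic_root hB hG hgen hf hk hb hdeg ht
    exact not_valid_of_fails h

/-! ### Completeness of certificates -/

theorem finite_inBox (n b : ℕ) : {u : ℤ[X] | InBox n b u}.Finite := by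
  classical
  refine ((Fintype.piFinset fun _ : Fin n => Finset.Icc (-(b : ℤ)) b).image
    fun c => ∑ i : Fin n, monomial (i : ℕ) (c i)).finite_toSet.subset fun u hu => ?_
  rw [Finset.mem_coe, Finset.mem_image]
  refine ⟨fun i => u.coeff i, Fintype.mem_piFinset.2 fun i => ?_, ?_⟩
  · have := abs_lt.1 (hu.2 i)
    exact Finset.mem_Icc.2 ⟨this.1.le, this.2.le⟩
  · rw [Fin.sum_univ_eq_sum_range (fun i => monomial i (u.coeff i))]
    exact (as_sum_range' u n hu.1).symm

theorem isJacobsonRing_int : IsJacobsonRing ℤ := by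
  rw [isJacobsonRing_iff_prime_eq]
  intro P hP
  by_cases h : P = ⊥
  · subst h
    refine le_antisymm (fun m hm => ?_) Ideal.le_jacobson
    have h1 := Int.isUnit_iff.1 (Ideal.mem_jacobson_bot.1 hm m)
    rw [Ideal.mem_bot]
    refine mul_self_eq_zero.1 ?_
    have h2 := mul_self_nonneg m
    obtain h1 | h1 := h1 <;> linarith
  · have := IsPrime.to_maximal_ideal h
    exact Ideal.jacobson_eq_self_of_isMaximal

/-- The residue fields of `ℤ[X]` are finite. -/
theorem finite_quotient_of_isMaximal (M : Ideal ℤ[X]) [hM : M.IsMaximal] : Finite (ℤ[X] ⧸ M) := by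
  let : Field (ℤ[X] ⧸ M) := Ideal.Quotient.field M
  have := isJacobsonRing_int
  have hfin : Module.Finite ℤ (ℤ[X] ⧸ M) := finite_of_finite_type_of_isJacobsonRing ℤ _
  obtain ⟨p, hp⟩ := CharP.exists (ℤ[X] ⧸ M)
  obtain hp0 | hp0 := CharP.char_is_prime_or_zero (ℤ[X] ⧸ M) p
  · have : Fact p.Prime := ⟨hp0⟩
    let := ZMod.algebra (ℤ[X] ⧸ M) p
    have : Module.Finite (ZMod p) (ℤ[X] ⧸ M) := Module.Finite.of_restrictScalars_finite ℤ _ _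
    exact Module.finite_of_finite (ZMod p)
  · subst hp0
    have : CharZero (ℤ[X] ⧸ M) := CharP.charP_to_charZero _
    exact absurd (isField_of_isIntegral_of_isField (R := ℤ) (S := ℤ[X] ⧸ M)
      (FaithfulSMul.algebraMap_injective ℤ _) (Field.toIsField _)) Int.not_isField

/-- An element `a` of a field has an image `t` in some finite field such that the polynomials from a
given box vanish at `t` only if they vanish at `a`: the kernel of the evaluation at `a` is an
intersection of maximal ideals of the Jacobson ring `ℤ[X]`, one of which does not contain the
product of the polynomials from the box that do not vanish at `a`. -/
theorem exists_finite_field_imitation {K : Type*} [Field K] (a : K) (M : ℕ) :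
    ∃ (k : Type) (_ : Field k) (_ : Finite k) (t : k), (∀ s, ev a s = 0 → ev t s = 0) ∧
      ∀ s, InBox M M s → ev t s = 0 → ev a s = 0 := by
  classical
  set P : Ideal ℤ[X] := RingHom.ker (aeval a : ℤ[X] →ₐ[ℤ] K) with hP
  have hprime : P.IsPrime := RingHom.ker_isPrime _
  set F := (finite_inBox M M).toFinset.filter (fun s => s ∉ P) with hF
  have hF0 : ∏ s ∈ F, s ∉ P := by
    rw [hprime.prod_mem_iff]
    push Not
    exact fun s hs => (Finset.mem_filter.1 hs).2
  have := isJacobsonRing_int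
  have hJ : P.jacobson = P := isJacobsonRing_iff_prime_eq.1 inferInstance P hprime
  rw [← hJ, Ideal.jacobson, Submodule.mem_sInf] at hF0
  push Not at hF0
  obtain ⟨Q, ⟨hPQ, hQ⟩, hFQ⟩ := hF0
  let : Field (ℤ[X] ⧸ Q) := Ideal.Quotient.field Q
  have hev : ∀ s : ℤ[X], ev (Ideal.Quotient.mk Q X) s = Ideal.Quotient.mk Q s := fun s => by
    rw [← map_ev]
    exact congrArg _ (aeval_X_left_apply s)
  refine ⟨ℤ[X] ⧸ Q, inferInstance, finite_quotient_of_isMaximal Q, Ideal.Quotient.mk Q X,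
    fun s hs => ?_, fun s hs h0 => ?_⟩
  · rw [hev, Ideal.Quotient.eq_zero_iff_mem]
    exact hPQ hs
  · rw [hev, Ideal.Quotient.eq_zero_iff_mem] at h0
    by_contra hsP
    have hsF : s ∈ F := Finset.mem_filter.2 ⟨(finite_inBox M M).mem_toFinset.2 hs, hsP⟩
    exact hFQ (Ideal.mem_of_dvd Q (Finset.dvd_prod_of_mem _ hsF) h0)

/-- If `t` imitates `a`, a failure at `a` implies failures at `t` throughout the box. -/
theorem BoxFails.of_imitation {K k : Type*} [Field K] [Field k] {a : K} {t : k} {c B M : ℕ}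
    (h₁ : ∀ s, ev a s = 0 → ev t s = 0) (h₂ : ∀ s, InBox M M s → ev t s = 0 → ev a s = 0)
    (hM : testBound c B < M) (hf : ∀ y, ¬ evF (xy a y) c) : BoxFails t c B := by
  intro u v hu hv hvt h
  have hva : ev a v ≠ 0 := fun h => hvt (h₁ v h)
  rw [← evF_div_iff (fun s hs => ⟨h₁ s, h₂ s (.of_wt_lt (hs.trans_lt hM))⟩) hu hv hva hvt] at h
  exact hf _ h

theorem intCast_eq_ev {R : Type*} [CommRing R] (t : R) (m : ℤ) : (m : R) = ev t (C m) := by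
  rw [ev, aeval_C]; simp

theorem inBox_C {M : ℕ} {m : ℤ} (hm : |m| < M) : InBox M M (C m) := by
  refine ⟨?_, fun i => ?_⟩
  · rw [natDegree_C]
    have := abs_nonneg m
    omega
  · rw [coeff_C]
    split_ifs
    · exact hm
    · simpa using lt_of_le_of_lt (abs_nonneg m) hm

theorem LargeChar.of_imitation {K k : Type*} [Field K] [CharZero K] [Field k] {a : K} {t : k}
    {G M : ℕ} (h₂ : ∀ s, InBox M M s → ev t s = 0 → ev a s = 0) (hM : G < M) : LargeChar k G := by
  intro i hi hiG h
  have h3 := h₂ (C i) (inBox_C (by rw [Nat.abs_cast]; omega))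
    (by rw [← intCast_eq_ev, Int.cast_natCast, h])
  rw [← intCast_eq_ev, Int.cast_natCast] at h3
  exact hi.ne' (by exact_mod_cast h3)

/-- The certificate for an element `a` that is transcendental over the prime field. The box
contains the characteristic, so that a positive characteristic is detected. -/
theorem exists_finiteRefutation_of_transcendental {K : Type*} [Field K] {a : K} {c : ℕ}
    (hf : ∀ y, ¬ evF (xy a y) c)
    (ha : ∀ u : ℤ[X], ev a u = 0 → ∀ i, (u.coeff i : K) = 0) :
    ∃ (k : Type) (_ : Field k) (_ : Finite k) (t : k), FiniteRefutation t c := by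
  obtain ⟨p, hp⟩ := CharP.exists K
  set B := minBox c 0 + p with hB
  set G := minGen c 0 B with hG
  set M := testBound c B + G + 1 with hM
  obtain ⟨k, _, _, t, h₁, h₂⟩ := exists_finite_field_imitation a M
  refine ⟨k, inferInstance, inferInstance, t, .inr ⟨0, B, G, G, by omega, le_rfl,
    fun u hu h0 i => ?_, .of_imitation h₁ h₂ (by omega) hf, ?_⟩⟩
  · have h3 := ha u (h₂ u ⟨hu.1.trans_le (by omega), fun i => (hu.2 i).trans_le
      (by exact_mod_cast (by omega : G ≤ M))⟩ h0) i
    rw [intCast_eq_ev a] at h3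
    rw [intCast_eq_ev t, h₁ _ h3]
  · obtain hp0 | hp0 := Nat.eq_zero_or_pos p
    · subst hp0
      have : CharZero K := CharP.charP_to_charZero K
      exact .inr (.inl ⟨rfl, .of_imitation h₂ (by omega)⟩)
    · refine .inl ⟨rfl, p, hp0, by omega, ?_⟩
      have h3 : ((p : ℤ) : k) = 0 := by
        rw [intCast_eq_ev t]
        refine h₁ _ ?_
        rw [← intCast_eq_ev a, Int.cast_natCast, CharP.cast_eq_zero]
      rwa [Int.cast_natCast] at h3

/-- The certificate for an algebraic number `a`: the polynomial `h` has minimal degree among the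
nonzero integer polynomials that vanish at `a`, hence `t` is generic up to this degree. -/
theorem exists_finiteRefutation_of_algebraic {K : Type*} [Field K] [CharZero K] {a : K} {c : ℕ}
    (hf : ∀ y, ¬ evF (xy a y) c) (ha : ∃ u : ℤ[X], ev a u = 0 ∧ u ≠ 0) :
    ∃ (k : Type) (_ : Field k) (_ : Finite k) (t : k), FiniteRefutation t c := by
  classical
  have ha' : ∃ n, ∃ h : ℤ[X], ev a h = 0 ∧ h ≠ 0 ∧ h.natDegree = n :=
    ha.elim fun h hh => ⟨_, h, hh.1, hh.2, rfl⟩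
  obtain ⟨h, hh, hh0, hn⟩ := Nat.find_spec ha'
  have hmin := fun m => Nat.find_min (m := m) ha'
  rw [← hn] at hmin
  have hdeg : 0 < h.natDegree := by
    refine Nat.pos_of_ne_zero fun h0 => hh0 ?_
    rw [eq_C_of_natDegree_eq_zero h0, ← intCast_eq_ev, Int.cast_eq_zero] at hh
    rw [eq_C_of_natDegree_eq_zero h0, hh, C_0]
  set b := wt h + 1 with hb
  set B := minBox c b with hB
  set G := minGen c b B with hG
  set M := testBound c B + G + h.natDegree + 1 with hM
  obtain ⟨k, _, _, t, h₁, h₂⟩ := exists_finite_field_imitation a M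
  refine ⟨k, inferInstance, inferInstance, t, .inr ⟨b, B, G, h.natDegree, le_rfl, le_rfl,
    fun u hu h0 i => ?_, .of_imitation h₁ h₂ (by omega) hf, .inr (.inr
    ⟨.of_imitation h₂ (by omega), h, .of_wt_lt (by omega), rfl, hdeg, h₁ h hh⟩)⟩⟩
  have h3 := h₂ u ⟨hu.1.trans_le (by omega), fun i => (hu.2 i).trans_le
    (by exact_mod_cast (by omega : G ≤ M))⟩ h0
  have h4 : u = 0 := by
    by_contra hu0
    exact hmin _ hu.1 ⟨u, h3, hu0, rfl⟩
  rw [h4, coeff_zero, Int.cast_zero]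

/-- If the formula `c` fails at an element of a finite field `k` in an infinite extension of `k`,
then it fails in the extensions of `k` of large prime degree: an element of such an extension is in
`k` or is not a root of a nonzero polynomial of small degree over `k`. -/
theorem exists_finiteRefutation_of_finite {K k : Type*} [Field K] [Infinite K] [Field k] [Finite k]
    [Algebra k K] {t : k} {c : ℕ} (hf : ∀ y, ¬ evF (xy (algebraMap k K t) y) c) :
    ∃ (k : Type) (_ : Field k) (_ : Finite k) (t : k), FiniteRefutation t c := by
  obtain ⟨p, hp⟩ := CharP.exists k
  have hp0 : p.Prime := (CharP.char_is_prime_or_zero k p).resolve_right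
    (CharP.char_ne_zero_of_finite k p)
  have : Fact p.Prime := ⟨hp0⟩
  -- The atomic polynomials have degree at most `c + 1 < ℓ`.
  obtain ⟨ℓ, hℓc, hℓ⟩ := Nat.exists_infinite_primes (c + 2)
  have : NeZero ℓ := ⟨hℓ.ne_zero⟩
  let L := FiniteField.Extension k p ℓ
  have hgenk : ¬ evF (xy (C t) X : ℕ → k[X]) c := by
    obtain ⟨S, -, -, hS⟩ := exists_exceptional_set (algebraMap k K t) c
    obtain ⟨y, hy⟩ := Infinite.exists_notMem_finset S
    have h1 := hf y
    rw [hS y hy] at h1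
    have h2 := evF_xy_map_iff (mapRingHom (algebraMap k K))
      (map_injective _ (algebraMap k K).injective) (C t) X c
    simp only [coe_mapRingHom, map_C, map_X] at h2
    rwa [h2] at h1
  refine ⟨L, inferInstance, inferInstance, algebraMap k L t, .inl ⟨?_, fun y => ?_⟩⟩
  · rw [FiniteField.natCard_extension]
    have h1 : 1 < Nat.card k := Finite.one_lt_card
    have h2 : ℓ < Nat.card k ^ ℓ := Nat.lt_pow_self h1
    omega
  · obtain ⟨S, -, hroot, hgen⟩ := exists_exceptional_set (algebraMap k L t) c
    have hmap : ∀ d, (evT (xy (C t) X) d : k[X]).map (algebraMap k L) =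
        evT (xy (C (algebraMap k L t)) X) d := by
      intro d
      rw [← coe_mapRingHom, map_evT_xy]
      simp
    by_cases hy : y ∈ S
    · obtain ⟨a, b, hab, hne, heq⟩ := hroot y hy
      set g : k[X] := evT (xy (C t) X : ℕ → k[X]) a - evT (xy (C t) X : ℕ → k[X]) b with hg
      have hg0 : g ≠ 0 := by
        intro h0
        apply hne
        rw [← hmap, ← hmap, sub_eq_zero.1 h0]
      have hgy : aeval y g = 0 := by
        rw [aeval_def, ← eval_map, hg, Polynomial.map_sub, hmap, hmap,
          ← coe_evalRingHom, map_sub, map_evT_xy, map_evT_xy]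
        simp [heq]
      have hgdeg : g.natDegree < ℓ := by
        have ha := natDegree_evT_le t a
        have hb := natDegree_evT_le t b
        exact ((natDegree_sub_le _ _).trans (max_le (ha.trans (by omega : a + 1 ≤ c + 1))
          (hb.trans (by omega)))).trans_lt (by omega)
      have hyint : IsIntegral k y := Algebra.IsIntegral.isIntegral y
      have h1 : (minpoly k y).natDegree ≤ g.natDegree :=
        natDegree_le_of_dvd (minpoly.dvd k y hgy) hg0
      have h2 : (minpoly k y).natDegree ∣ ℓ := by
        have h3 : Module.finrank k L = ℓ := FiniteField.finrank_extension k p ℓ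
        exact (minpoly.degree_dvd hyint).trans (dvd_of_eq h3)
      have h3 : (minpoly k y).natDegree = 1 :=
        ((Nat.dvd_prime hℓ).1 h2).resolve_right (by omega)
      obtain ⟨r, rfl⟩ := minpoly.natDegree_eq_one_iff.1 h3
      have h4 := evF_xy_map_iff (algebraMap k L) (algebraMap k L).injective t r c
      have h5 := evF_xy_map_iff (algebraMap k K) (algebraMap k K).injective t r c
      rw [h4, ← h5]
      exact hf _
    · rw [hgen y hy]
      have h2 := evF_xy_map_iff (mapRingHom (algebraMap k L))
        (map_injective _ (algebraMap k L).injective) (C t) X c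
      simp only [coe_mapRingHom, map_C, map_X] at h2
      rwa [h2]

/-- Certificates are complete. -/
theorem exists_finiteRefutation {c : ℕ} (hc : ¬ Valid.{u} c) :
    ∃ (k : Type) (_ : Field k) (_ : Finite k) (t : k), FiniteRefutation t c := by
  simp only [Valid, not_forall, not_exists] at hc
  obtain ⟨K, _, _, a, hf⟩ := hc
  by_cases ha : ∀ u : ℤ[X], ev a u = 0 → ∀ i, (u.coeff i : K) = 0
  · exact exists_finiteRefutation_of_transcendental hf ha
  push Not at ha
  obtain ⟨h, h0, i, hi⟩ := ha
  obtain ⟨p, hp⟩ := CharP.exists K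
  obtain rfl | hp0 := Nat.eq_zero_or_pos p
  · have : CharZero K := CharP.charP_to_charZero K
    exact exists_finiteRefutation_of_algebraic hf ⟨h, h0, by rintro rfl; simp at hi⟩
  · have : Fact p.Prime := ⟨(CharP.char_is_prime_or_zero K p).resolve_right hp0.ne'⟩
    let := ZMod.algebra K p
    have hint : IsIntegral (ZMod p) a := by
      rw [← isAlgebraic_iff_isIntegral]
      refine ⟨h.map (algebraMap ℤ (ZMod p)), fun h1 => hi ?_,
        by rw [aeval_map_algebraMap]; exact h0⟩
      have h2 := congrArg (fun q => algebraMap (ZMod p) K (q.coeff i)) h1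
      simpa using h2
    have := IntermediateField.adjoin.finiteDimensional hint
    have : Finite (IntermediateField.adjoin (ZMod p) {a}) := Module.finite_of_finite (ZMod p)
    exact exists_finiteRefutation_of_finite (K := K)
      (t := IntermediateField.AdjoinSimple.gen (ZMod p) a)
      (by rwa [IntermediateField.AdjoinSimple.algebraMap_gen])

/-! ### Finite fields given by tables -/

/-- The entry for the operation number `o` at the arguments `a` and `b` in the table `T`. A table
consists of a list, which holds the values of all operations, and of the number of elements of the
structure, the elements of which are the smaller numbers. -/
def entry (T : List ℕ × ℕ) (o a b : ℕ) : ℕ := T.1.getD (pair o (pair a b)) 0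

/-- The axioms of fields in a table. The operations are addition, multiplication, negation,
inversion and the constants `0` and `1`, with numbers from `0` to `5`; superfluous arguments
are `0`. -/
def IsFieldTable (T : List ℕ × ℕ) : Prop :=
  entry T 4 0 0 < T.2 ∧ entry T 5 0 0 < T.2 ∧ entry T 4 0 0 ≠ entry T 5 0 0 ∧
  entry T 3 (entry T 4 0 0) 0 = entry T 4 0 0 ∧
  BAll T.2 fun a => entry T 2 a 0 < T.2 ∧ entry T 3 a 0 < T.2 ∧ entry T 0 (entry T 4 0 0) a = a ∧
    entry T 0 (entry T 2 a 0) a = entry T 4 0 0 ∧ entry T 1 (entry T 5 0 0) a = a ∧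
    (a = entry T 4 0 0 ∨ entry T 1 a (entry T 3 a 0) = entry T 5 0 0) ∧
    BAll T.2 fun b => entry T 0 a b < T.2 ∧ entry T 1 a b < T.2 ∧ entry T 1 a b = entry T 1 b a ∧
      BAll T.2 fun d => entry T 0 (entry T 0 a b) d = entry T 0 a (entry T 0 b d) ∧
        entry T 1 (entry T 1 a b) d = entry T 1 a (entry T 1 b d) ∧
        entry T 1 a (entry T 0 b d) = entry T 0 (entry T 1 a b) (entry T 1 a d)

/-- The table `T` represents the field `k` under the numbering `e` of the elements of `k`. -/
structure Represents {k : Type*} [Field k] (T : List ℕ × ℕ) (e : k → ℕ) : Prop where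
  inj : Function.Injective e
  range : ∀ m, m < T.2 ↔ ∃ a, e a = m
  add : ∀ a b, entry T 0 (e a) (e b) = e (a + b)
  mul : ∀ a b, entry T 1 (e a) (e b) = e (a * b)
  neg : ∀ a, entry T 2 (e a) 0 = e (-a)
  inv : ∀ a, entry T 3 (e a) 0 = e a⁻¹
  zero : entry T 4 0 0 = e 0
  one : entry T 5 0 0 = e 1

/-- Every table that satisfies the axioms represents a finite field. -/
theorem exists_represents_of_isFieldTable {T : List ℕ × ℕ} (h : IsFieldTable T) :
    ∃ (k : Type) (_ : Field k) (_ : Finite k) (e : k → ℕ), Represents T e := by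
  obtain ⟨h0, h1, h01, hi0, h⟩ := h
  have hb := fun (a b : Fin T.2) => (h a a.2).2.2.2.2.2.2 b b.2
  let : Add (Fin T.2) := ⟨fun a b => ⟨entry T 0 a b, (hb a b).1⟩⟩
  let : Mul (Fin T.2) := ⟨fun a b => ⟨entry T 1 a b, (hb a b).2.1⟩⟩
  let : Neg (Fin T.2) := ⟨fun a => ⟨entry T 2 a 0, (h a a.2).1⟩⟩
  let : Inv (Fin T.2) := ⟨fun a => ⟨entry T 3 a 0, (h a a.2).2.1⟩⟩
  let : Zero (Fin T.2) := ⟨⟨entry T 4 0 0, h0⟩⟩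
  let : One (Fin T.2) := ⟨⟨entry T 5 0 0, h1⟩⟩
  let F : Field (Fin T.2) := Field.ofMinimalAxioms (Fin T.2)
    (fun a b d => Fin.ext ((hb a b).2.2.2 d d.2).1)
    (fun a => Fin.ext (h a a.2).2.2.1)
    (fun a => Fin.ext (h a a.2).2.2.2.1)
    (fun a b d => Fin.ext ((hb a b).2.2.2 d d.2).2.1)
    (fun a b => Fin.ext (hb a b).2.2.1)
    (fun a => Fin.ext (h a a.2).2.2.2.2.1)
    (fun a ha => Fin.ext ((h a a.2).2.2.2.2.2.1.resolve_left fun h => ha (Fin.ext h)))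
    (Fin.ext hi0)
    (fun a b d => Fin.ext ((hb a b).2.2.2 d d.2).2.2)
    ⟨0, 1, fun h => h01 (Fin.ext_iff.1 h)⟩
  exact ⟨Fin T.2, F, inferInstance, Fin.val, Fin.val_injective,
    fun m => ⟨fun hm => ⟨⟨m, hm⟩, rfl⟩, fun ⟨a, ha⟩ => ha ▸ a.2⟩, fun _ _ => rfl, fun _ _ => rfl,
    fun _ => rfl, fun _ => rfl, rfl, rfl⟩

/-- Every finite field is represented by a table. -/
theorem exists_represents (k : Type*) [Field k] [Finite k] :
    ∃ (T : List ℕ × ℕ) (e : k → ℕ), Represents T e := by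
  classical
  obtain ⟨q, ⟨f⟩⟩ := Finite.exists_equiv_fin k
  have hq : 0 < q := Fin.pos (f 0)
  let g : ℕ → k := fun m => if h : m < q then f.symm ⟨m, h⟩ else 0
  have hg : ∀ a, g (f a) = a := fun a => by simp [g]
  let v : ℕ → k := fun m => byTag (unpair m).1
    (g (unpair (unpair m).2).1 + g (unpair (unpair m).2).2)
    (g (unpair (unpair m).2).1 * g (unpair (unpair m).2).2) (-g (unpair (unpair m).2).1)
    (g (unpair (unpair m).2).1)⁻¹ 0 1 0
  have hlt : ∀ o < 6, ∀ a < q, ∀ b < q, pair o (pair a b) < pair 6 (pair q q) := by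
    intro o ho a ha b hb
    refine (Nat.pair_lt_pair_left _ ho).trans (Nat.pair_lt_pair_right _ ?_)
    exact (Nat.pair_lt_pair_left _ ha).trans (Nat.pair_lt_pair_right _ hb)
  have key : ∀ o < 6, ∀ a < q, ∀ b < q,
      entry ((List.range (pair 6 (pair q q))).map fun m => (f (v m) : ℕ), q) o a b =
        f (v (pair o (pair a b))) := by
    intro o ho a ha b hb
    simp [entry, List.getD, hlt o ho a ha b hb]
  refine ⟨((List.range (pair 6 (pair q q))).map fun m => (f (v m) : ℕ), q), fun a => f a,
    fun a b h => f.injective (Fin.ext h), fun m => ⟨fun hm => ⟨f.symm ⟨m, hm⟩, by simp⟩,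
    fun ⟨a, ha⟩ => ha ▸ (f a).2⟩, fun a b => ?_, fun a b => ?_, fun a => ?_, fun a => ?_, ?_, ?_⟩
  · rw [key 0 (by norm_num) _ (f a).2 _ (f b).2]; simp [v, hg]
  · rw [key 1 (by norm_num) _ (f a).2 _ (f b).2]; simp [v, hg]
  · rw [key 2 (by norm_num) _ (f a).2 _ hq]; simp [v, hg]
  · rw [key 3 (by norm_num) _ (f a).2 _ hq]; simp [v, hg]
  · rw [key 4 (by norm_num) _ hq _ hq]; simp [v]
  · rw [key 5 (by norm_num) _ hq _ hq]; simp [v]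

section Represents

variable {k : Type*} [Field k] {T : List ℕ × ℕ} {e : k → ℕ}

theorem Represents.lt (h : Represents T e) (a : k) : e a < T.2 := (h.range _).2 ⟨a, rfl⟩

theorem Represents.bAll_iff (h : Represents T e) {P : ℕ → Prop} : BAll T.2 P ↔ ∀ a, P (e a) :=
  ⟨fun H a => H _ (h.lt a), fun H m hm => by obtain ⟨a, rfl⟩ := (h.range m).1 hm; exact H a⟩

theorem Represents.card (h : Represents T e) : Nat.card k = T.2 := by
  have h1 : Set.range e = Set.Iio T.2 := by
    ext m
    exact (h.range m).symm
  rw [← Set.ncard_univ, ← Set.ncard_image_of_injective _ h.inj, Set.image_univ, h1,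
    Set.ncard_Iio_nat]

theorem Represents.isFieldTable (h : Represents T e) : IsFieldTable T := by
  refine ⟨?_, ?_, ?_, ?_, ?_⟩
  · exact h.zero ▸ h.lt 0
  · exact h.one ▸ h.lt 1
  · rw [h.zero, h.one]
    exact fun H => zero_ne_one (h.inj H)
  · rw [h.zero, h.inv, inv_zero]
  · simp only [h.bAll_iff, h.add, h.mul, h.neg, h.inv, h.zero, h.one, h.inj.eq_iff]
    refine fun a => ⟨h.lt _, h.lt _, zero_add a, neg_add_cancel a, one_mul a,
      (eq_or_ne a 0).imp_right mul_inv_cancel₀, fun b => ⟨h.lt _, h.lt _, mul_comm a b, fun d =>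
      ⟨add_assoc a b d, mul_assoc a b d, mul_add a b d⟩⟩⟩

end Represents

/-! ### Evaluation in tables -/

/-- The value of the term `c` in the structure given by a table; the argument consists of the table
and the values of the variables. -/
def tableT (w : (List ℕ × ℕ) × ℕ × ℕ) (c : ℕ) : ℕ :=
  treeRec 0 (fun (w : (List ℕ × ℕ) × ℕ × ℕ) c p l r => byTag (unpair c).1
    (if (unpair c).2 = 0 then w.2.1 else w.2.2) (entry w.1 4 0 0) (entry w.1 5 0 0)
    (entry w.1 2 p 0) (entry w.1 0 l r) (entry w.1 1 l r) (entry w.1 4 0 0)) w c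

/-- The truth value, `0` or `1`, of the formula `c` in the structure given by a table. -/
def tableF (w : (List ℕ × ℕ) × ℕ × ℕ) (c : ℕ) : ℕ :=
  treeRec 0 (fun (w : (List ℕ × ℕ) × ℕ × ℕ) c _ l r => byTag (unpair c).1 0
    (if tableT w (unpair (unpair c).2).1 = tableT w (unpair (unpair c).2).2 then 1 else 0)
    (if l = 0 then 1 else r) 0 0 0 0) w c

/-- The digit number `i` of `D` in base `b`. -/
def digit (b D i : ℕ) : ℕ := D / b ^ i % b

/-- The polynomial of degree less than `n` the coefficients of which are the differences of the
digits of `D` and `D'` in base `b`. -/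
noncomputable def boxPoly (b n D D' : ℕ) : ℤ[X] :=
  ∑ i ∈ Finset.range n, monomial i ((digit b D i : ℤ) - digit b D' i)

/-- The value of the natural number `m` in the structure given by a table. -/
def tableNat (T : List ℕ × ℕ) (m : ℕ) : ℕ :=
  iter (entry T 4 0 0) (fun _ s => entry T 0 s (entry T 5 0 0)) m

/-- Powers in the structure given by a table. -/
def tablePow (T : List ℕ × ℕ) (t i : ℕ) : ℕ := iter (entry T 5 0 0) (fun _ s => entry T 1 s t) i

/-- The value at `t` of the polynomial of degree less than `n` with the digits of `D` as
coefficients. -/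
def tableDigits (T : List ℕ × ℕ) (t b n D : ℕ) : ℕ :=
  iter (entry T 4 0 0) (fun i s => entry T 0 s (entry T 1 (tableNat T (digit b D i))
    (tablePow T t i))) n

/-- The value of `boxPoly b n D D'` at `t`. -/
def tableBox (T : List ℕ × ℕ) (t b n D D' : ℕ) : ℕ :=
  entry T 0 (tableDigits T t b n D) (entry T 2 (tableDigits T t b n D') 0)

/-- The computable form of `Generic`. -/
def TableGeneric (T : List ℕ × ℕ) (t n G : ℕ) : Prop :=
  BAll (G ^ n) fun D => BAll (G ^ n) fun D' => tableBox T t G n D D' ≠ entry T 4 0 0 ∨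
    BAll n fun i => tableNat T (digit G D i) = tableNat T (digit G D' i)

/-- The computable form of `BoxFails`. -/
def TableBoxFails (T : List ℕ × ℕ) (t c B : ℕ) : Prop :=
  BAll (B ^ B) fun D => BAll (B ^ B) fun D' => BAll (B ^ B) fun E => BAll (B ^ B) fun E' =>
    tableBox T t B B E E' = entry T 4 0 0 ∨
      tableF (T, t, entry T 1 (tableBox T t B B D D') (entry T 3 (tableBox T t B B E E') 0)) c = 0

/-- The computable form of `LargeChar`. -/
def TableLargeChar (T : List ℕ × ℕ) (G : ℕ) : Prop :=
  BAll G fun i => tableNat T (i + 1) ≠ entry T 4 0 0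

/-- The computable form of `FiniteRefutation`. -/
def TableRefutation (T : List ℕ × ℕ) (t b B G n D D' c : ℕ) : Prop :=
  (c + 1 < T.2 ∧ BAll T.2 fun y => tableF (T, t, y) c = 0) ∨
  (minBox c b ≤ B ∧ minGen c b B ≤ G ∧ 0 < n ∧ TableGeneric T t n G ∧ TableBoxFails T t c B ∧
    ((n = G ∧ BEx B fun p => tableNat T (p + 1) = entry T 4 0 0) ∨
     (n = G ∧ TableLargeChar T G) ∨
     (TableLargeChar T G ∧ D < b ^ b ∧ D' < b ^ b ∧ n < b ∧ digit b D n ≠ digit b D' n ∧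
      (BAll b fun i => i ≤ n ∨ digit b D i = digit b D' i) ∧
      tableBox T t b b D D' = entry T 4 0 0)))

/-! ### Polynomials given by digits -/

/-- Digits may be prescribed. -/
theorem exists_digits {b n : ℕ} (a : ℕ → ℕ) (ha : ∀ i < n, a i < b) :
    ∃ D < b ^ n, ∀ i < n, digit b D i = a i := by
  induction n with
  | zero => exact ⟨0, by simp, by simp⟩
  | succ n ih =>
    obtain ⟨D, hD, h⟩ := ih fun i hi => ha i (by omega)
    have hb : 0 < b := by have := ha n (by omega); omega
    refine ⟨D + b ^ n * a n, ?_, fun i hi => ?_⟩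
    · have h1 : b ^ n * (a n + 1) ≤ b ^ n * b := Nat.mul_le_mul_left _ (ha n (by omega))
      rw [pow_succ]
      rw [mul_add] at h1
      omega
    · obtain hi | rfl := Nat.lt_succ_iff_lt_or_eq.1 hi
      · obtain ⟨j, rfl⟩ : ∃ j, n = i + (j + 1) := ⟨n - i - 1, by omega⟩
        rw [← h i hi, digit, digit, pow_add, mul_assoc, Nat.add_mul_div_left _ _ (by positivity),
          pow_succ, mul_comm (b ^ j), mul_assoc, Nat.add_mul_mod_self_left]
      · rw [digit, Nat.add_mul_div_left _ _ (by positivity), Nat.div_eq_of_lt hD, zero_add,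
          Nat.mod_eq_of_lt (ha i (by omega))]

theorem coeff_boxPoly (b n D D' i : ℕ) : (boxPoly b n D D').coeff i =
    if i < n then (digit b D i : ℤ) - digit b D' i else 0 := by
  simp only [boxPoly, finsetSum_coeff, coeff_monomial, Finset.sum_ite_eq', Finset.mem_range]

theorem inBox_boxPoly {b n D D' : ℕ} (hn : 0 < n) (hb : 0 < b) : InBox n b (boxPoly b n D D') := by
  refine ⟨?_, fun i => ?_⟩
  · refine (natDegree_le_iff_coeff_eq_zero (n := n - 1)).2 (fun i hi => ?_) |>.trans_lt (by omega)
    rw [coeff_boxPoly, if_neg (by omega)]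
  · rw [coeff_boxPoly]
    have h1 : digit b D i < b := Nat.mod_lt _ hb
    have h2 : digit b D' i < b := Nat.mod_lt _ hb
    split_ifs
    · rw [abs_lt]; omega
    · simpa using hb

theorem InBox.exists_boxPoly {b n : ℕ} {u : ℤ[X]} (hu : InBox n b u) :
    ∃ D < b ^ n, ∃ D' < b ^ n, u = boxPoly b n D D' := by
  have h := fun i => abs_lt.1 (hu.2 i)
  obtain ⟨D, hD, h1⟩ := exists_digits (n := n) (b := b) (fun i => (u.coeff i).toNat)
    fun i _ => by have := h i; omega
  obtain ⟨D', hD', h2⟩ := exists_digits (n := n) (b := b) (fun i => (-u.coeff i).toNat)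
    fun i _ => by have := h i; omega
  refine ⟨D, hD, D', hD', ?_⟩
  ext i
  rw [coeff_boxPoly]
  split_ifs with hi
  · rw [h1 i hi, h2 i hi]
    omega
  · exact coeff_eq_zero_of_natDegree_lt (by have := hu.1; omega)

theorem forall_inBox_iff {b n : ℕ} (hn : 0 < n) {P : ℤ[X] → Prop} :
    (∀ u, InBox n b u → P u) ↔
      BAll (b ^ n) fun D => BAll (b ^ n) fun D' => P (boxPoly b n D D') := by
  refine ⟨fun h D hD D' _ => h _ (inBox_boxPoly hn ?_), fun h u hu => ?_⟩
  · by_contra hb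
    rw [Nat.eq_zero_of_not_pos hb, zero_pow hn.ne'] at hD
    omega
  · obtain ⟨D, hD, D', hD', rfl⟩ := hu.exists_boxPoly
    exact h D hD D' hD'

/-! ### Correctness of the evaluation in tables -/

namespace Represents

variable {k : Type*} [Field k] {T : List ℕ × ℕ} {e : k → ℕ}

theorem tableT_eq (h : Represents T e) (x y : k) (c : ℕ) :
    tableT (T, e x, e y) c = e (evT (xy x y) c) := by
  induction c using term_induction with
  | var i => rw [tableT, treeRec, evT_var, xy]; simp [apply_ite e]
  | zero r => rw [tableT, treeRec, evT_zero]; simp [h.zero]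
  | one r => rw [tableT, treeRec, evT_one]; simp [h.one]
  | neg a ih =>
    rw [tableT] at *
    rw [treeRec_pair _ _ _ (by norm_num), evT_neg]
    simp [ih, h.neg]
  | add a b iha ihb =>
    rw [tableT] at *
    rw [treeRec_pair _ _ _ (by norm_num), evT_add]
    simp [iha, ihb, h.add]
  | mul a b iha ihb =>
    rw [tableT] at *
    rw [treeRec_pair _ _ _ (by norm_num), evT_mul]
    simp [iha, ihb, h.mul]
  | junk t r ht =>
    rw [tableT, treeRec_pair _ _ _ (by omega), evT_junk _ ht]
    simp [byTag_junk _ _ _ _ _ _ _ ht, h.zero]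

theorem tableF_eq_zero_iff (h : Represents T e) (x y : k) (c : ℕ) :
    tableF (T, e x, e y) c = 0 ↔ ¬ evF (xy x y) c := by
  induction c using formula_induction with
  | falsum r => rw [tableF, treeRec]; simp
  | equal a b => rw [tableF, treeRec]; simp [h.tableT_eq, h.inj.eq_iff]
  | imp a b iha ihb =>
    rw [tableF] at *
    rw [treeRec_pair _ _ _ (by norm_num), evF_imp]
    by_cases ha : evF (xy x y) a <;> simp_all
  | junk t r ht =>
    rw [tableF, treeRec_pair _ _ _ (by omega)]
    simp [byTag_const _ _ _ _ ht, evF_junk _ ht]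

theorem tableNat_eq (h : Represents T e) (m : ℕ) : tableNat T m = e m := by
  induction m with
  | zero => rw [Nat.cast_zero, ← h.zero]; rfl
  | succ m ih => rw [Nat.cast_succ, ← h.add, ← ih, ← h.one]; rfl

theorem tablePow_eq (h : Represents T e) (t : k) (i : ℕ) : tablePow T (e t) i = e (t ^ i) := by
  induction i with
  | zero => rw [pow_zero, ← h.one]; rfl
  | succ i ih => rw [pow_succ, ← h.mul, ← ih]; rfl

theorem tableDigits_eq (h : Represents T e) (t : k) (b n D : ℕ) :
    tableDigits T (e t) b n D = e (∑ i ∈ Finset.range n, (digit b D i : k) * t ^ i) := by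
  induction n with
  | zero => rw [Finset.sum_range_zero, ← h.zero]; rfl
  | succ n ih =>
    rw [Finset.sum_range_succ, ← h.add, ← ih, ← h.mul, ← h.tablePow_eq, ← h.tableNat_eq]; rfl

theorem tableBox_eq (h : Represents T e) (t : k) (b n D D' : ℕ) :
    tableBox T (e t) b n D D' = e (ev t (boxPoly b n D D')) := by
  rw [tableBox, h.tableDigits_eq, h.tableDigits_eq, h.neg, h.add, ev, boxPoly, map_sum,
    ← sub_eq_add_neg, ← Finset.sum_sub_distrib]
  congr 1
  refine Finset.sum_congr rfl fun i _ => ?_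
  rw [aeval_monomial]
  simp [sub_mul]

theorem tableGeneric_iff (h : Represents T e) {t : k} {n G : ℕ} (hn : 0 < n) :
    TableGeneric T (e t) n G ↔ Generic t n G := by
  rw [Generic, forall_inBox_iff hn, TableGeneric]
  simp only [BAll, h.tableBox_eq, h.tableNat_eq, h.zero, ne_eq, h.inj.eq_iff, coeff_boxPoly]
  refine forall₄_congr fun D _ D' _ => ?_
  rw [imp_iff_not_or]
  refine or_congr_right (forall_congr' fun i => ?_)
  split_ifs with hi <;> simp [hi, sub_eq_zero]

theorem tableBoxFails_iff (h : Represents T e) {t : k} {c B : ℕ} (hB : 0 < B) :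
    TableBoxFails T (e t) c B ↔ BoxFails t c B := by
  have h1 : BoxFails t c B ↔ ∀ u, InBox B B u → ∀ v, InBox B B v →
      (ev t v = 0 ∨ ¬ evF (xy t (ev t u / ev t v)) c) := by
    simp only [BoxFails, or_iff_not_imp_left]
    exact ⟨fun H u hu v hv => H u v hu hv, fun H u v hu hv => H u hu v hv⟩
  rw [h1, forall_inBox_iff hB]
  simp only [forall_inBox_iff hB, TableBoxFails, h.tableBox_eq, h.zero, h.inv, h.mul,
    h.tableF_eq_zero_iff, h.inj.eq_iff, div_eq_mul_inv]

theorem tableLargeChar_iff (h : Represents T e) {G : ℕ} :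
    TableLargeChar T G ↔ LargeChar k G := by
  simp only [TableLargeChar, BAll, h.tableNat_eq, h.zero, ne_eq, h.inj.eq_iff, LargeChar]
  refine ⟨fun H i hi hiG => ?_, fun H i hi => H (i + 1) (by omega) (by omega)⟩
  have := H (i - 1) (by omega)
  rwa [Nat.sub_add_cancel hi] at this

theorem finiteRefutation (h : Represents T e) {t : k} {b B G n D D' c : ℕ}
    (H : TableRefutation T (e t) b B G n D D' c) : FiniteRefutation t c := by
  obtain ⟨h1, h2⟩ | ⟨hB, hG, hn, hgen, hbox, H⟩ := H
  · left
    rw [h.bAll_iff] at h2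
    exact ⟨h.card ▸ h1, fun y => (h.tableF_eq_zero_iff t y c).1 (h2 y)⟩
  · have hB0 : 0 < B := (Nat.zero_le _).trans_lt ((two_pow_lt_minBox c b).trans_le hB)
    rw [h.tableGeneric_iff hn] at hgen
    rw [h.tableBoxFails_iff hB0] at hbox
    rw [h.tableLargeChar_iff] at H
    refine .inr ⟨b, B, G, n, hB, hG, hgen, hbox, H.imp (fun ⟨h1, p, hp, h2⟩ =>
      ⟨h1, p + 1, by omega, by omega, ?_⟩) (Or.imp_right fun ⟨h1, hD, hD', hnb, hne, hhi, h0⟩ =>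
        ⟨h1, boxPoly b b D D', inBox_boxPoly (by omega) (by omega), ?_, hn, ?_⟩)⟩
    · beta_reduce at h2
      rwa [h.tableNat_eq, h.zero, h.inj.eq_iff] at h2
    · refine le_antisymm (natDegree_le_iff_coeff_eq_zero.2 fun i hi => ?_)
        (le_natDegree_of_ne_zero ?_)
      · rw [coeff_boxPoly]
        split_ifs with hib
        · rw [(hhi i hib).resolve_left (by omega), sub_self]
        · rfl
      · rw [coeff_boxPoly, if_pos hnb, sub_ne_zero]
        exact_mod_cast hne
    · rwa [h.tableBox_eq, h.zero, h.inj.eq_iff] at h0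

theorem exists_tableRefutation (h : Represents T e) {t : k} {c : ℕ} (H : FiniteRefutation t c) :
    ∃ b B G n D D', TableRefutation T (e t) b B G n D D' c := by
  obtain ⟨h1, h2⟩ | ⟨b, B, G, n, hB, hG, hgen, hbox, H⟩ := H
  · refine ⟨0, 0, 0, 0, 0, 0, .inl ⟨h.card ▸ h1, ?_⟩⟩
    rw [h.bAll_iff]
    exact fun y => (h.tableF_eq_zero_iff t y c).2 (h2 y)
  · have hB0 : 0 < B := (Nat.zero_le _).trans_lt ((two_pow_lt_minBox c b).trans_le hB)
    have hG0 : 0 < G := by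
      rw [minGen] at hG
      omega
    have hn : 0 < n := by
      obtain ⟨rfl, _⟩ | ⟨rfl, _⟩ | ⟨_, _, _, _, hn, _⟩ := H <;> assumption
    rw [← h.tableGeneric_iff hn] at hgen
    rw [← h.tableBoxFails_iff hB0] at hbox
    rw [← h.tableLargeChar_iff] at H
    obtain ⟨h1, p, hp0, hpB, hp⟩ | ⟨h1, h2⟩ | ⟨h1, g, hg, rfl, -, h0⟩ := H
    · refine ⟨b, B, G, n, 0, 0, .inr ⟨hB, hG, hn, hgen, hbox, .inl ⟨h1, p - 1, by omega, ?_⟩⟩⟩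
      beta_reduce
      rw [h.tableNat_eq, h.zero, h.inj.eq_iff, Nat.sub_add_cancel hp0, hp]
    · exact ⟨b, B, G, n, 0, 0, .inr ⟨hB, hG, hn, hgen, hbox, .inr (.inl ⟨h1, h2⟩)⟩⟩
    · obtain ⟨D, hD, D', hD', rfl⟩ := hg.exists_boxPoly
      refine ⟨b, B, G, _, D, D', .inr ⟨hB, hG, hn, hgen, hbox, .inr (.inr
        ⟨h1, hD, hD', hg.1, fun heq => ?_, fun i hi => ?_, ?_⟩)⟩⟩
      · have h3 : (boxPoly b b D D').leadingCoeff = 0 := by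
          rw [leadingCoeff, coeff_boxPoly, if_pos hg.1, heq, sub_self]
        rw [leadingCoeff_eq_zero.1 h3, natDegree_zero] at hn
        omega
      · refine (le_or_gt i _).imp_right fun hlt => ?_
        have h3 := coeff_eq_zero_of_natDegree_lt hlt
        rw [coeff_boxPoly, if_pos hi, sub_eq_zero] at h3
        exact_mod_cast h3
      · rw [h.tableBox_eq, h.zero, h0]

end Represents

/-! ### Falsity is recursively enumerable -/

@[fun_prop] theorem primrec_entry {α : Type*} [Primcodable α] {T : α → List ℕ × ℕ} {o a b : α → ℕ}
    (hT : Primrec T) (ho : Primrec o) (ha : Primrec a) (hb : Primrec b) :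
    Primrec fun x => entry (T x) (o x) (a x) (b x) := by
  unfold entry
  fun_prop

theorem primrec_tableT : Primrec fun q : ((List ℕ × ℕ) × ℕ × ℕ) × ℕ => tableT q.1 q.2 :=
  primrec_treeRec 0 (by fun_prop)

theorem primrec_tableF : Primrec fun q : ((List ℕ × ℕ) × ℕ × ℕ) × ℕ => tableF q.1 q.2 := by
  have h := primrec_tableT
  refine primrec_treeRec 0 ?_
  have h1 : Primrec fun q : ((List ℕ × ℕ) × ℕ × ℕ) × ℕ × ℕ × ℕ × ℕ =>
      tableT q.1 (unpair (unpair q.2.1).2).1 :=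
    h.comp (g := fun q : ((List ℕ × ℕ) × ℕ × ℕ) × ℕ × ℕ × ℕ × ℕ =>
      (q.1, (unpair (unpair q.2.1).2).1)) (by fun_prop)
  have h2 : Primrec fun q : ((List ℕ × ℕ) × ℕ × ℕ) × ℕ × ℕ × ℕ × ℕ =>
      tableT q.1 (unpair (unpair q.2.1).2).2 :=
    h.comp (g := fun q : ((List ℕ × ℕ) × ℕ × ℕ) × ℕ × ℕ × ℕ × ℕ =>
      (q.1, (unpair (unpair q.2.1).2).2)) (by fun_prop)
  fun_prop

@[fun_prop] theorem primrec_tableF_comp {α : Type*} [Primcodable α] {T : α → List ℕ × ℕ}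
    {x y c : α → ℕ} (hT : Primrec T) (hx : Primrec x) (hy : Primrec y) (hc : Primrec c) :
    Primrec fun a => tableF (T a, x a, y a) (c a) :=
  primrec_tableF.comp (g := fun a => ((T a, x a, y a), c a)) (by fun_prop)

@[fun_prop] theorem primrec_tableNat {α : Type*} [Primcodable α] {T : α → List ℕ × ℕ} {m : α → ℕ}
    (hT : Primrec T) (hm : Primrec m) : Primrec fun a => tableNat (T a) (m a) := by
  unfold tableNat
  fun_prop

@[fun_prop] theorem primrec_tablePow {α : Type*} [Primcodable α] {T : α → List ℕ × ℕ} {t i : α → ℕ}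
    (hT : Primrec T) (ht : Primrec t) (hi : Primrec i) :
    Primrec fun a => tablePow (T a) (t a) (i a) := by
  unfold tablePow
  fun_prop

@[fun_prop] theorem primrec_digit {α : Type*} [Primcodable α] {b D i : α → ℕ}
    (hb : Primrec b) (hD : Primrec D) (hi : Primrec i) :
    Primrec fun a => digit (b a) (D a) (i a) := by
  unfold digit
  fun_prop

@[fun_prop] theorem primrec_tableDigits {α : Type*} [Primcodable α] {T : α → List ℕ × ℕ}
    {t b n D : α → ℕ} (hT : Primrec T) (ht : Primrec t) (hb : Primrec b) (hn : Primrec n)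
    (hD : Primrec D) : Primrec fun a => tableDigits (T a) (t a) (b a) (n a) (D a) := by
  unfold tableDigits
  fun_prop

@[fun_prop] theorem primrec_tableBox {α : Type*} [Primcodable α] {T : α → List ℕ × ℕ}
    {t b n D D' : α → ℕ} (hT : Primrec T) (ht : Primrec t) (hb : Primrec b) (hn : Primrec n)
    (hD : Primrec D) (hD' : Primrec D') :
    Primrec fun a => tableBox (T a) (t a) (b a) (n a) (D a) (D' a) := by
  unfold tableBox
  fun_prop

@[fun_prop] theorem primrec_testBound {α : Type*} [Primcodable α] {c B : α → ℕ}
    (hc : Primrec c) (hB : Primrec B) : Primrec fun a => testBound (c a) (B a) := by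
  unfold testBound
  fun_prop

@[fun_prop] theorem primrec_minBox {α : Type*} [Primcodable α] {c b : α → ℕ}
    (hc : Primrec c) (hb : Primrec b) : Primrec fun a => minBox (c a) (b a) := by
  unfold minBox rootBound
  fun_prop

@[fun_prop] theorem primrec_minGen {α : Type*} [Primcodable α] {c b B : α → ℕ}
    (hc : Primrec c) (hb : Primrec b) (hB : Primrec B) :
    Primrec fun a => minGen (c a) (b a) (B a) := by
  unfold minGen
  fun_prop

theorem primrecPred_isFieldTable : PrimrecPred IsFieldTable := by
  unfold IsFieldTable
  fun_prop

/-- The data of a certificate: a table, the element `t`, and the parameters. -/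
abbrev CertificateData : Type := (List ℕ × ℕ) × ℕ × ℕ × ℕ × ℕ × ℕ × ℕ × ℕ

theorem primrecPred_tableGeneric :
    PrimrecPred fun q : ℕ × CertificateData =>
      TableGeneric q.2.1 q.2.2.1 q.2.2.2.2.2.2.1 q.2.2.2.2.2.1 := by
  unfold TableGeneric
  fun_prop

theorem primrecPred_tableBoxFails :
    PrimrecPred fun q : ℕ × CertificateData => TableBoxFails q.2.1 q.2.2.1 q.1 q.2.2.2.2.1 := by
  unfold TableBoxFails
  fun_prop

theorem primrecPred_tableRefutation :
    PrimrecPred fun q : ℕ × CertificateData => TableRefutation q.2.1 q.2.2.1 q.2.2.2.1 q.2.2.2.2.1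
      q.2.2.2.2.2.1 q.2.2.2.2.2.2.1 q.2.2.2.2.2.2.2.1 q.2.2.2.2.2.2.2.2 q.1 := by
  have h1 := primrecPred_tableGeneric
  have h2 := primrecPred_tableBoxFails
  unfold TableRefutation TableLargeChar
  fun_prop

theorem rePred_not_valid : REPred fun c => ¬ Valid.{u} c := by
  have h : REPred fun c => ∃ w : CertificateData, IsFieldTable w.1 ∧ w.2.1 < w.1.2 ∧
      TableRefutation w.1 w.2.1 w.2.2.1 w.2.2.2.1 w.2.2.2.2.1 w.2.2.2.2.2.1 w.2.2.2.2.2.2.1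
        w.2.2.2.2.2.2.2 c := by
    refine rePred_exists ?_
    have h1 := primrecPred_isFieldTable
    have h2 := primrecPred_tableRefutation
    fun_prop
  refine h.of_eq fun c => ⟨?_, fun hc => ?_⟩
  · rintro ⟨⟨T, t, b, B, G, n, D, D'⟩, hT, ht, H⟩
    obtain ⟨k, _, _, e, he⟩ := exists_represents_of_isFieldTable hT
    obtain ⟨t, rfl⟩ := (he.range _).1 ht
    exact not_valid_of_finiteRefutation (he.finiteRefutation H)
  · obtain ⟨k, _, _, t, H⟩ := exists_finiteRefutation hc
    obtain ⟨T, e, he⟩ := exists_represents k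
    obtain ⟨b, B, G, n, D, D', H⟩ := he.exists_tableRefutation H
    exact ⟨(T, e t, b, B, G, n, D, D'), he.isFieldTable, he.lt t, H⟩

end InfiniteFields

theorem mainTheorem10 :
    ComputablePred fun k : ℕ =>
      ∃ ψ ∈ InfiniteFields.forallExistsTheory.{u}, InfiniteFields.sentenceCode ψ = k :=
  InfiniteFields.computablePred_theory InfiniteFields.rePred_valid InfiniteFields.rePred_not_valid
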